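/- Let $\hbar,m,\omega,\alpha>0$. On $L^2(\mathbb R)$ let $Q$ be the position operator, $(Q\psi)(x)=x\psi(x)$, and $P=-i\hbar\,\frac{d}{dx}$ the momentum operator, both on their maximal domains; let $H=\frac{P^2}{2m}+\frac{m\omega^2}{2}Q^2$ be the harmonic oscillator Hamiltonian, and $$Q'=Q+\alpha\Bigl(\frac{P^2}{2m}+\frac{m\omega^2}{2}Q^2-\frac{\hbar\omega}{2}\mathbf 1\Bigr),$$ all operators being taken on their natural domains. A *state* $\rho$ is a positive operator of trace one; an *observable* $\mathsf F$ is a normalized positive operator valued measure on $\mathbb R$, with outcome distributions $\mathsf F_\rho(X)=\operatorname{tr}(\rho\,\mathsf F(X))$. A *measurement scheme* $\mathcal M=(\mathcal K,\sigma,Z,U)$ consists of a probe Hilbert space $\mathcal K$, a state $\sigma$ on $\mathcal K$, a self-adjoint pointer operator $Z$ on $\mathcal K$ with spectral measure $\mathsf Z$, and a unitary $U$ on $L^2(\mathbb R)\otimes\mathcal K$. It *measures* the observable $\mathsf F$ if $\operatorname{tr}(\rho\,\mathsf F(X))=\operatorname{tr}\bigl((\rho\otimes\sigma)U^*(\mathbf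 1\otimes\mathsf Z(X))U\bigr)$ for all states $\rho$ and Borel sets $X$. The noise-operator error $\varepsilon_{\rm NO}(A,\mathcal M,\rho)\in[0,\infty]$ is defined by $$\varepsilon_{\rm NO}(A,\mathcal M,\rho)^2=\operatorname{tr}\Bigl((\rho\otimes\sigma)\bigl(U^*(\mathbf 1\otimes Z)U-A\otimes\mathbf 1\bigr)^2\Bigr).$$ Here, for a state $\tau$ and an unbounded operator $N$ (a difference being taken on the intersection of the domains), $\operatorname{tr}(\tau N^2)$ means the squared Hilbert–Schmidt norm of $N\tau^{1/2}$, and $\infty$ if the range of $\tau^{1/2}$ is not contained in the domain of $N$. Then $Q'$ is self-adjoint, $Q'$ and $Q$ have spectral measures, and $H$ has a ground state (a unit eigenvector for its lowest energy). Let $\mathsf C$ be the spectral measure of $Q'$, $\mathsf Q$ the spectral measure of $Q$, $\psi_0$ a ground state of $H$, and $\rho_0=|\psi_0\rangle\langle\psi_0|$. Then: 1. There is a measurement scheme that measures $\mathsf C$, and every measurement scheme $\mathcal M$ that measures $\mathsf C$ satisfies $$\varepsilon_{\rm NO}(Q,\mathcal M,\rho_0)^2=\bigl\langle (Q'-Q)^2\bigr\rangle_{\psi_0}=0.$$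 2. $\mathsf C$ has purely discrete spectrum (every point of the spectrum is isolated and is an eigenvalue of $Q'$ of finite multiplicity), while $\mathsf Q$ has purely continuous spectrum (no eigenvalues), which is all of $\mathbb R$. 3. For every state $\rho$ the distributions $\mathsf C_\rho$ and $\mathsf Q_\rho$ are different; indeed they are mutually singular: there is a countable set $S\subset\mathbb R$ with $\mathsf C_\rho(S)=1$ and $\mathsf Q_\rho(S)=0$. -/

import Mathlib

open MeasureTheory Topology UniformSpace
open scoped ENNReal NNReal TensorProduct SchwartzMap InnerProductSpace

universe u

noncomputable section

namespace QM

/-! ### Unbounded operators -/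

section Operators

variable {E F G : Type*} [AddCommGroup E] [Module ℂ E] [AddCommGroup F] [Module ℂ F]
  [AddCommGroup G] [Module ℂ G]

/-- The product `S T` of partially defined operators on its natural domain
`{x ∈ dom T | T x ∈ dom S}`. -/
def pcomp (S : F →ₗ.[ℂ] G) (T : E →ₗ.[ℂ] F) : E →ₗ.[ℂ] G where
  domain :=
    { carrier := {x | ∃ h : x ∈ T.domain, T ⟨x, h⟩ ∈ S.domain}
      zero_mem' := ⟨T.domain.zero_mem, by
        have h : T ⟨0, T.domain.zero_mem⟩ = 0 := T.map_zero
        rw [h]; exact S.domain.zero_mem⟩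
      add_mem' := by
        rintro x y ⟨hx, hx'⟩ ⟨hy, hy'⟩
        refine ⟨T.domain.add_mem hx hy, ?_⟩
        have h : T ⟨x + y, T.domain.add_mem hx hy⟩ = T ⟨x, hx⟩ + T ⟨y, hy⟩ :=
          T.map_add ⟨x, hx⟩ ⟨y, hy⟩
        rw [h]; exact S.domain.add_mem hx' hy'
      smul_mem' := by
        rintro c x ⟨hx, hx'⟩
        refine ⟨T.domain.smul_mem c hx, ?_⟩
        have h : T ⟨c • x, T.domain.smul_mem c hx⟩ = c • T ⟨x, hx⟩ :=
          T.map_smul c ⟨x, hx⟩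
        rw [h]; exact S.domain.smul_mem c hx' }
  toFun :=
    { toFun := fun x => S ⟨T ⟨x.1, x.2.1⟩, x.2.2⟩
      map_add' := fun x y => by
        rw [← S.map_add]
        congr 1
        exact Subtype.ext (T.map_add ⟨x.1, x.2.1⟩ ⟨y.1, y.2.1⟩)
      map_smul' := fun c x => by
        rw [RingHom.id_apply, ← S.map_smul]
        congr 1
        exact Subtype.ext (T.map_smul c ⟨x.1, x.2.1⟩) }

/-- An everywhere defined linear map, as a partially defined operator. -/
def total (L : E →ₗ[ℂ] F) : E →ₗ.[ℂ] F := L.toPMap ⊤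

end Operators

/-! ### States, observables, spectral measures -/

section Hilbert

variable {H : Type*} [NormedAddCommGroup H] [InnerProductSpace ℂ H] [CompleteSpace H]

variable (H) in
/-- The index set of a fixed Hilbert basis of `H`. -/
def basisIndex : Set H := (exists_hilbertBasis ℂ H).choose

variable (H) in
/-- A fixed Hilbert basis of `H`. The traces below do not depend on this choice. -/
def basis : HilbertBasis (basisIndex H) ℂ H := (exists_hilbertBasis ℂ H).choose_spec.choose

/-- The trace `∑ ⟪eᵢ, T eᵢ⟫` of a bounded (trace class) operator. -/
def trace (T : H →L[ℂ] H) : ℂ := ∑' i, inner ℂ (basis H i) (T (basis H i))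

variable (H) in
/-- A state: a positive operator of trace one. -/
structure DensityOperator where
  op : H →L[ℂ] H
  nonneg : 0 ≤ op
  trace_one : HasSum (fun i => inner ℂ (basis H i) (op (basis H i))) 1

/-- The pure state `|ψ⟩⟨ψ|` of a unit vector `ψ`. -/
def pureState (ψ : H) (hψ : ‖ψ‖ = 1) : DensityOperator H where
  op := InnerProductSpace.rankOne ℂ ψ ψ
  nonneg := by
    rw [ContinuousLinearMap.nonneg_iff_isPositive]
    exact InnerProductSpace.isPositive_rankOne_self ψ
  trace_one := by
    have h := (basis H).hasSum_inner_mul_inner ψ ψ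
    rw [inner_self_eq_norm_sq_to_K, hψ] at h
    simpa [InnerProductSpace.rankOne_apply, inner_smul_right] using h

variable (H) in
/-- A real-valued observable: a normalized positive operator valued measure on the Borel sets of
`ℝ` (extended by `0` to the sets that are not Borel). -/
structure Observable where
  toFun : Set ℝ → H →L[ℂ] H
  nonneg : ∀ X, 0 ≤ toFun X
  univ : toFun Set.univ = 1
  not_measurable : ∀ X, ¬ MeasurableSet X → toFun X = 0
  iUnion : ∀ f : ℕ → Set ℝ, (∀ n, MeasurableSet (f n)) → Pairwise (Function.onFun Disjoint f) →
    ∀ ψ : H, HasSum (fun n => toFun (f n) ψ) (toFun (⋃ n, f n) ψ)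

namespace Observable

set_option linter.unusedSectionVars false

/-- A sharp observable: all effects are projections. -/
def IsSharp (F : Observable H) : Prop := ∀ X, IsStarProjection (F.toFun X)

lemma re_inner_nonneg (F : Observable H) (X : Set ℝ) (ψ : H) :
    0 ≤ (inner ℂ ψ (F.toFun X ψ)).re :=
  ((ContinuousLinearMap.nonneg_iff_isPositive _).1 (F.nonneg X)).re_inner_nonneg_right ψ

lemma toFun_empty (F : Observable H) : F.toFun ∅ = 0 := by
  ext ψ
  have h := F.iUnion (fun _ => ∅) (fun _ => MeasurableSet.empty)
    (fun _ _ _ => by simp [Function.onFun]) ψ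
  have h2 := h.summable.tendsto_atTop_zero
  simpa using tendsto_nhds_unique tendsto_const_nhds h2

/-- The measure `X ↦ ⟪ψ, F(X) ψ⟫`. -/
def vectorMeasure (F : Observable H) (ψ : H) : Measure ℝ :=
  Measure.ofMeasurable (fun X _ => ENNReal.ofReal (inner ℂ ψ (F.toFun X ψ)).re)
    (by simp [F.toFun_empty])
    (by
      intro f hf hd
      have h : HasSum (fun n => (inner ℂ ψ (F.toFun (f n) ψ)).re)
          (inner ℂ ψ (F.toFun (⋃ n, f n) ψ)).re :=
        Complex.hasSum_re ((F.iUnion f hf hd ψ).mapL (innerSL ℂ ψ))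
      rw [← h.tsum_eq, ENNReal.ofReal_tsum_of_nonneg (fun n => F.re_inner_nonneg _ ψ) h.summable])

/-- `F` is the spectral measure of the operator `A`: `F` is projection valued and `A = ∫ x F(dx)`,
that is, `ψ ∈ dom A` iff `∫ x² ⟪ψ, F(dx) ψ⟫ < ∞`, and then `⟪ψ, A ψ⟫ = ∫ x ⟪ψ, F(dx) ψ⟫`. -/
structure IsSpectralMeasureOf (F : Observable H) (A : H →ₗ.[ℂ] H) : Prop where
  isSharp : F.IsSharp
  mem_domain_iff : ∀ ψ, ψ ∈ A.domain ↔ ∫⁻ x, ENNReal.ofReal (x ^ 2) ∂(F.vectorMeasure ψ) < ∞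
  inner_apply : ∀ ψ : A.domain,
    inner ℂ (ψ : H) (A ψ) = ((∫ x, x ∂(F.vectorMeasure (ψ : H)) : ℝ) : ℂ)

/-- The outcome distribution `F_ρ(X) = tr (ρ F(X))` of `F` in the state `ρ`. -/
def distribution (F : Observable H) (ρ : DensityOperator H) (X : Set ℝ) : ℝ :=
  (trace (ρ.op ∘L F.toFun X)).re

/-- The spectrum (support) of an observable: `x` belongs to it iff `F` does not vanish on any
neighbourhood of `x`. For the spectral measure of `A` this is the spectrum of `A`. -/
def spectrum (F : Observable H) : Set ℝ := {x | ∀ U ∈ 𝓝 x, IsOpen U → F.toFun U ≠ 0}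

/-- Purely discrete spectrum: every point of the spectrum is isolated in the spectrum
and is a value of finite multiplicity. -/
def HasPurelyDiscreteSpectrum (F : Observable H) : Prop :=
  ∀ x ∈ F.spectrum, (∃ ε > 0, ∀ y ∈ F.spectrum, |y - x| < ε → y = x) ∧
    F.toFun {x} ≠ 0 ∧ FiniteDimensional ℂ (F.toFun {x}).range

/-- Purely continuous spectrum: there are no eigenvalues. -/
def HasPurelyContinuousSpectrum (F : Observable H) : Prop := ∀ x, F.toFun {x} = 0

end Observable

/-- A ground state of `T`: a unit eigenvector for the lowest possible energy. -/
structure IsGroundState (T : H →ₗ.[ℂ] H) (ψ : H) : Prop where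
  norm_eq_one : ‖ψ‖ = 1
  exists_energy : ∃ (h : ψ ∈ T.domain) (E : ℝ), T ⟨ψ, h⟩ = (E : ℂ) • ψ ∧
    ∀ φ : T.domain, E * ‖(φ : H)‖ ^ 2 ≤ (inner ℂ (φ : H) (T φ)).re

open scoped Classical in
/-- The expectation `⟨N²⟩_ρ = tr (ρ N²)` of the square of a (symmetric, possibly unbounded) operator
`N` in the state with density operator `ρ`, as the sum `∑ ‖N √ρ eᵢ‖²`, that is, the squared
Hilbert-Schmidt norm of `N √ρ`; it is `∞` unless `√ρ` maps into the domain of `N`. -/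
def secondMoment (ρ : H →L[ℂ] H) (N : H →ₗ.[ℂ] H) : ℝ≥0∞ :=
  if h : ∀ x, CFC.sqrt ρ x ∈ N.domain then ∑' i, ‖N ⟨CFC.sqrt ρ (basis H i), h _⟩‖ₑ ^ 2 else ∞

end Hilbert

/-! ### Measurement schemes and the noise-operator error -/

section Measurement

variable {H : Type*} [NormedAddCommGroup H] [InnerProductSpace ℂ H]
  {K : Type*} [NormedAddCommGroup K] [InnerProductSpace ℂ K]

variable (H K) in
/-- The Hilbert space tensor product. -/
abbrev HilbertTensor : Type _ := Completion (H ⊗[ℂ] K)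

/-- The elementary tensor `ψ ⊗ φ`. -/
def tmul (ψ : H) (φ : K) : HilbertTensor H K := ((ψ ⊗ₜ[ℂ] φ : H ⊗[ℂ] K) : Completion (H ⊗[ℂ] K))

/-- The tensor product `A ⊗ B` of bounded operators. -/
def tensorOp (A : H →L[ℂ] H) (B : K →L[ℂ] K) : HilbertTensor H K →L[ℂ] HilbertTensor H K :=
  (TensorProduct.mapL A B).completion

/-- The operator `A ⊗ 1` for a densely defined closable operator `A`: the closure of
its algebraic version, which acts on the span of the `ψ ⊗ φ` with `ψ ∈ dom A`. -/
def tensorOne (A : H →ₗ.[ℂ] H) : HilbertTensor H K →ₗ.[ℂ] HilbertTensor H K :=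
  (Submodule.span ℂ {p : HilbertTensor H K × HilbertTensor H K |
    ∃ (ψ : A.domain) (φ : K), p = (tmul (ψ : H) φ, tmul (A ψ) φ)}).topologicalClosure.toLinearPMap

/-- The operator `1 ⊗ Z` for a densely defined closable operator `Z`: the closure of
its algebraic version, which acts on the span of the `ψ ⊗ φ` with `φ ∈ dom Z`. -/
def oneTensor (Z : K →ₗ.[ℂ] K) : HilbertTensor H K →ₗ.[ℂ] HilbertTensor H K :=
  (Submodule.span ℂ {p : HilbertTensor H K × HilbertTensor H K |
    ∃ (ψ : H) (φ : Z.domain), p = (tmul ψ (φ : K), tmul ψ (Z φ))}).topologicalClosure.toLinearPMap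

variable [CompleteSpace H]

universe v

/-- A measurement scheme for a system with Hilbert space `H`: a probe system with Hilbert space `K`
in a fixed initial state `σ`, a self-adjoint pointer operator `Z` on `K` with its spectral measure,
and a unitary coupling `U` of system and probe. -/
structure MeasurementScheme (H : Type v) [NormedAddCommGroup H] [InnerProductSpace ℂ H]
    [CompleteSpace H] where
  K : Type u
  [normedAddCommGroup : NormedAddCommGroup K]
  [innerProductSpace : InnerProductSpace ℂ K]
  [completeSpace : CompleteSpace K]
  σ : DensityOperator K
  Z : K →ₗ.[ℂ] K
  pointer : Observable K
  isSpectralMeasure : pointer.IsSpectralMeasureOf Z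
  U : HilbertTensor H K ≃ₗᵢ[ℂ] HilbertTensor H K

namespace MeasurementScheme

attribute [instance] normedAddCommGroup innerProductSpace completeSpace

variable (M : MeasurementScheme H)

/-- `F` is the observable measured by the scheme:
`tr (ρ F(X)) = tr ((ρ ⊗ σ) U* (1 ⊗ Z(X)) U)` for all states `ρ` and outcome sets `X`. -/
def Measures (F : Observable H) : Prop :=
  ∀ (ρ : DensityOperator H) (X : Set ℝ), MeasurableSet X →
    trace (ρ.op ∘L F.toFun X) =
      trace (tensorOp ρ.op M.σ.op ∘L (M.U.symm : HilbertTensor H M.K →L[ℂ] HilbertTensor H M.K) ∘L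
        tensorOp 1 (M.pointer.toFun X) ∘L (M.U : HilbertTensor H M.K →L[ℂ] HilbertTensor H M.K))

/-- The output operator `U* (1 ⊗ Z) U`. -/
def outputOp : HilbertTensor H M.K →ₗ.[ℂ] HilbertTensor H M.K :=
  pcomp (total M.U.symm.toLinearEquiv.toLinearMap)
    (pcomp (oneTensor M.Z) (total M.U.toLinearEquiv.toLinearMap))

/-- The noise operator `U* (1 ⊗ Z) U - A ⊗ 1`. -/
def noiseOp (A : H →ₗ.[ℂ] H) : HilbertTensor H M.K →ₗ.[ℂ] HilbertTensor H M.K :=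
  M.outputOp - tensorOne A

end MeasurementScheme

/-- The noise-operator based error `ε_NO(A, M, ρ)`, the square root of
`tr ((ρ ⊗ σ) (U* (1 ⊗ Z) U - A ⊗ 1)²)`. -/
def noError (A : H →ₗ.[ℂ] H) (M : MeasurementScheme H) (ρ : DensityOperator H) : ℝ≥0∞ :=
  (secondMoment (tensorOp ρ.op M.σ.op) (M.noiseOp A)) ^ (1 / 2 : ℝ)

end Measurement

/-! ### Position, momentum, the harmonic oscillator -/

/-- The Hilbert space `L²(ℝ)` of a particle on the line. -/
abbrev L2R : Type := Lp ℂ 2 (volume : Measure ℝ)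

/-- The position operator `(Q ψ)(x) = x ψ(x)` on its maximal domain. -/
def position : L2R →ₗ.[ℂ] L2R where
  domain :=
    { carrier := {ψ | MemLp (fun x : ℝ => (x : ℂ) * ψ x) 2 volume}
      zero_mem' := by
        refine (memLp_congr_ae ?_).2 (MemLp.zero (ε := ℂ))
        filter_upwards [Lp.coeFn_zero ℂ 2 (volume : Measure ℝ)] with x hx
        rw [hx, Pi.zero_apply, mul_zero]
      add_mem' := by
        intro ψ φ hψ hφ
        refine (memLp_congr_ae ?_).2 (MemLp.add hψ hφ)
        filter_upwards [Lp.coeFn_add ψ φ] with x hx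
        rw [Pi.add_apply, hx, Pi.add_apply, mul_add]
      smul_mem' := by
        intro c ψ hψ
        refine (memLp_congr_ae ?_).2 (MemLp.const_smul hψ c)
        filter_upwards [Lp.coeFn_smul c ψ] with x hx
        simp [hx, mul_left_comm] }
  toFun :=
    { toFun := fun ψ => MemLp.toLp (fun x : ℝ => (x : ℂ) * (ψ : L2R) x) ψ.2
      map_add' := by
        intro ψ φ
        rw [← MemLp.toLp_add, MemLp.toLp_eq_toLp_iff]
        filter_upwards [Lp.coeFn_add (ψ : L2R) (φ : L2R)] with x hx
        rw [Pi.add_apply, Submodule.coe_add, hx, Pi.add_apply, mul_add]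
      map_smul' := by
        intro c ψ
        rw [RingHom.id_apply, ← MemLp.toLp_const_smul, MemLp.toLp_eq_toLp_iff]
        filter_upwards [Lp.coeFn_smul c (ψ : L2R)] with x hx
        simp [hx, mul_left_comm] }

/-- A Schwartz function as an element of `L²(ℝ)`. -/
def schwartz (g : 𝓢(ℝ, ℂ)) : L2R := g.toLp 2 volume

/-- The momentum operator `P = -iħ d/dx`, with the derivative in the weak sense, on its maximal
domain: `ψ ∈ dom P` and `P ψ = χ` iff `χ ∈ L²(ℝ)` is the weak derivative of `ψ` times `-iħ`, that
is, `∫ conj(g) χ = ∫ conj(-iħ g') ψ` for all test functions `g`. -/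
def momentum (ħ : ℝ) : L2R →ₗ.[ℂ] L2R :=
  Submodule.toLinearPMap
    { carrier := {p | ∀ g : 𝓢(ℝ, ℂ), inner ℂ (schwartz g) p.2 =
        inner ℂ ((-Complex.I * ħ) • schwartz (SchwartzMap.derivCLM ℂ ℂ g)) p.1}
      zero_mem' := fun g => by simp
      add_mem' := by
        intro p q hp hq g
        rw [Prod.snd_add, Prod.fst_add, inner_add_right, inner_add_right, hp g, hq g]
      smul_mem' := by
        intro c p hp g
        rw [Prod.smul_snd, Prod.smul_fst, inner_smul_right, inner_smul_right, hp g] }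

/-- The Hamiltonian `P²/2m + (mω²/2) Q²` of the harmonic oscillator. -/
def oscillator (ħ m ω : ℝ) : L2R →ₗ.[ℂ] L2R :=
  ((1 / (2 * m) : ℝ) : ℂ) • pcomp (momentum ħ) (momentum ħ) +
    ((m * ω ^ 2 / 2 : ℝ) : ℂ) • pcomp position position

/-- The operator `Q' = Q + α (P²/2m + (mω²/2) Q² - (ħω/2) 1)`. -/
def perturbedPosition (ħ m ω α : ℝ) : L2R →ₗ.[ℂ] L2R :=
  position + (α : ℂ) • (oscillator ħ m ω - ((ħ * ω / 2 : ℝ) : ℂ) • total LinearMap.id)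

end QM

end

/-!
Completing the square in position, `Q' = Q + α (H - ħω/2)` is, up to an additive constant, `α` times
the Hamiltonian of an oscillator of the same mass and frequency that is centred at
`a = -1 / (α m ω²)`. Hence `Q'`, like `H`, is diagonal in a basis of Hermite functions (those centred
at `a`, and at `0` for `H`), with simple eigenvalues that grow linearly. On a ground state of `H`, on
the other hand, `H - ħω/2` vanishes, so that `Q' ψ₀ = Q ψ₀`.

The analytic part is the proof that the operators, on their natural domains, are the maximal
diagonal operators `IsDiagonal` for these bases (`isDiagonal_oscillator`,
`isDiagonal_perturbedPosition`). The Hermite functions are complete because a function orthogonal to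
all of them, multiplied by the Gaussian, has vanishing moments and decays faster than every
exponential, so its Fourier transform vanishes (`eq_zero_of_inner_hermiteFun`). Symmetry against
Schwartz functions bounds the natural domain from above. In the other direction, `P` and `Q` are
closed and act on the basis as combinations of creation and annihilation operators, so a vector whose
coefficients are square summable with weight `n²` lies in the domains of `P²` and `Q²`
(`IsLadder.mem_domain_pcomp`). Self-adjointness, the spectral measure and the discreteness of the
spectrum then follow from `IsDiagonal`, and the ground states of `H` from the list of its eigenvalues.

A scheme that measures the spectral measure `C` of `Q'` has vanishing error as a measurement of `Q`
in the state `ψ₀` for the following reason. If the system starts in an eigenvector `e` of `Q'` for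
`λ`, then the outcome `λ` is certain, so `1 ⊗ Z({λ})` fixes `U (e ⊗ √σ k)` for every probe vector `k`
(`MeasurementScheme.event_tmul`): the output operator acts on `e ⊗ √σ k` as multiplication by `λ`. As
`1 ⊗ Z` is closed, expanding in eigenvectors gives `U* (1 ⊗ Z) U (ψ ⊗ √σ k) = Q' ψ ⊗ √σ k` on the
domain of `Q'` (`MeasurementScheme.mem_graph_of_measures`). For `ψ = ψ₀` this is `Q ψ₀ ⊗ √σ k`, so the
noise operator annihilates the range of the square root of the initial state
(`MeasurementScheme.noError_eq_zero`). Such schemes exist: a swap hands the system over to a probe on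
which `Q'` is the pointer (`MeasurementScheme.exists_measures`).

Finally, the position distribution of every state is absolutely continuous, while `C` is concentrated
on the countable set of eigenvalues of `Q'`, which separates the two distributions.
-/

namespace QM

/-! ### Spectral measures -/

lemma integrable_id_of_lintegral_sq {μ : Measure ℝ} [IsFiniteMeasure μ]
    (h : ∫⁻ x, ENNReal.ofReal (x ^ 2) ∂μ < ∞) : Integrable (fun x : ℝ => x) μ := by
  have h2 : MemLp (fun x : ℝ => x) 2 μ := by
    refine ⟨measurable_id.aestronglyMeasurable, ?_⟩
    rw [eLpNorm_lt_top_iff_lintegral_rpow_enorm_lt_top (by norm_num) (by norm_num)]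
    refine lt_of_eq_of_lt (lintegral_congr fun x => ?_) h
    rw [← ofReal_norm, ENNReal.toReal_ofNat, ENNReal.rpow_ofNat,
      ← ENNReal.ofReal_pow (norm_nonneg _), Real.norm_eq_abs, sq_abs]
  exact h2.integrable (by norm_num)

section Spectral

variable {H : Type*} [NormedAddCommGroup H] [InnerProductSpace ℂ H]

lemma inner_self_eq_ofReal (x : H) : inner ℂ x x = ((‖x‖ ^ 2 : ℝ) : ℂ) := by
  rw [inner_self_eq_norm_sq_to_K]; norm_cast

/-- Polarization: a pair on which a sesquilinear form behaves additively on the diagonal is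
orthogonal for the form. -/
lemma inner_eq_zero_of_diagonal_additive {D : Submodule ℂ H} (f : D →ₗ[ℂ] H) (u v : D)
    (h1 : inner ℂ ((u + v : D) : H) (f (u + v)) = inner ℂ (u : H) (f u) + inner ℂ (v : H) (f v))
    (h2 : inner ℂ ((u + Complex.I • v : D) : H) (f (u + Complex.I • v)) =
      inner ℂ (u : H) (f u) + inner ℂ (v : H) (f v)) :
    inner ℂ (u : H) (f v) = 0 := by
  simp only [map_add, map_smul, Submodule.coe_add, Submodule.coe_smul, inner_add_left,
    inner_add_right, inner_smul_left, inner_smul_right, Complex.conj_I] at h1 h2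
  linear_combination (1 / 2 : ℂ) * h1 + (-Complex.I / 2) * h2 +
    (1 / 2 * inner ℂ (u : H) (f v) - 1 / 2 * inner ℂ (v : H) (f u)
      - Complex.I / 2 * inner ℂ (v : H) (f v)) * Complex.I_sq

/-- Polarization: a linear map with real quadratic form is symmetric. -/
lemma inner_symm_of_quadratic_real {D : Submodule ℂ H} (f : D →ₗ[ℂ] H)
    (h : ∀ w : D, (inner ℂ (w : H) (f w)).im = 0) (u v : D) :
    inner ℂ (u : H) (f v) = inner ℂ (f u) (v : H) := by
  rw [← inner_conj_symm (f u)]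
  have h1 := h (u + v)
  have h2 := h (u + Complex.I • v)
  simp only [map_add, map_smul, Submodule.coe_add, Submodule.coe_smul, inner_add_left,
    inner_add_right, inner_smul_left, inner_smul_right, Complex.conj_I, Complex.add_im,
    Complex.add_re, Complex.mul_im, Complex.mul_re, Complex.neg_re, Complex.neg_im, Complex.I_re,
    Complex.I_im, h u, h v] at h1 h2
  apply Complex.ext
  · rw [Complex.conj_re]; linarith
  · rw [Complex.conj_im]; linarith

variable [CompleteSpace H]

namespace Observable

lemma toFun_union (F : Observable H) {X Y : Set ℝ} (hX : MeasurableSet X) (hY : MeasurableSet Y)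
    (hd : Disjoint X Y) : F.toFun (X ∪ Y) = F.toFun X + F.toFun Y := by
  ext ψ
  have h := F.iUnion (fun n => Nat.casesOn n X (fun m => Nat.casesOn m Y (fun _ => ∅)))
    (by rintro (_ | _ | _) <;> simp [hX, hY])
    (by
      rintro (_ | _ | _) (_ | _ | _) hij <;> simp_all [Function.onFun, disjoint_comm]) ψ
  have hU : (⋃ n : ℕ, (Nat.casesOn n X (fun m => Nat.casesOn m Y (fun _ => ∅)) : Set ℝ))
      = X ∪ Y := by
    ext x
    simp only [Set.mem_iUnion, Set.mem_union]
    constructor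
    · rintro ⟨_ | _ | _, hn⟩
      · exact Or.inl hn
      · exact Or.inr hn
      · exact hn.elim
    · rintro (hx | hx)
      · exact ⟨0, hx⟩
      · exact ⟨1, hx⟩
  rw [hU] at h
  refine h.unique ?_
  have h2 := hasSum_sum_of_ne_finset_zero (s := {0, 1}) (f := fun n : ℕ =>
    F.toFun (Nat.casesOn n X (fun m => Nat.casesOn m Y (fun _ => ∅))) ψ) (L := .unconditional ℕ)
    (by rintro (_ | _ | _) hn <;> simp_all [F.toFun_empty])
  simpa using h2

lemma toFun_compl (F : Observable H) {X : Set ℝ} (hX : MeasurableSet X) :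
    F.toFun Xᶜ = 1 - F.toFun X := by
  rw [eq_sub_iff_add_eq', ← F.toFun_union hX hX.compl disjoint_compl_right, Set.union_compl_self,
    F.univ]

lemma vectorMeasure_apply (F : Observable H) (ψ : H) {X : Set ℝ} (hX : MeasurableSet X) :
    F.vectorMeasure ψ X = ENNReal.ofReal (inner ℂ ψ (F.toFun X ψ)).re :=
  Measure.ofMeasurable_apply X hX

instance (F : Observable H) (ψ : H) : IsFiniteMeasure (F.vectorMeasure ψ) :=
  ⟨by rw [vectorMeasure_apply _ _ .univ]; exact ENNReal.ofReal_lt_top⟩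

lemma measureReal_vectorMeasure (F : Observable H) (ψ : H) {X : Set ℝ} (hX : MeasurableSet X) :
    (F.vectorMeasure ψ).real X = (inner ℂ ψ (F.toFun X ψ)).re := by
  rw [measureReal_def, vectorMeasure_apply _ _ hX, ENNReal.toReal_ofReal (F.re_inner_nonneg _ _)]

namespace IsSharp

variable {F : Observable H} (hs : F.IsSharp)
include hs

lemma inner_toFun (X : Set ℝ) (u v : H) : inner ℂ (F.toFun X u) v = inner ℂ u (F.toFun X v) := by
  have h := (hs X).isSelfAdjoint
  rw [← ContinuousLinearMap.adjoint_inner_right, ← ContinuousLinearMap.star_eq_adjoint, h.star_eq]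

lemma toFun_toFun_self (X : Set ℝ) (u : H) : F.toFun X (F.toFun X u) = F.toFun X u :=
  congrArg (· u) (hs X).isIdempotentElem.eq

/-- For projections `P` and `R` whose sum is a projection, `P R + R P = 0`. Multiplication by `P` on
either side shows that `P` and `R` commute, so their product vanishes. -/
lemma mul_eq_zero {X Y : Set ℝ} (hX : MeasurableSet X) (hY : MeasurableSet Y)
    (hd : Disjoint X Y) : F.toFun X * F.toFun Y = 0 := by
  have h := (hs (X ∪ Y)).isIdempotentElem.eq
  have hx := (hs X).isIdempotentElem.eq
  have hy := (hs Y).isIdempotentElem.eq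
  rw [F.toFun_union hX hY hd] at h
  set P := F.toFun X
  set R := F.toFun Y
  have h1 : P * R + R * P = 0 := by
    have : (P + R) * (P + R) = P * P + R * R + (P * R + R * P) := by noncomm_ring
    rw [this, hx, hy] at h
    simpa using h
  have h2 : P * R = R * P := by
    have e1 : P * R + P * (R * P) = 0 := by
      have := congrArg (P * ·) h1
      simp only [mul_add, mul_zero, ← mul_assoc, hx] at this
      simpa [mul_assoc] using this
    have e2 : P * (R * P) + R * P = 0 := by
      have := congrArg (· * P) h1
      simp only [add_mul, zero_mul, mul_assoc, hx] at this
      exact this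
    exact (eq_neg_of_add_eq_zero_left e1).trans (eq_neg_of_add_eq_zero_right e2).symm
  rw [← h2, ← two_smul ℂ] at h1
  exact (smul_eq_zero.1 h1).resolve_left two_ne_zero

lemma mul_toFun {X Y : Set ℝ} (hX : MeasurableSet X) (hY : MeasurableSet Y) :
    F.toFun X * F.toFun Y = F.toFun (X ∩ Y) := by
  have e1 : F.toFun X = F.toFun (X ∩ Y) + F.toFun (X \ Y) := by
    rw [← F.toFun_union (hX.inter hY) (hX.diff hY) Set.disjoint_sdiff_inter.symm,
      Set.inter_union_sdiff]
  have e2 : F.toFun Y = F.toFun (X ∩ Y) + F.toFun (Y \ X) := by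
    rw [Set.inter_comm, ← F.toFun_union (hY.inter hX) (hY.diff hX) Set.disjoint_sdiff_inter.symm,
      Set.inter_union_sdiff]
  have h1 := hs.mul_eq_zero (hX.diff hY) hY Set.disjoint_sdiff_left
  have h2 := hs.mul_eq_zero (hX.inter hY) (hY.diff hX)
    (Set.disjoint_sdiff_right.mono_left Set.inter_subset_left)
  rw [e1, add_mul, h1, add_zero]
  conv_lhs => rw [e2]
  rw [mul_add, h2, add_zero, (hs _).isIdempotentElem.eq]

lemma toFun_toFun {X Y : Set ℝ} (hX : MeasurableSet X) (hY : MeasurableSet Y) (ψ : H) :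
    F.toFun X (F.toFun Y ψ) = F.toFun (X ∩ Y) ψ :=
  congrArg (· ψ) (hs.mul_toFun hX hY)

lemma inner_toFun_self (X : Set ℝ) (ψ : H) :
    inner ℂ ψ (F.toFun X ψ) = ((‖F.toFun X ψ‖ ^ 2 : ℝ) : ℂ) := by
  rw [← hs.toFun_toFun_self X ψ, ← hs.inner_toFun, hs.toFun_toFun_self,
    inner_self_eq_ofReal]

lemma vectorMeasure_apply {X : Set ℝ} (hX : MeasurableSet X) (ψ : H) :
    F.vectorMeasure ψ X = ‖F.toFun X ψ‖ₑ ^ 2 := by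
  rw [F.vectorMeasure_apply _ hX, hs.inner_toFun_self, Complex.ofReal_re,
    ENNReal.ofReal_pow (norm_nonneg _), ofReal_norm]

lemma vectorMeasure_toFun {X : Set ℝ} (hX : MeasurableSet X) (ψ : H) :
    F.vectorMeasure (F.toFun X ψ) = (F.vectorMeasure ψ).restrict X := by
  ext Y hY
  rw [Measure.restrict_apply hY, hs.vectorMeasure_apply hY, hs.vectorMeasure_apply (hY.inter hX),
    hs.toFun_toFun hY hX]

/-- Vectors in complementary spectral subspaces have additive outcome distributions. -/
lemma vectorMeasure_add {X : Set ℝ} (hX : MeasurableSet X) {u v : H} (hu : F.toFun X u = u)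
    (hv : F.toFun Xᶜ v = v) :
    F.vectorMeasure (u + v) = F.vectorMeasure u + F.vectorMeasure v := by
  have key (Y : Set ℝ) (hY : MeasurableSet Y) : inner ℂ u (F.toFun Y v) = 0 := by
    rw [← hu, ← hv, hs.toFun_toFun hY hX.compl, hs.inner_toFun,
      hs.toFun_toFun hX (hY.inter hX.compl)]
    have : X ∩ (Y ∩ Xᶜ) = ∅ := by ext; simp; tauto
    rw [this, F.toFun_empty]; simp
  ext Y hY
  rw [Measure.add_apply, F.vectorMeasure_apply _ hY, F.vectorMeasure_apply _ hY,
    F.vectorMeasure_apply _ hY, ← ENNReal.ofReal_add (F.re_inner_nonneg _ _)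
    (F.re_inner_nonneg _ _)]
  congr 1
  have k2 : inner ℂ v (F.toFun Y u) = 0 := by
    rw [← hs.inner_toFun, ← inner_conj_symm, key Y hY, map_zero]
  rw [map_add, inner_add_left, inner_add_right, inner_add_right, key Y hY, k2]
  simp

end IsSharp

namespace IsSpectralMeasureOf

variable {F : Observable H} {A : H →ₗ.[ℂ] H} (hF : F.IsSpectralMeasureOf A)
include hF

lemma symm (u v : A.domain) : inner ℂ (u : H) (A v) = inner ℂ (A u) (v : H) :=
  inner_symm_of_quadratic_real A.toFun (fun w => by
    have := hF.inner_apply w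
    change (inner ℂ (w : H) (A w)).im = 0
    rw [this, Complex.ofReal_im]) u v

lemma toFun_mem_domain {X : Set ℝ} (hX : MeasurableSet X) {ψ : H} (hψ : ψ ∈ A.domain) :
    F.toFun X ψ ∈ A.domain := by
  rw [hF.mem_domain_iff] at hψ ⊢
  rw [hF.isSharp.vectorMeasure_toFun hX]
  exact (setLIntegral_le_lintegral _ _).trans_lt hψ

lemma toFun_mem_domain_of_bounded {X : Set ℝ} (hX : MeasurableSet X) {R : ℝ}
    (hR : ∀ x ∈ X, |x| ≤ R) (ψ : H) : F.toFun X ψ ∈ A.domain := by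
  rw [hF.mem_domain_iff, hF.isSharp.vectorMeasure_toFun hX]
  calc ∫⁻ x in X, ENNReal.ofReal (x ^ 2) ∂(F.vectorMeasure ψ)
      ≤ ∫⁻ x in X, ENNReal.ofReal (R ^ 2) ∂(F.vectorMeasure ψ) := by
        refine setLIntegral_mono' hX fun x hx => ENNReal.ofReal_le_ofReal ?_
        exact sq_le_sq' (by linarith [neg_abs_le x, hR x hx]) ((le_abs_self x).trans (hR x hx))
    _ < ∞ := by
        rw [setLIntegral_const]
        exact ENNReal.mul_lt_top ENNReal.ofReal_lt_top (measure_lt_top _ _)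

lemma dense_domain : Dense (A.domain : Set H) := by
  intro ψ
  -- The spectral subspaces of the bounded sets `n ≤ |x| < n + 1` lie in the domain.
  have h := F.iUnion (fun n : ℕ => {x : ℝ | ⌊|x|⌋₊ = n})
    (fun n => (Nat.measurable_floor.comp measurable_norm) (measurableSet_singleton n))
    (fun i j hij => Set.disjoint_left.2 fun x hi hj => hij (hi.symm.trans hj)) ψ
  have hU : (⋃ n : ℕ, {x : ℝ | ⌊|x|⌋₊ = n}) = Set.univ := by
    ext x; simp
  rw [hU, F.univ] at h
  refine mem_closure_of_tendsto h (Filter.Eventually.of_forall fun s => ?_)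
  refine Submodule.sum_mem _ fun n _ => ?_
  refine hF.toFun_mem_domain_of_bounded
    ((Nat.measurable_floor.comp measurable_norm) (measurableSet_singleton n)) (R := n + 1)
    (fun x hx => ?_) ψ
  have : ⌊|x|⌋₊ = n := hx
  rw [← this]; exact (Nat.lt_floor_add_one _).le

lemma integrable_id {ψ : H} (hψ : ψ ∈ A.domain) :
    Integrable (fun x : ℝ => x) (F.vectorMeasure ψ) :=
  integrable_id_of_lintegral_sq ((hF.mem_domain_iff ψ).1 hψ)

/-- The operator does not connect complementary spectral subspaces. -/
lemma inner_eq_zero {X : Set ℝ} (hX : MeasurableSet X) (u v : A.domain)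
    (hu : F.toFun X u = u) (hv : F.toFun Xᶜ v = v) : inner ℂ (u : H) (A v) = 0 := by
  -- The outcome distribution of `u + s v` does not depend on the phase `s`.
  have key (s : ℂ) (hs : ‖s‖ = 1) : inner ℂ ((u + s • v : A.domain) : H) (A (u + s • v)) =
      inner ℂ (u : H) (A u) + inner ℂ (v : H) (A v) := by
    have hv' : F.toFun Xᶜ (s • (v : H)) = s • (v : H) := by rw [map_smul, hv]
    have hm : F.vectorMeasure (s • (v : H)) = F.vectorMeasure v := by
      ext Y hY
      rw [hF.isSharp.vectorMeasure_apply hY, hF.isSharp.vectorMeasure_apply hY, map_smul,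
        enorm_smul, ← ofReal_norm, hs]
      simp
    rw [hF.inner_apply, hF.inner_apply, hF.inner_apply, Submodule.coe_add, Submodule.coe_smul,
      hF.isSharp.vectorMeasure_add hX hu hv', hm,
      integral_add_measure (hF.integrable_id u.2) (hF.integrable_id v.2)]
    push_cast; ring
  refine inner_eq_zero_of_diagonal_additive A.toFun u v ?_ (key _ Complex.norm_I)
  simpa using key 1 (by simp)

lemma inner_toFun_apply {X : Set ℝ} (hX : MeasurableSet X) (ψ : A.domain) :
    inner ℂ (F.toFun X ψ) (A ψ) = ((∫ x in X, x ∂(F.vectorMeasure (ψ : H)) : ℝ) : ℂ) := by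
  have hd := hF.toFun_mem_domain hX ψ.2
  have hd' := hF.toFun_mem_domain hX.compl ψ.2
  have e : ψ = ⟨_, hd⟩ + ⟨_, hd'⟩ := by
    ext1
    simp [F.toFun_compl hX]
  have h0 := hF.inner_eq_zero hX ⟨_, hd⟩ ⟨_, hd'⟩ (hF.isSharp.toFun_toFun_self _ _)
    (hF.isSharp.toFun_toFun_self _ _)
  have h1 := hF.inner_apply ⟨_, hd⟩
  conv_lhs => rw [e, A.map_add, inner_add_right]
  rw [← e, h0, add_zero, h1, hF.isSharp.vectorMeasure_toFun hX]

/-- The outcome of measuring an observable in an eigenstate is the eigenvalue. -/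
lemma toFun_singleton_of_eigenvector (e : A.domain) (l : ℝ) (he : A e = (l : ℂ) • (e : H)) :
    F.toFun {l} e = e := by
  have h0 : (fun x : ℝ => x - l) =ᵐ[F.vectorMeasure e] 0 := by
    refine Integrable.ae_eq_zero_of_forall_setIntegral_eq_zero
      ((hF.integrable_id e.2).sub (integrable_const l)) fun X hX _ => ?_
    rw [integral_sub (hF.integrable_id e.2).integrableOn (integrable_const l).integrableOn,
      setIntegral_const]
    have h1 := hF.inner_toFun_apply hX e
    rw [he, inner_smul_right, hF.isSharp.inner_toFun, hF.isSharp.inner_toFun_self] at h1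
    have h2 := F.measureReal_vectorMeasure e hX
    rw [hF.isSharp.inner_toFun_self, Complex.ofReal_re] at h2
    rw [h2, smul_eq_mul, sub_eq_zero]
    rw [← Complex.ofReal_mul, Complex.ofReal_inj] at h1
    rw [← h1, mul_comm]
  have h1 : F.vectorMeasure e {l}ᶜ = 0 := by
    rw [Filter.EventuallyEq, ae_iff] at h0
    convert h0 using 2
    ext x
    simp [sub_eq_zero]
  rw [hF.isSharp.vectorMeasure_apply (measurableSet_singleton l).compl,
    F.toFun_compl (measurableSet_singleton l)] at h1
  have h2 : ‖(e : H) - F.toFun {l} e‖ₑ = 0 := by simpa using h1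
  exact (sub_eq_zero.1 (enorm_eq_zero.1 h2)).symm

/-- Conversely, the spectral subspace of a point consists of eigenvectors. -/
lemma eigenvector_of_toFun_singleton (l : ℝ) {e : H} (he : F.toFun {l} e = e) :
    ∃ h : e ∈ A.domain, A ⟨e, h⟩ = (l : ℂ) • e := by
  have hm := measurableSet_singleton l
  have hd : ∀ w, F.toFun {l} w ∈ A.domain := fun w =>
    hF.toFun_mem_domain_of_bounded hm (R := |l|) (by simp) w
  have hed : e ∈ A.domain := he ▸ hd e
  refine ⟨hed, ?_⟩
  have quad (w : A.domain) (hw : F.toFun {l} w = w) :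
      inner ℂ (w : H) (A.toFun w - (l : ℂ) • (w : H)) = 0 := by
    have h1 := hF.inner_apply w
    rw [inner_sub_right, inner_smul_right]
    change inner ℂ (w : H) (A w) - _ = _
    have h2 := F.measureReal_vectorMeasure w hm
    rw [hw] at h2
    have h3 : F.vectorMeasure w = (F.vectorMeasure w).restrict {l} := by
      rw [← hF.isSharp.vectorMeasure_toFun hm, hw]
    rw [h1, h3, integral_singleton, h2, inner_self_eq_ofReal, Complex.ofReal_re, smul_eq_mul]
    push_cast; ring
  let f : A.domain →ₗ[ℂ] H := A.toFun - (l : ℂ) • A.domain.subtype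
  have hf (w : A.domain) : f w = A.toFun w - (l : ℂ) • (w : H) := rfl
  rw [← sub_eq_zero]
  refine hF.dense_domain.eq_zero_of_inner_right ℂ fun φ hφd => ?_
  have hu := hd φ
  have hv := hF.toFun_mem_domain hm.compl hφd
  have hφ : (φ : H) = F.toFun {l} φ + F.toFun {l}ᶜ φ := by simp [F.toFun_compl hm]
  rw [hφ, inner_add_left]
  have hu1 := hF.isSharp.toFun_toFun_self {l} (φ : H)
  have hv1 := hF.isSharp.toFun_toFun_self {l}ᶜ (φ : H)
  have h1 : inner ℂ (F.toFun {l} φ) (f ⟨e, hed⟩) = 0 := by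
    refine inner_eq_zero_of_diagonal_additive f ⟨_, hu⟩ ⟨e, hed⟩ ?_ ?_
    · rw [hf, hf, hf, quad ⟨_, hu⟩ hu1, quad ⟨e, hed⟩ he, quad]
      · simp
      · simp [hu1, he]
    · rw [hf, hf, hf, quad ⟨_, hu⟩ hu1, quad ⟨e, hed⟩ he, quad]
      · simp
      · simp [hu1, he]
  have h2 : inner ℂ (F.toFun {l}ᶜ φ) (A ⟨e, hed⟩) = 0 :=
    hF.inner_eq_zero hm.compl ⟨_, hv⟩ ⟨e, hed⟩ hv1 (by rwa [compl_compl])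
  have h3 : inner ℂ (F.toFun {l}ᶜ φ) e = 0 := by
    rw [hF.isSharp.inner_toFun, F.toFun_compl hm]
    simp [he]
  have h4 : inner ℂ (F.toFun {l} φ) (A ⟨e, hed⟩ - (l : ℂ) • e) = 0 := h1
  rw [h4, inner_sub_right, inner_smul_right, h2, h3]
  simp

/-- If the spectral measure vanishes on `(c - r, c + r)`, then `A - c` is bounded below
by `r / 2`: there are no approximate eigenvectors for `c`. -/
lemma norm_le_of_toFun_eq_zero {c r : ℝ} (hr : 0 < r) (h0 : F.toFun (Set.Ioo (c - r) (c + r)) = 0)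
    (ψ : A.domain) : r * ‖(ψ : H)‖ ≤ 2 * ‖A ψ - (c : ℂ) • (ψ : H)‖ := by
  have hnull : F.vectorMeasure ψ (Set.Ioo (c - r) (c + r)) = 0 := by
    rw [hF.isSharp.vectorMeasure_apply measurableSet_Ioo, h0]; simp
  have hae : ∀ᵐ x ∂(F.vectorMeasure (ψ : H)), r ≤ |x - c| := by
    rw [ae_iff]
    convert hnull using 2
    ext x
    simp only [not_le, Set.mem_ofPred_eq, Set.mem_Ioo, abs_lt]
    constructor <;> rintro ⟨h1, h2⟩ <;> constructor <;> linarith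
  -- The estimate is made on the two sides of `c` separately, where `x - c` has a fixed sign `s`.
  have key (X : Set ℝ) (hX : MeasurableSet X) (s : ℝ) (hs : |s| = 1)
      (hsX : ∀ x ∈ X, s * (x - c) = |x - c|) :
      r * ‖F.toFun X ψ‖ ≤ ‖A ψ - (c : ℂ) • (ψ : H)‖ := by
    have h1 : inner ℂ (F.toFun X ψ) (A ψ - (c : ℂ) • (ψ : H)) =
        ((∫ x in X, (x - c) ∂(F.vectorMeasure (ψ : H)) : ℝ) : ℂ) := by
      rw [inner_sub_right, hF.inner_toFun_apply hX, inner_smul_right,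
        integral_sub (hF.integrable_id ψ.2).integrableOn (integrable_const c).integrableOn,
        setIntegral_const, F.measureReal_vectorMeasure _ hX, hF.isSharp.inner_toFun,
        hF.isSharp.inner_toFun_self]
      push_cast [Complex.ofReal_re]
      rw [← Complex.ofReal_pow, Complex.ofReal_re]
      simp [mul_comm]
    have h2 : r * ‖F.toFun X ψ‖ ^ 2 ≤ s * ∫ x in X, (x - c) ∂(F.vectorMeasure (ψ : H)) := by
      have h3 := F.measureReal_vectorMeasure ψ hX
      rw [hF.isSharp.inner_toFun_self, Complex.ofReal_re] at h3
      rw [← h3, ← integral_const_mul, mul_comm, ← smul_eq_mul, ← setIntegral_const]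
      have hi : IntegrableOn (fun x : ℝ => x - c) X (F.vectorMeasure (ψ : H)) :=
        ((hF.integrable_id ψ.2).sub (integrable_const c)).integrableOn
      refine setIntegral_mono_on_ae (integrable_const r).integrableOn (hi.const_mul s) hX ?_
      filter_upwards [hae] with x hx hxX
      rw [hsX x hxX]; exact hx
    have h4 : s * ∫ x in X, (x - c) ∂(F.vectorMeasure (ψ : H)) ≤
        ‖F.toFun X ψ‖ * ‖A ψ - (c : ℂ) • (ψ : H)‖ := by
      refine le_trans ?_ (norm_inner_le_norm (𝕜 := ℂ) _ _)
      rw [h1, Complex.norm_real, Real.norm_eq_abs]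
      refine (le_abs_self _).trans ?_
      rw [abs_mul, hs, one_mul]
    rcases (norm_nonneg (F.toFun X (ψ : H))).eq_or_lt with hz | hz
    · rw [← hz, mul_zero]; exact norm_nonneg _
    · refine le_of_mul_le_mul_left ?_ hz
      calc _ = r * ‖F.toFun X ψ‖ ^ 2 := by ring
        _ ≤ _ := h2.trans h4
  have hA := key (Set.Ici c) measurableSet_Ici 1 (by simp) (fun x hx => by
    rw [one_mul, abs_of_nonneg (sub_nonneg.2 hx)])
  have hB := key (Set.Ici c)ᶜ measurableSet_Ici.compl (-1) (by simp) (fun x hx => by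
    rw [Set.compl_Ici, Set.mem_Iio] at hx
    rw [abs_of_neg (sub_neg.2 hx)]; ring)
  have hψ : (ψ : H) = F.toFun (Set.Ici c) ψ + F.toFun (Set.Ici c)ᶜ ψ := by
    rw [F.toFun_compl measurableSet_Ici]; simp
  have := norm_add_le (F.toFun (Set.Ici c) (ψ : H)) (F.toFun (Set.Ici c)ᶜ ψ)
  rw [← hψ] at this
  nlinarith [mul_le_mul_of_nonneg_left this hr.le]

end IsSpectralMeasureOf

open scoped Classical in
/-- The projection valued measure with given projections `P X` and given outcome distributions
`μ ψ`. Countable additivity in the strong sense follows from that of the measures `μ ψ`. -/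
noncomputable def ofProjections (P : Set ℝ → H →L[ℂ] H) (μ : H → Measure ℝ)
    [∀ ψ, IsFiniteMeasure (μ ψ)] (hP : ∀ X, MeasurableSet X → IsStarProjection (P X))
    (huniv : P Set.univ = 1)
    (hmul : ∀ X Y, MeasurableSet X → MeasurableSet Y → P X * P Y = P (X ∩ Y))
    (hμ : ∀ X, MeasurableSet X → ∀ ψ, inner ℂ ψ (P X ψ) = (((μ ψ).real X : ℝ) : ℂ)) :
    Observable H where
  toFun X := if MeasurableSet X then P X else 0
  nonneg X := by
    split_ifs with hX
    · exact (hP X hX).nonneg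
    · exact le_rfl
  univ := by simp [huniv]
  not_measurable X hX := if_neg hX
  iUnion f hf hd ψ := by
    have hU : MeasurableSet (⋃ n, f n) := MeasurableSet.iUnion hf
    simp only [hf, hU, if_true]
    have hin (X Y : Set ℝ) (hX : MeasurableSet X) (hY : MeasurableSet Y) :
        inner ℂ (P X ψ) (P Y ψ) = (((μ ψ).real (X ∩ Y) : ℝ) : ℂ) := by
      rw [← hμ _ (hX.inter hY), ← hmul X Y hX hY]
      conv_lhs => rw [← (hP X hX).isSelfAdjoint.star_eq, ContinuousLinearMap.star_eq_adjoint,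
        ContinuousLinearMap.adjoint_inner_left]
      rfl
    have hsum : HasSum (fun n => (μ ψ).real (f n)) ((μ ψ).real (⋃ n, f n)) := by
      have h := measure_iUnion (μ := μ ψ) hd hf
      rw [measureReal_def, h, ENNReal.tsum_toReal_eq (fun n => measure_ne_top _ _)]
      exact (ENNReal.summable_toReal (h ▸ measure_ne_top _ _)).hasSum
    -- The vectors `P (f n) ψ` are orthogonal, so the remainder has the norm of its distribution.
    have hnorm (s : Finset ℕ) : ‖∑ n ∈ s, P (f n) ψ - P (⋃ n, f n) ψ‖ =
        √((μ ψ).real (⋃ n, f n) - ∑ n ∈ s, (μ ψ).real (f n)) := by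
      rw [norm_eq_sqrt_re_inner (𝕜 := ℂ)]
      congr 1
      rw [inner_sub_left, inner_sub_right, inner_sub_right, inner_sum, sum_inner, inner_sum]
      have e1 : ∑ i ∈ s, inner ℂ (∑ j ∈ s, P (f j) ψ) (P (f i) ψ) =
          ∑ i ∈ s, (((μ ψ).real (f i) : ℝ) : ℂ) := by
        refine Finset.sum_congr rfl fun i hi => ?_
        rw [sum_inner, Finset.sum_eq_single_of_mem i hi fun j _ hj => ?_, hin _ _ (hf i) (hf i),
          Set.inter_self]
        rw [hin _ _ (hf j) (hf i), (hd hj).inter_eq]; simp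
      have e2 (i : ℕ) : inner ℂ (P (f i) ψ) (P (⋃ n, f n) ψ) = (((μ ψ).real (f i) : ℝ) : ℂ) := by
        rw [hin _ _ (hf i) hU, Set.inter_eq_left.2 (Set.subset_iUnion f i)]
      have e3 (i : ℕ) : inner ℂ (P (⋃ n, f n) ψ) (P (f i) ψ) = (((μ ψ).real (f i) : ℝ) : ℂ) := by
        rw [hin _ _ hU (hf i), Set.inter_eq_right.2 (Set.subset_iUnion f i)]
      rw [e1]
      simp only [e2, e3]
      rw [hin _ _ hU hU, Set.inter_self, ← Complex.ofReal_sum]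
      simp
    have h0 : Filter.Tendsto (fun s : Finset ℕ =>
        √((μ ψ).real (⋃ n, f n) - ∑ n ∈ s, (μ ψ).real (f n))) Filter.atTop (𝓝 0) := by
      have hs : Filter.Tendsto (fun s : Finset ℕ => ∑ n ∈ s, (μ ψ).real (f n)) Filter.atTop
          (𝓝 ((μ ψ).real (⋃ n, f n))) := by
        simpa [HasSum] using hsum
      have := (tendsto_const_nhds (x := (μ ψ).real (⋃ n, f n))).sub hs
      simpa [Function.comp_def] using (Real.continuous_sqrt.tendsto _).comp this
    rw [HasSum, SummationFilter.unconditional_filter, tendsto_iff_norm_sub_tendsto_zero]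
    simpa only [hnorm] using h0

section ofProjections

variable {P : Set ℝ → H →L[ℂ] H} {μ : H → Measure ℝ}
  [∀ ψ, IsFiniteMeasure (μ ψ)] (hP : ∀ X, MeasurableSet X → IsStarProjection (P X))
  (huniv : P Set.univ = 1)
  (hmul : ∀ X Y, MeasurableSet X → MeasurableSet Y → P X * P Y = P (X ∩ Y))
  (hμ : ∀ X, MeasurableSet X → ∀ ψ, inner ℂ ψ (P X ψ) = (((μ ψ).real X : ℝ) : ℂ))

lemma isSharp_ofProjections : (ofProjections P μ hP huniv hmul hμ).IsSharp := by
  intro X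
  by_cases hX : MeasurableSet X
  · simpa [ofProjections, hX] using hP X hX
  · simp [ofProjections, hX, IsStarProjection.zero]

lemma vectorMeasure_ofProjections (ψ : H) :
    (ofProjections P μ hP huniv hmul hμ).vectorMeasure ψ = μ ψ := by
  ext X hX
  rw [vectorMeasure_apply _ _ hX]
  simp only [ofProjections, hX, if_true]
  rw [hμ X hX, Complex.ofReal_re, ofReal_measureReal]

end ofProjections

end Observable

end Spectral

/-! ### Traces and Hilbert-Schmidt norms -/

section Trace

variable {H : Type*} [NormedAddCommGroup H] [InnerProductSpace ℂ H]

lemma hasSum_norm_sq_inner {ι : Type*} (e : HilbertBasis ι ℂ H) (x : H) :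
    HasSum (fun i => ‖inner ℂ (e i) x‖ ^ 2) (‖x‖ ^ 2) := by
  have h := e.hasSum_inner_mul_inner x x
  rw [inner_self_eq_ofReal] at h
  rw [← Complex.hasSum_ofReal]
  have h2 (i : ι) : ((‖inner ℂ (e i) x‖ ^ 2 : ℝ) : ℂ) = inner ℂ x (e i) * inner ℂ (e i) x := by
    rw [← inner_conj_symm x, mul_comm, RCLike.mul_conj]
    norm_cast
  simpa only [h2] using h

lemma tsum_enorm_sq_inner {ι : Type*} (e : HilbertBasis ι ℂ H) (x : H) :
    ∑' i, ‖inner ℂ (e i) x‖ₑ ^ 2 = ‖x‖ₑ ^ 2 := by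
  have h := hasSum_norm_sq_inner e x
  rw [← ofReal_norm x, ← ENNReal.ofReal_pow (norm_nonneg _), ← h.tsum_eq,
    ENNReal.ofReal_tsum_of_nonneg (fun i => by positivity) h.summable]
  refine tsum_congr fun i => ?_
  rw [← ofReal_norm, ENNReal.ofReal_pow (norm_nonneg _)]

lemma summable_norm_sq_iff {ι : Type*} {E : Type*} [NormedAddCommGroup E] (g : ι → E) :
    Summable (fun i => ‖g i‖ ^ 2) ↔ ∑' i, ‖g i‖ₑ ^ 2 ≠ ∞ := by
  have h (i : ι) : ‖g i‖ₑ ^ 2 = ((‖g i‖₊ ^ 2 : ℝ≥0) : ℝ≥0∞) := by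
    rw [enorm_eq_nnnorm]; norm_cast
  simp_rw [h]
  rw [ENNReal.tsum_coe_ne_top_iff_summable, ← NNReal.summable_coe]
  simp

variable [CompleteSpace H] {ι κ : Type*}

/-- The Hilbert-Schmidt norms of an operator and of its adjoint agree, and neither depends on the
Hilbert basis. -/
lemma tsum_enorm_sq_adjoint (e : HilbertBasis ι ℂ H) (f : HilbertBasis κ ℂ H) (T : H →L[ℂ] H) :
    ∑' i, ‖T (e i)‖ₑ ^ 2 = ∑' j, ‖ContinuousLinearMap.adjoint T (f j)‖ₑ ^ 2 := by
  simp_rw [← tsum_enorm_sq_inner f (T _), ← tsum_enorm_sq_inner e (ContinuousLinearMap.adjoint T _)]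
  rw [ENNReal.tsum_comm]
  refine tsum_congr fun j => tsum_congr fun i => ?_
  rw [ContinuousLinearMap.adjoint_inner_right, ← inner_conj_symm, enorm_eq_nnnorm, enorm_eq_nnnorm,
    RCLike.nnnorm_conj]

/-- The trace of `S² E` for a self-adjoint Hilbert-Schmidt operator `S` and a projection `E` is the
squared Hilbert-Schmidt norm of `E S`, in any pair of Hilbert bases. -/
lemma exists_hasSum_inner_mul_projection (e : HilbertBasis ι ℂ H) (f : HilbertBasis κ ℂ H)
    {S E : H →L[ℂ] H} (hS : IsSelfAdjoint S) (hE : IsStarProjection E)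
    (hHS : ∑' j, ‖S (f j)‖ₑ ^ 2 ≠ ∞) :
    ∃ t : ℝ, HasSum (fun i => inner ℂ (e i) (S (S (E (e i))))) (t : ℂ) ∧
      HasSum (fun j => ‖E (S (f j))‖ ^ 2) t := by
  have hSi (x y : H) : inner ℂ (S x) y = inner ℂ x (S y) := by
    rw [← ContinuousLinearMap.adjoint_inner_right, ← ContinuousLinearMap.star_eq_adjoint,
      hS.star_eq]
  have hEi (x y : H) : inner ℂ (E x) y = inner ℂ x (E y) := by
    rw [← ContinuousLinearMap.adjoint_inner_right, ← ContinuousLinearMap.star_eq_adjoint,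
      hE.isSelfAdjoint.star_eq]
  have hEE (x : H) : E (E x) = E x := congrArg (· x) hE.isIdempotentElem.eq
  have hEle (x : H) : ‖E x‖ ≤ ‖x‖ := by
    rcases (norm_nonneg (E x)).eq_or_lt with hz | hz
    · rw [← hz]; exact norm_nonneg _
    · have h1 : ‖E x‖ * ‖E x‖ ≤ ‖E x‖ * ‖x‖ := by
        have h2 := norm_inner_le_norm (𝕜 := ℂ) (E x) x
        have h3 : inner ℂ (E x) x = inner ℂ (E x) (E x) := by rw [hEi, hEi, hEE]
        rw [h3, inner_self_eq_ofReal, Complex.norm_real, Real.norm_of_nonneg (by positivity)] at h2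
        rwa [← sq]
      exact le_of_mul_le_mul_left h1 hz
  -- Both sums arise from one absolutely summable double series, summed in either order.
  obtain ⟨a, had⟩ : ∃ a : ι × κ → ℂ, ∀ p,
      a p = inner ℂ (S (e p.1)) (f p.2) * inner ℂ (f p.2) (S (E (e p.1))) := ⟨_, fun _ => rfl⟩
  have hHS' : ∑' i, ‖S (e i)‖ₑ ^ 2 ≠ ∞ := by
    rw [tsum_enorm_sq_adjoint e f, ← ContinuousLinearMap.star_eq_adjoint, hS.star_eq]
    exact hHS
  have s1 : Summable fun p : ι × κ => ‖inner ℂ (f p.2) (S (e p.1))‖ ^ 2 := by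
    rw [summable_norm_sq_iff, ENNReal.tsum_prod']
    simpa only [tsum_enorm_sq_inner] using hHS'
  have s2 : Summable fun p : ι × κ => ‖inner ℂ (f p.2) (S (E (e p.1)))‖ ^ 2 := by
    rw [summable_norm_sq_iff, ENNReal.tsum_prod']
    simp only [tsum_enorm_sq_inner]
    have := tsum_enorm_sq_adjoint e f (S * E)
    simp only [mul_apply_eq_comp] at this
    rw [this, ← ContinuousLinearMap.star_eq_adjoint, star_mul, hS.star_eq,
      hE.isSelfAdjoint.star_eq]
    refine ne_top_of_le_ne_top hHS (ENNReal.tsum_le_tsum fun j => ?_)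
    gcongr
    rw [← ofReal_norm, ← ofReal_norm]
    exact ENNReal.ofReal_le_ofReal (hEle _)
  have ha : Summable a := by
    refine Summable.of_norm_bounded (s1.add s2) fun p => ?_
    rw [had, norm_mul, norm_inner_symm]
    nlinarith [sq_nonneg (‖inner ℂ (f p.2) (S (e p.1))‖ - ‖inner ℂ (f p.2) (S (E (e p.1)))‖),
      sq_nonneg ‖inner ℂ (f p.2) (S (e p.1))‖, sq_nonneg ‖inner ℂ (f p.2) (S (E (e p.1)))‖]
  have h1 : HasSum (fun i => inner ℂ (e i) (S (S (E (e i))))) (∑' p, a p) := by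
    refine HasSum.prod_fiberwise ha.hasSum fun i => ?_
    simp only [had]
    rw [← hSi]
    exact f.hasSum_inner_mul_inner _ _
  have h2 : HasSum (fun j => ((‖E (S (f j))‖ ^ 2 : ℝ) : ℂ)) (∑' p, a p) := by
    have hsw : HasSum (fun q : κ × ι => a (q.2, q.1)) (∑' p, a p) :=
      (Equiv.prodComm κ ι).hasSum_iff.2 ha.hasSum
    refine HasSum.prod_fiberwise hsw fun j => ?_
    have h3 := e.hasSum_inner_mul_inner (E (S (f j))) (S (f j))
    have h4 : inner ℂ (E (S (f j))) (S (f j)) = ((‖E (S (f j))‖ ^ 2 : ℝ) : ℂ) := by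
      have : inner ℂ (E (S (f j))) (S (f j)) = inner ℂ (E (S (f j))) (E (S (f j))) := by
        rw [hEi, hEi, hEE]
      rw [this, inner_self_eq_ofReal]
    rw [h4] at h3
    have h5 (i : ι) : a (i, j) = inner ℂ (E (S (f j))) (e i) * inner ℂ (e i) (S (f j)) := by
      rw [had, hSi, ← hSi (f j), ← hEi, mul_comm]
    simpa only [h5] using h3
  have hre := Complex.hasSum_re h2
  simp only [Complex.ofReal_re] at hre
  refine ⟨_, ?_, hre⟩
  rwa [(Complex.hasSum_ofReal.2 hre).unique h2]

namespace DensityOperator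

variable (ρ : DensityOperator H)

lemma isSelfAdjoint_sqrt : IsSelfAdjoint (CFC.sqrt ρ.op) := (CFC.sqrt_nonneg ρ.op).isSelfAdjoint

lemma sqrt_sqrt_apply (x : H) : CFC.sqrt ρ.op (CFC.sqrt ρ.op x) = ρ.op x :=
  congrArg (· x) (CFC.sqrt_mul_sqrt_self ρ.op ρ.nonneg)

lemma hasSum_norm_sqrt : HasSum (fun i => ‖CFC.sqrt ρ.op (basis H i)‖ ^ 2) 1 := by
  rw [← Complex.hasSum_ofReal, Complex.ofReal_one]
  convert ρ.trace_one using 2 with i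
  rw [← ρ.sqrt_sqrt_apply, ← ContinuousLinearMap.adjoint_inner_left,
    ← ContinuousLinearMap.star_eq_adjoint, ρ.isSelfAdjoint_sqrt.star_eq,
    inner_self_eq_ofReal]

lemma tsum_enorm_sqrt : ∑' i, ‖CFC.sqrt ρ.op (basis H i)‖ₑ ^ 2 ≠ ∞ :=
  (summable_norm_sq_iff _).1 ρ.hasSum_norm_sqrt.summable

/-- The probability of a sharp event is the squared Hilbert-Schmidt norm of `E √ρ`. -/
lemma hasSum_trace_projection {E : H →L[ℂ] H} (hE : IsStarProjection E) :
    ∃ t : ℝ, trace (ρ.op ∘L E) = t ∧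
      HasSum (fun j => ‖E (CFC.sqrt ρ.op (basis H j))‖ ^ 2) t := by
  obtain ⟨t, h1, h2⟩ := exists_hasSum_inner_mul_projection (basis H) (basis H)
    ρ.isSelfAdjoint_sqrt hE ρ.tsum_enorm_sqrt
  refine ⟨t, ?_, h2⟩
  rw [trace, ← h1.tsum_eq]
  simp [ρ.sqrt_sqrt_apply]

end DensityOperator

end Trace

/-! ### The Hilbert space tensor product -/

section Tensor

variable {H : Type*} [NormedAddCommGroup H] [InnerProductSpace ℂ H]
  {K : Type*} [NormedAddCommGroup K] [InnerProductSpace ℂ K]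

/-- The map `φ ↦ ψ ⊗ φ` into the Hilbert space tensor product. -/
noncomputable def tmulRight (ψ : H) : K →L[ℂ] HilbertTensor H K :=
  Completion.toComplL ∘L TensorProduct.mkL ℂ H K ψ

/-- The map `ψ ↦ ψ ⊗ φ` into the Hilbert space tensor product. -/
noncomputable def tmulLeft (φ : K) : H →L[ℂ] HilbertTensor H K :=
  Completion.toComplL ∘L (TensorProduct.mkL ℂ H K).flip φ

lemma tmulRight_apply (ψ : H) (φ : K) : tmulRight ψ φ = tmul ψ φ := rfl

lemma inner_tmul_tmul (ψ ψ' : H) (φ φ' : K) :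
    inner ℂ (tmul ψ φ) (tmul ψ' φ') = inner ℂ ψ ψ' * inner ℂ φ φ' := by
  rw [tmul, tmul, Completion.inner_coe, TensorProduct.inner_tmul]

lemma norm_tmul (ψ : H) (φ : K) : ‖tmul ψ φ‖ = ‖ψ‖ * ‖φ‖ := by
  rw [tmul, Completion.norm_coe, TensorProduct.norm_tmul]

lemma smul_tmul_left (c : ℂ) (ψ : H) (φ : K) : tmul (c • ψ) φ = c • tmul ψ φ :=
  (tmulLeft φ).map_smul c ψ

lemma smul_tmul_right (c : ℂ) (ψ : H) (φ : K) : tmul ψ (c • φ) = c • tmul ψ φ :=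
  (tmulRight ψ).map_smul c φ

lemma tensorOp_tmul (A : H →L[ℂ] H) (B : K →L[ℂ] K) (ψ : H) (φ : K) :
    tensorOp A B (tmul ψ φ) = tmul (A ψ) (B φ) := by
  rw [tensorOp, tmul, ContinuousLinearMap.completion_apply_coe]
  rfl

/-- A closed subspace that contains the elementary tensors is everything. -/
lemma closed_submodule_eq_top {S : Submodule ℂ (HilbertTensor H K)}
    (hS : IsClosed (S : Set (HilbertTensor H K))) (h : ∀ ψ φ, tmul ψ φ ∈ S) (x : HilbertTensor H K) :
    x ∈ S := by
  induction x using Completion.induction_on with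
  | hp => exact hS
  | ih a =>
    induction a with
    | zero => rw [Completion.coe_zero]; exact S.zero_mem
    | tmul ψ φ => exact h ψ φ
    | add a b ha hb => rw [Completion.coe_add]; exact S.add_mem ha hb

lemma tensor_ext {E : Type*} [NormedAddCommGroup E] [NormedSpace ℂ E]
    {f g : HilbertTensor H K →L[ℂ] E} (h : ∀ ψ φ, f (tmul ψ φ) = g (tmul ψ φ)) : f = g := by
  ext1 x
  exact closed_submodule_eq_top (S := LinearMap.eqLocus f.toLinearMap g.toLinearMap)
    (isClosed_eq f.continuous g.continuous) h x

lemma tensorOp_mul (A A' : H →L[ℂ] H) (B B' : K →L[ℂ] K) :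
    tensorOp A B * tensorOp A' B' = tensorOp (A * A') (B * B') :=
  tensor_ext fun ψ φ => by simp [tensorOp_tmul]

variable [CompleteSpace H] [CompleteSpace K]

lemma star_tensorOp (A : H →L[ℂ] H) (B : K →L[ℂ] K) :
    star (tensorOp A B) = tensorOp (star A) (star B) := by
  simp only [ContinuousLinearMap.star_eq_adjoint]
  refine tensor_ext fun ψ φ => ?_
  refine ext_inner_right ℂ fun x => ?_
  rw [ContinuousLinearMap.adjoint_inner_left, tensorOp_tmul]
  have : (innerSL ℂ (tmul ψ φ)) ∘L tensorOp A B = innerSL ℂ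
      (tmul (ContinuousLinearMap.adjoint A ψ) (ContinuousLinearMap.adjoint B φ)) :=
    tensor_ext fun ψ' φ' => by
      simp [tensorOp_tmul, inner_tmul_tmul, ContinuousLinearMap.adjoint_inner_left]
  exact congrArg (· x) this

lemma isStarProjection_tensorOp {A : H →L[ℂ] H} {B : K →L[ℂ] K} (hA : IsStarProjection A)
    (hB : IsStarProjection B) : IsStarProjection (tensorOp A B) :=
  ⟨by rw [IsIdempotentElem, tensorOp_mul, hA.isIdempotentElem.eq, hB.isIdempotentElem.eq],
    by rw [IsSelfAdjoint, star_tensorOp, hA.isSelfAdjoint.star_eq, hB.isSelfAdjoint.star_eq]⟩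

omit [CompleteSpace K] in
/-- An operator that annihilates the range of `√T` has second moment zero in the state `T`. The
square root of `T` is given here as `S = R* R` with `S² = T`. -/
lemma secondMoment_eq_zero {T S R : H →L[ℂ] H} {N : H →ₗ.[ℂ] H} (hS : S * S = T)
    (hR : star R * R = S) (h : ∀ x, ∃ hx : S x ∈ N.domain, N ⟨S x, hx⟩ = 0) :
    secondMoment T N = 0 := by
  have hsq : CFC.sqrt T = S := CFC.sqrt_unique hS (hR ▸ star_mul_self_nonneg R)
  subst hsq
  rw [secondMoment, dif_pos fun x => (h x).1]
  simp [(h _).2]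

/-- The product of two Hilbert bases. -/
noncomputable def tensorBasis {ι κ : Type*} (e : HilbertBasis ι ℂ H) (f : HilbertBasis κ ℂ K) :
    HilbertBasis (ι × κ) ℂ (HilbertTensor H K) :=
  HilbertBasis.mk (v := fun p : ι × κ => tmul (e p.1) (f p.2))
    (by
      classical
      rw [orthonormal_iff_ite]
      intro p q
      rw [inner_tmul_tmul, orthonormal_iff_ite.1 e.orthonormal, orthonormal_iff_ite.1 f.orthonormal]
      split_ifs <;> simp_all [Prod.ext_iff])
    (by
      intro x _
      refine closed_submodule_eq_top (Submodule.isClosed_topologicalClosure _) (fun ψ φ => ?_) x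
      set S := (Submodule.span ℂ
        (Set.range fun p : ι × κ => tmul (e p.1) (f p.2))).topologicalClosure with hSdef
      have hS : IsClosed (S : Set (HilbertTensor H K)) := Submodule.isClosed_topologicalClosure _
      have h1 (i : ι) (φ : K) : tmul (e i) φ ∈ S := by
        have hle : (Submodule.span ℂ (Set.range f)).topologicalClosure ≤
            S.comap (tmulRight (e i)).toLinearMap := by
          refine Submodule.topologicalClosure_minimal _ (Submodule.span_le.2 ?_)
            (hS.preimage (tmulRight (e i)).continuous)
          rintro _ ⟨j, rfl⟩
          exact Submodule.le_topologicalClosure _ (Submodule.subset_span ⟨(i, j), rfl⟩)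
        exact hle (f.dense_span ▸ Submodule.mem_top)
      have hle : (Submodule.span ℂ (Set.range e)).topologicalClosure ≤
          S.comap (tmulLeft φ).toLinearMap := by
        refine Submodule.topologicalClosure_minimal _ (Submodule.span_le.2 ?_)
          (hS.preimage (tmulLeft φ).continuous)
        rintro _ ⟨i, rfl⟩
        exact h1 i φ
      exact hle (e.dense_span ▸ Submodule.mem_top))

omit [CompleteSpace H] [CompleteSpace K] in
lemma tensorBasis_apply {ι κ : Type*} (e : HilbertBasis ι ℂ H) (f : HilbertBasis κ ℂ K)
    (p : ι × κ) : tensorBasis e f p = tmul (e p.1) (f p.2) := by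
  rw [tensorBasis, HilbertBasis.coe_mk]

/-- The probability of a sharp event `E` of the compound system in a product state. -/
lemma hasSum_trace_tensorOp (ρ : DensityOperator H) (σ : DensityOperator K)
    {E : HilbertTensor H K →L[ℂ] HilbertTensor H K} (hE : IsStarProjection E) :
    ∃ t : ℝ, trace (tensorOp ρ.op σ.op ∘L E) = t ∧
      HasSum (fun p : basisIndex H × basisIndex K =>
        ‖E (tmul (CFC.sqrt ρ.op (basis H p.1)) (CFC.sqrt σ.op (basis K p.2)))‖ ^ 2) t := by
  have hS : IsSelfAdjoint (tensorOp (CFC.sqrt ρ.op) (CFC.sqrt σ.op)) := by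
    rw [IsSelfAdjoint, star_tensorOp, ρ.isSelfAdjoint_sqrt.star_eq, σ.isSelfAdjoint_sqrt.star_eq]
  have hHS : ∑' p, ‖tensorOp (CFC.sqrt ρ.op) (CFC.sqrt σ.op)
      (tensorBasis (basis H) (basis K) p)‖ₑ ^ 2 ≠ ∞ := by
    rw [← summable_norm_sq_iff]
    simp only [tensorBasis_apply, tensorOp_tmul, norm_tmul, mul_pow]
    exact Summable.mul_of_nonneg (f := fun i => ‖CFC.sqrt ρ.op (basis H i)‖ ^ 2)
      (g := fun j => ‖CFC.sqrt σ.op (basis K j)‖ ^ 2) ρ.hasSum_norm_sqrt.summable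
      σ.hasSum_norm_sqrt.summable (fun _ => sq_nonneg _) (fun _ => sq_nonneg _)
  obtain ⟨t, h1, h2⟩ := exists_hasSum_inner_mul_projection (basis (HilbertTensor H K))
    (tensorBasis (basis H) (basis K)) hS hE hHS
  refine ⟨t, ?_, ?_⟩
  · rw [trace, ← h1.tsum_eq]
    refine tsum_congr fun i => ?_
    have : tensorOp ρ.op σ.op = tensorOp (CFC.sqrt ρ.op) (CFC.sqrt σ.op) *
        tensorOp (CFC.sqrt ρ.op) (CFC.sqrt σ.op) := by
      rw [tensorOp_mul, CFC.sqrt_mul_sqrt_self _ ρ.nonneg, CFC.sqrt_mul_sqrt_self _ σ.nonneg]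
    rw [this]
    rfl
  · simpa only [tensorBasis_apply, tensorOp_tmul] using h2

/-- The exchange of the two factors, as a bounded operator. -/
noncomputable def swapL : HilbertTensor H H →L[ℂ] HilbertTensor H H :=
  ((TensorProduct.commIsometry ℂ H H).toContinuousLinearEquiv :
    H ⊗[ℂ] H →L[ℂ] H ⊗[ℂ] H).completion

omit [CompleteSpace H] in
lemma swapL_tmul (ψ φ : H) : swapL (tmul ψ φ) = tmul φ ψ := by
  rw [swapL, tmul, ContinuousLinearMap.completion_apply_coe]
  rfl

omit [CompleteSpace H] in
lemma swapL_swapL (x : HilbertTensor H H) : swapL (swapL x) = x := by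
  have h : (swapL : HilbertTensor H H →L[ℂ] HilbertTensor H H) ∘L swapL =
      ContinuousLinearMap.id ℂ _ :=
    tensor_ext fun ψ φ => by
      rw [ContinuousLinearMap.comp_apply, swapL_tmul, swapL_tmul, ContinuousLinearMap.id_apply]
  exact congrArg (· x) h

omit [CompleteSpace H] in
lemma norm_swapL (x : HilbertTensor H H) : ‖swapL x‖ = ‖x‖ := by
  induction x using Completion.induction_on with
  | hp => exact isClosed_eq swapL.continuous.norm continuous_norm
  | ih a =>
    rw [swapL, ContinuousLinearMap.completion_apply_coe, Completion.norm_coe, Completion.norm_coe]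
    exact (TensorProduct.commIsometry ℂ H H).norm_map a

/-- The exchange of the two factors, as a unitary operator. -/
noncomputable def swap : HilbertTensor H H ≃ₗᵢ[ℂ] HilbertTensor H H where
  toLinearEquiv := LinearEquiv.ofInvolutive swapL.toLinearMap swapL_swapL
  norm_map' := norm_swapL

omit [CompleteSpace H] in
lemma swap_tmul (ψ φ : H) : swap (tmul ψ φ) = tmul φ ψ := swapL_tmul ψ φ

end Tensor

/-! ### Diagonal operators -/

section Diagonal

variable {H : Type*} [NormedAddCommGroup H] [InnerProductSpace ℂ H] {ι : Type*}

lemma clm_ext_basis {E : Type*} [NormedAddCommGroup E] [NormedSpace ℂ E] (e : HilbertBasis ι ℂ H)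
    {S T : H →L[ℂ] E} (h : ∀ i, S (e i) = T (e i)) : S = T := by
  refine ContinuousLinearMap.ext_on (s := Set.range e) ?_ ?_
  · rw [dense_iff_closure_eq, ← Submodule.topologicalClosure_coe, e.dense_span]; rfl
  · rintro _ ⟨i, rfl⟩; exact h i

/-- `A` is the diagonal operator with eigenbasis `e` and eigenvalues `l`, on its maximal domain
`∑ lᵢ² |⟪eᵢ, ψ⟫|² < ∞`. -/
structure IsDiagonal (A : H →ₗ.[ℂ] H) (e : HilbertBasis ι ℂ H) (l : ι → ℝ) : Prop where
  mem_domain_iff : ∀ ψ, ψ ∈ A.domain ↔ Summable fun i => l i ^ 2 * ‖inner ℂ (e i) ψ‖ ^ 2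
  inner_apply : ∀ (ψ : A.domain) i, inner ℂ (e i) (A ψ) = l i * inner ℂ (e i) (ψ : H)

namespace IsDiagonal

variable {A : H →ₗ.[ℂ] H} {e : HilbertBasis ι ℂ H} {l : ι → ℝ} (hA : IsDiagonal A e l)
include hA

lemma basis_mem_domain (i : ι) : e i ∈ A.domain := by
  classical
  rw [hA.mem_domain_iff]
  refine summable_of_ne_finset_zero (s := {i}) fun j hj => ?_
  rw [orthonormal_iff_ite.1 e.orthonormal, if_neg (by simpa using hj)]
  simp

lemma apply_basis (i : ι) : A ⟨e i, hA.basis_mem_domain i⟩ = (l i : ℂ) • e i := by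
  classical
  rw [← sub_eq_zero, ← inner_self_eq_zero (𝕜 := ℂ)]
  have h (x : H) (hx : ∀ j, inner ℂ (e j) x = 0) : inner ℂ x x = 0 := by
    refine (e.hasSum_inner_mul_inner x x).unique ?_
    simp only [hx, mul_zero]
    exact hasSum_zero
  refine h _ fun j => ?_
  rw [inner_sub_right, hA.inner_apply, inner_smul_right, orthonormal_iff_ite.1 e.orthonormal]
  split_ifs with hij
  · rw [hij]; simp
  · simp

lemma hasSum_apply (ψ : A.domain) :
    HasSum (fun i => inner ℂ (e i) (ψ : H) • ((l i : ℂ) • e i)) (A ψ) := by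
  have h := e.hasSum_repr (A ψ)
  simp only [HilbertBasis.repr_apply_apply, hA.inner_apply] at h
  simpa only [smul_smul, mul_comm] using h

lemma hasSum_inner_apply (ψ : A.domain) :
    HasSum (fun i => l i * ‖inner ℂ (e i) (ψ : H)‖ ^ 2) (inner ℂ (ψ : H) (A ψ)).re := by
  have h := Complex.hasSum_re (e.hasSum_inner_mul_inner (ψ : H) (A ψ))
  have h2 (i : ι) : (inner ℂ (ψ : H) (e i) * inner ℂ (e i) (A ψ)).re =
      l i * ‖inner ℂ (e i) (ψ : H)‖ ^ 2 := by
    rw [hA.inner_apply, ← inner_conj_symm (ψ : H), mul_left_comm, mul_comm ((starRingEnd ℂ) _),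
      Complex.mul_conj', ← Complex.ofReal_pow, ← Complex.ofReal_mul, Complex.ofReal_re]
  simpa only [h2] using h

lemma inner_symm (u v : A.domain) : inner ℂ (A u) (v : H) = inner ℂ (u : H) (A v) := by
  refine (e.hasSum_inner_mul_inner (A u) (v : H)).unique ?_
  have h := e.hasSum_inner_mul_inner (u : H) (A v)
  have h2 (i : ι) : inner ℂ (u : H) (e i) * inner ℂ (e i) (A v) =
      inner ℂ (A u) (e i) * inner ℂ (e i) (v : H) := by
    rw [hA.inner_apply, ← inner_conj_symm (A u), hA.inner_apply, map_mul, inner_conj_symm,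
      Complex.conj_ofReal]
    ring
  simpa only [h2] using h

lemma dense_domain : Dense (A.domain : Set H) := by
  have h : Submodule.span ℂ (Set.range e) ≤ A.domain :=
    Submodule.span_le.2 (by rintro _ ⟨i, rfl⟩; exact hA.basis_mem_domain i)
  refine Dense.mono h ?_
  rw [dense_iff_closure_eq, ← Submodule.topologicalClosure_coe, e.dense_span]
  rfl

variable [CompleteSpace H]

/-- The maximal domain makes a diagonal operator with real eigenvalues self-adjoint: an element `y`
of the domain of the adjoint has `⟪eᵢ, A* y⟫ = lᵢ ⟪eᵢ, y⟫`, which is square summable. -/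
lemma isSelfAdjoint : IsSelfAdjoint A := by
  rw [LinearPMap.isSelfAdjoint_def]
  refine le_antisymm (And.intro (fun y hy => ?_) ?_)
    (LinearPMap.IsFormalAdjoint.le_adjoint hA.dense_domain fun u v => hA.inner_symm u v)
  · rw [hA.mem_domain_iff]
    have h (i : ι) : inner ℂ (e i) (LinearPMap.adjoint A ⟨y, hy⟩) = l i * inner ℂ (e i) y := by
      have h1 := LinearPMap.adjoint_isFormalAdjoint hA.dense_domain ⟨y, hy⟩
        ⟨e i, hA.basis_mem_domain i⟩
      rw [hA.apply_basis, inner_smul_right] at h1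
      rw [← inner_conj_symm, h1, map_mul, Complex.conj_ofReal, inner_conj_symm]
    have h2 := (hasSum_norm_sq_inner e (LinearPMap.adjoint A ⟨y, hy⟩)).summable
    refine h2.congr fun i => ?_
    rw [h, norm_mul, mul_pow, Complex.norm_real, Real.norm_eq_abs, sq_abs]
  · rintro ⟨y, hy⟩ ⟨y', hy'⟩ (rfl : y = y')
    refine (hA.dense_domain.eq_of_inner_left ℂ fun v hv => ?_)
    have h1 := LinearPMap.adjoint_isFormalAdjoint hA.dense_domain ⟨y, hy⟩ ⟨v, hv⟩
    exact h1.trans (hA.inner_symm ⟨y, hy'⟩ ⟨v, hv⟩).symm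

omit hA in
/-- The spectral projection of the diagonal operator. -/
noncomputable def proj (e : HilbertBasis ι ℂ H) (l : ι → ℝ) (X : Set ℝ) : H →L[ℂ] H :=
  (Submodule.span ℂ (e '' (l ⁻¹' X))).topologicalClosure.starProjection

omit hA in
open scoped Classical in
lemma proj_basis (e : HilbertBasis ι ℂ H) (l : ι → ℝ) (X : Set ℝ) (i : ι) :
    proj e l X (e i) = if l i ∈ X then e i else 0 := by
  split_ifs with h
  · exact Submodule.starProjection_eq_self_iff.2
      (Submodule.le_topologicalClosure _ (Submodule.subset_span ⟨i, h, rfl⟩))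
  · refine (Submodule.starProjection_apply_eq_zero_iff _).2 ?_
    rw [Submodule.orthogonal_closure, Submodule.mem_orthogonal]
    intro u hu
    induction hu using Submodule.span_induction with
    | mem u hu =>
      obtain ⟨j, hj, rfl⟩ := hu
      refine e.orthonormal.2 fun hij => h ?_
      rw [← hij]; exact hj
    | zero => simp
    | add u v _ _ hu hv => rw [inner_add_left, hu, hv, add_zero]
    | smul c u _ hu => rw [inner_smul_left, hu, mul_zero]

omit hA in
open scoped Classical in
lemma inner_proj (e : HilbertBasis ι ℂ H) (l : ι → ℝ) (X : Set ℝ) (i : ι) (ψ : H) :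
    inner ℂ (e i) (proj e l X ψ) = if l i ∈ X then inner ℂ (e i) ψ else 0 := by
  rw [proj, ← Submodule.inner_starProjection_left_eq_right, ← proj, proj_basis]
  split_ifs <;> simp

omit hA [CompleteSpace H] in
/-- The outcome distribution of the diagonal operator in the vector `ψ`. -/
noncomputable def measure (e : HilbertBasis ι ℂ H) (l : ι → ℝ) (ψ : H) : Measure ℝ :=
  Measure.sum fun i => ENNReal.ofReal (‖inner ℂ (e i) ψ‖ ^ 2) • Measure.dirac (l i)

omit hA [CompleteSpace H] in
lemma measure_apply (e : HilbertBasis ι ℂ H) (l : ι → ℝ) (ψ : H) {X : Set ℝ}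
    (hX : MeasurableSet X) :
    measure e l ψ X = ENNReal.ofReal (∑' i, X.indicator 1 (l i) * ‖inner ℂ (e i) ψ‖ ^ 2) := by
  classical
  rw [measure, Measure.sum_apply _ hX, ENNReal.ofReal_tsum_of_nonneg]
  · refine tsum_congr fun i => ?_
    rw [Measure.smul_apply, Measure.dirac_apply' _ hX, smul_eq_mul]
    by_cases h : l i ∈ X <;> simp [h]
  · intro i
    exact mul_nonneg (Set.indicator_nonneg (by simp) _) (by positivity)
  · refine Summable.of_nonneg_of_le (fun i => ?_) (fun i => ?_)
      (hasSum_norm_sq_inner e ψ).summable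
    · exact mul_nonneg (Set.indicator_nonneg (by simp) _) (by positivity)
    · by_cases h : l i ∈ X <;> simp [h]

instance (e : HilbertBasis ι ℂ H) (l : ι → ℝ) (ψ : H) : IsFiniteMeasure (measure e l ψ) :=
  ⟨by rw [measure_apply e l ψ .univ]; exact ENNReal.ofReal_lt_top⟩

/-- The spectral measure of a diagonal operator maps `X` to the projection onto the closed span of
the basis vectors with eigenvalue in `X`. -/
lemma exists_isSpectralMeasureOf : ∃ C : Observable H, C.IsSpectralMeasureOf A := by
  classical
  have hproj : ∀ X, MeasurableSet X → IsStarProjection (proj e l X) :=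
    fun X _ => isStarProjection_starProjection
  have huniv : proj e l Set.univ = 1 := clm_ext_basis e fun i => by simp [proj_basis]
  have hmul : ∀ X Y, MeasurableSet X → MeasurableSet Y →
      proj e l X * proj e l Y = proj e l (X ∩ Y) := fun X Y _ _ =>
    clm_ext_basis e fun i => by
      by_cases hX : l i ∈ X <;> by_cases hY : l i ∈ Y <;> simp [proj_basis, hX, hY]
  have hμ : ∀ X, MeasurableSet X → ∀ ψ,
      inner ℂ ψ (proj e l X ψ) = (((measure e l ψ).real X : ℝ) : ℂ) := by
    intro X hX ψ
    refine (e.hasSum_inner_mul_inner ψ (proj e l X ψ)).unique ?_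
    have h (i : ι) : inner ℂ ψ (e i) * inner ℂ (e i) (proj e l X ψ) =
        ((X.indicator 1 (l i) * ‖inner ℂ (e i) ψ‖ ^ 2 : ℝ) : ℂ) := by
      rw [inner_proj, ← inner_conj_symm ψ]
      by_cases hX : l i ∈ X
      · simp only [hX, if_true, Set.indicator_of_mem, Pi.one_apply, one_mul]
        rw [mul_comm, RCLike.mul_conj]; norm_cast
      · simp [hX]
    simp only [h]
    rw [Complex.hasSum_ofReal, measureReal_def, measure_apply _ _ _ hX, ENNReal.toReal_ofReal
      (tsum_nonneg fun i => mul_nonneg (Set.indicator_nonneg (by simp) _) (by positivity))]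
    refine Summable.hasSum (Summable.of_nonneg_of_le (fun i => ?_) (fun i => ?_)
      (hasSum_norm_sq_inner e ψ).summable)
    · exact mul_nonneg (Set.indicator_nonneg (by simp) _) (by positivity)
    · by_cases h : l i ∈ X <;> simp [h]
  have hlint (ψ : H) : ∫⁻ x, ENNReal.ofReal (x ^ 2) ∂(measure e l ψ) =
      ∑' i, ENNReal.ofReal (l i ^ 2 * ‖inner ℂ (e i) ψ‖ ^ 2) := by
    rw [measure, lintegral_sum_measure]
    refine tsum_congr fun i => ?_
    rw [lintegral_smul_measure, lintegral_dirac' _ (by fun_prop), smul_eq_mul,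
      ← ENNReal.ofReal_mul (by positivity), mul_comm]
  have hdom (ψ : H) : ψ ∈ A.domain ↔ ∫⁻ x, ENNReal.ofReal (x ^ 2) ∂(measure e l ψ) < ∞ := by
    rw [hlint, hA.mem_domain_iff]
    constructor
    · intro h
      rw [← ENNReal.ofReal_tsum_of_nonneg (fun i => by positivity) h]
      exact ENNReal.ofReal_lt_top
    · intro h
      refine (ENNReal.summable_toReal h.ne).congr fun i => ?_
      rw [ENNReal.toReal_ofReal (by positivity)]
  refine ⟨.ofProjections (proj e l) (measure e l) hproj huniv hmul hμ,
    Observable.isSharp_ofProjections hproj huniv hmul hμ, fun ψ => ?_, fun ψ => ?_⟩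
  · rw [Observable.vectorMeasure_ofProjections]; exact hdom ψ
  · rw [Observable.vectorMeasure_ofProjections]
    have hint : Integrable (fun x : ℝ => x) (measure e l (ψ : H)) :=
      integrable_id_of_lintegral_sq ((hdom ψ).1 ψ.2)
    have hs := hasSum_integral_measure hint
    simp only [integral_smul_measure, integral_dirac, smul_eq_mul] at hs
    have h1 := hA.hasSum_inner_apply ψ
    have h3 : (inner ℂ (ψ : H) (A ψ)).re = ∫ x, x ∂(measure e l (ψ : H)) := by
      refine h1.unique ?_
      have h4 (i : ι) : (ENNReal.ofReal (‖inner ℂ (e i) (ψ : H)‖ ^ 2)).toReal * l i =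
          l i * ‖inner ℂ (e i) (ψ : H)‖ ^ 2 := by
        rw [ENNReal.toReal_ofReal (by positivity), mul_comm]
      simp only [h4] at hs
      exact hs
    rw [← h3]
    refine Complex.ext ?_ ?_
    · simp
    · rw [Complex.ofReal_im]
      have := hA.inner_symm ψ ψ
      rw [← inner_conj_symm] at this
      have := congrArg Complex.im this
      rw [Complex.conj_im] at this
      linarith

variable {C : Observable H} (hC : C.IsSpectralMeasureOf A)
include hC

open scoped Classical in
/-- Every spectral measure of a diagonal operator is diagonal in the same basis. -/
lemma toFun_basis {X : Set ℝ} (hX : MeasurableSet X) (i : ι) :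
    C.toFun X (e i) = if l i ∈ X then e i else 0 := by
  have h1 : C.toFun {l i} (e i) = e i :=
    hC.toFun_singleton_of_eigenvector ⟨e i, hA.basis_mem_domain i⟩ (l i) (hA.apply_basis i)
  rw [← h1, hC.isSharp.toFun_toFun hX (measurableSet_singleton _)]
  split_ifs with h
  · rw [Set.inter_eq_right.2 (by simpa using h)]
  · rw [Set.inter_singleton_eq_empty.2 h, C.toFun_empty]; rfl

lemma toFun_eq_one {X : Set ℝ} (hX : MeasurableSet X) (h : ∀ i, l i ∈ X) : C.toFun X = 1 :=
  clm_ext_basis e fun i => by rw [hA.toFun_basis hC hX, if_pos (h i)]; rfl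

lemma toFun_eq_zero {X : Set ℝ} (hX : MeasurableSet X) (h : ∀ i, l i ∉ X) : C.toFun X = 0 :=
  clm_ext_basis e fun i => by rw [hA.toFun_basis hC hX, if_neg (h i)]; rfl

/-- The spectrum is purely discrete if the eigenvalues are simple and accumulate nowhere. -/
lemma hasPurelyDiscreteSpectrum [TopologicalSpace ι] [DiscreteTopology ι]
    (hl : IsClosedEmbedding l) : C.HasPurelyDiscreteSpectrum := by
  have hmem (x : ℝ) (hx : x ∈ C.spectrum) : ∃ i, l i = x := by
    by_contra! hcon
    have hopen : IsOpen (Set.range l)ᶜ := hl.isClosed_range.isOpen_compl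
    refine hx (Set.range l)ᶜ (hopen.mem_nhds ?_) hopen
      (hA.toFun_eq_zero hC hopen.measurableSet fun i => by simp)
    rintro ⟨i, hi⟩
    exact hcon i hi
  intro x hx
  obtain ⟨i, rfl⟩ := hmem x hx
  refine ⟨?_, fun h0 => ?_, ?_⟩
  · obtain ⟨V, hV, hVi⟩ := hl.isInducing.isOpen_iff.1 (isOpen_discrete {i})
    have hiV : l i ∈ V := by
      have : i ∈ l ⁻¹' V := by rw [hVi]; rfl
      exact this
    obtain ⟨ε, hε, hball⟩ := Metric.isOpen_iff.1 hV _ hiV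
    refine ⟨ε, hε, fun y hy hyi => ?_⟩
    obtain ⟨j, rfl⟩ := hmem y hy
    have : j ∈ l ⁻¹' V := hball (by rwa [Metric.mem_ball, Real.dist_eq])
    rw [hVi] at this
    rw [Set.mem_singleton_iff.1 this]
  · have h := hA.toFun_basis hC (measurableSet_singleton (l i)) i
    rw [h0, if_pos (Set.mem_singleton _)] at h
    exact e.orthonormal.ne_zero i h.symm
  · classical
    have h : C.toFun {l i} = InnerProductSpace.rankOne ℂ (e i) (e i) := by
      refine clm_ext_basis e fun j => ?_
      rw [hA.toFun_basis hC (measurableSet_singleton (l i)), InnerProductSpace.rankOne_apply,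
        orthonormal_iff_ite.1 e.orthonormal]
      by_cases hij : i = j
      · simp [hij]
      · rw [if_neg, if_neg hij, zero_smul]
        exact fun h => hij (hl.injective h).symm
    refine Submodule.finiteDimensional_of_le (S₂ := Submodule.span ℂ {e i}) ?_
    rintro _ ⟨ψ, rfl⟩
    rw [h]
    exact Submodule.mem_span_singleton.2 ⟨_, rfl⟩

end IsDiagonal

end Diagonal

/-! ### Measurement schemes -/

section Scheme

lemma mul_self_pureState {H : Type*} [NormedAddCommGroup H] [InnerProductSpace ℂ H]
    [CompleteSpace H] (ψ : H) (hψ : ‖ψ‖ = 1) :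
    (pureState ψ hψ).op * (pureState ψ hψ).op = (pureState ψ hψ).op := by
  ext x
  simp [pureState, InnerProductSpace.rankOne_apply, hψ]

lemma sqrt_pureState {H : Type*} [NormedAddCommGroup H] [InnerProductSpace ℂ H]
    [CompleteSpace H] (ψ : H) (hψ : ‖ψ‖ = 1) :
    CFC.sqrt (pureState ψ hψ).op = (pureState ψ hψ).op :=
  CFC.sqrt_unique (mul_self_pureState ψ hψ) (pureState ψ hψ).nonneg

lemma pureState_apply {H : Type*} [NormedAddCommGroup H] [InnerProductSpace ℂ H]
    [CompleteSpace H] (ψ : H) (hψ : ‖ψ‖ = 1) (x : H) :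
    (pureState ψ hψ).op x = inner ℂ ψ x • ψ := rfl

section Conj

variable {E : Type*} [NormedAddCommGroup E] [InnerProductSpace ℂ E] [CompleteSpace E]

lemma isStarProjection_conj (U : E ≃ₗᵢ[ℂ] E) {P : E →L[ℂ] E} (hP : IsStarProjection P) :
    IsStarProjection ((U.symm : E →L[ℂ] E) ∘L P ∘L (U : E →L[ℂ] E)) := by
  refine ⟨?_, ?_⟩
  · ext x
    have h := congrArg (· (U x)) hP.isIdempotentElem.eq
    simp only [mul_apply_eq_comp] at h
    simp [h]
  · rw [IsSelfAdjoint, ContinuousLinearMap.star_eq_adjoint]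
    ext x
    refine ext_inner_right ℂ fun y => ?_
    have h := hP.isSelfAdjoint.star_eq
    rw [ContinuousLinearMap.star_eq_adjoint] at h
    rw [ContinuousLinearMap.adjoint_inner_left]
    change inner ℂ x (U.symm (P (U y))) = inner ℂ (U.symm (P (U x))) y
    rw [← U.inner_map_map, U.apply_symm_apply, ← U.inner_map_map _ y, U.apply_symm_apply,
      ← ContinuousLinearMap.adjoint_inner_left, h]

omit [CompleteSpace E] in
/-- A densely defined symmetric relation is closable. -/
lemma snd_eq_zero_of_symmetric {g : Set (E × E)}
    (hsymm : ∀ p ∈ g, ∀ q ∈ g, inner ℂ p.1 q.2 = inner ℂ p.2 q.1)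
    (hdense : ∀ x, (∀ q ∈ g, inner ℂ x q.1 = 0) → x = 0) (p : E × E)
    (hp : p ∈ (Submodule.span ℂ g).topologicalClosure) (h0 : p.1 = 0) : p.2 = 0 := by
  refine hdense _ fun q hq => ?_
  let T : Submodule ℂ (E × E) :=
    LinearMap.eqLocus ((innerSL ℂ q.2) ∘L ContinuousLinearMap.fst ℂ E E).toLinearMap
      ((innerSL ℂ q.1) ∘L ContinuousLinearMap.snd ℂ E E).toLinearMap
  have hT : IsClosed (T : Set (E × E)) :=
    isClosed_eq (ContinuousLinearMap.continuous _) (ContinuousLinearMap.continuous _)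
  have hle : (Submodule.span ℂ g).topologicalClosure ≤ T := by
    refine Submodule.topologicalClosure_minimal _ (Submodule.span_le.2 fun r hr => ?_) hT
    exact (hsymm q hq r hr).symm
  have h1 : inner ℂ q.2 p.1 = inner ℂ q.1 p.2 := hle hp
  rw [h0, inner_zero_right] at h1
  rw [← inner_conj_symm, ← h1, map_zero]

end Conj

variable {H : Type*} [NormedAddCommGroup H] [InnerProductSpace ℂ H] [CompleteSpace H]
  {K : Type*} [NormedAddCommGroup K] [InnerProductSpace ℂ K] [CompleteSpace K]

omit [CompleteSpace H] [CompleteSpace K] in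
lemma eq_zero_of_inner_tmul {x : HilbertTensor H K} (h : ∀ ψ φ, inner ℂ x (tmul ψ φ) = 0) :
    x = 0 := by
  have h1 : innerSL ℂ x = 0 := tensor_ext fun ψ φ => h ψ φ
  rw [← inner_self_eq_zero (𝕜 := ℂ)]
  exact congrArg (· x) h1

omit [CompleteSpace H] [CompleteSpace K] in
/-- The graph of `A ⊗ 1` is the closure of the graph of its algebraic version. -/
lemma graph_tensorOne {A : H →ₗ.[ℂ] H} (hd : Dense (A.domain : Set H))
    (hs : ∀ u v : A.domain, inner ℂ (u : H) (A v) = inner ℂ (A u) (v : H)) :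
    (tensorOne (K := K) A).graph = (Submodule.span ℂ {p : HilbertTensor H K × HilbertTensor H K |
      ∃ (ψ : A.domain) (φ : K), p = (tmul (ψ : H) φ, tmul (A ψ) φ)}).topologicalClosure := by
  refine Submodule.toLinearPMap_graph_eq _ (snd_eq_zero_of_symmetric ?_ ?_)
  · rintro _ ⟨ψ, φ, rfl⟩ _ ⟨ψ', φ', rfl⟩
    simp only [inner_tmul_tmul, hs]
  · intro x hx
    refine eq_zero_of_inner_tmul fun ψ φ => ?_
    refine congrFun (Continuous.ext_on hd (f := fun ψ : H => inner ℂ x (tmulLeft φ ψ))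
      (g := fun _ => 0) (by fun_prop) continuous_const fun ψ hψ => ?_) ψ
    exact hx _ ⟨⟨ψ, hψ⟩, φ, rfl⟩

omit [CompleteSpace H] [CompleteSpace K] in
/-- The graph of `1 ⊗ Z` is the closure of the graph of its algebraic version. -/
lemma graph_oneTensor {Z : K →ₗ.[ℂ] K} (hd : Dense (Z.domain : Set K))
    (hs : ∀ u v : Z.domain, inner ℂ (u : K) (Z v) = inner ℂ (Z u) (v : K)) :
    (oneTensor (H := H) Z).graph = (Submodule.span ℂ {p : HilbertTensor H K × HilbertTensor H K |
      ∃ (ψ : H) (φ : Z.domain), p = (tmul ψ (φ : K), tmul ψ (Z φ))}).topologicalClosure := by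
  refine Submodule.toLinearPMap_graph_eq _ (snd_eq_zero_of_symmetric ?_ ?_)
  · rintro _ ⟨ψ, φ, rfl⟩ _ ⟨ψ', φ', rfl⟩
    simp only [inner_tmul_tmul, hs]
  · intro x hx
    refine eq_zero_of_inner_tmul fun ψ φ => ?_
    refine congrFun (Continuous.ext_on hd (f := fun φ : K => inner ℂ x (tmulRight ψ φ))
      (g := fun _ => 0) (by fun_prop) continuous_const fun φ hφ => ?_) φ
    exact hx _ ⟨ψ, ⟨φ, hφ⟩, rfl⟩

omit [CompleteSpace H] in
/-- The range of `1 ⊗ Z({λ})` consists of eigenvectors of `1 ⊗ Z`. -/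
lemma mem_graph_oneTensor {Z : K →ₗ.[ℂ] K} {F : Observable K} (hF : F.IsSpectralMeasureOf Z)
    (c : ℝ) (y : HilbertTensor H K) :
    (tensorOp 1 (F.toFun {c}) y, (c : ℂ) • tensorOp 1 (F.toFun {c}) y) ∈
      (oneTensor (H := H) Z).graph := by
  rw [graph_oneTensor hF.dense_domain hF.symm]
  set G := (Submodule.span ℂ {p : HilbertTensor H K × HilbertTensor H K |
      ∃ (ψ : H) (φ : Z.domain), p = (tmul ψ (φ : K), tmul ψ (Z φ))}).topologicalClosure with hG
  have hGc : IsClosed (G : Set (HilbertTensor H K × HilbertTensor H K)) :=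
    Submodule.isClosed_topologicalClosure _
  let L : HilbertTensor H K →L[ℂ] HilbertTensor H K × HilbertTensor H K :=
    (tensorOp 1 (F.toFun {c})).prod ((c : ℂ) • tensorOp 1 (F.toFun {c}))
  refine closed_submodule_eq_top (S := G.comap L.toLinearMap) (hGc.preimage L.continuous)
    (fun ψ φ => ?_) y
  obtain ⟨h, hZ⟩ := hF.eigenvector_of_toFun_singleton c (hF.isSharp.toFun_toFun_self {c} φ)
  refine Submodule.le_topologicalClosure _ (Submodule.subset_span ⟨ψ, ⟨_, h⟩, ?_⟩)
  change (tensorOp 1 (F.toFun {c}) (tmul ψ φ), (c : ℂ) • tensorOp 1 (F.toFun {c}) (tmul ψ φ)) = _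
  rw [hZ, tensorOp_tmul, smul_tmul_right]
  rfl

/-- The range of `|ψ⟩⟨ψ| ⊗ B` consists of elementary tensors. -/
lemma tensorOp_pureState (ψ : H) (hψ : ‖ψ‖ = 1) (B : K →L[ℂ] K) (x : HilbertTensor H K) :
    ∃ k, tensorOp (pureState ψ hψ).op B x = tmul ψ (B k) := by
  have hiso : Isometry (tmulRight ψ : K →L[ℂ] HilbertTensor H K) :=
    AddMonoidHomClass.isometry_of_norm _ fun k => by rw [tmulRight_apply, norm_tmul, hψ, one_mul]
  have hcl : IsClosed (Set.range (tmulRight ψ : K →L[ℂ] HilbertTensor H K)) :=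
    hiso.isClosedEmbedding.isClosed_range
  have h1 : x ∈ ((tmulRight ψ : K →L[ℂ] HilbertTensor H K).toLinearMap.range).comap
      (tensorOp (pureState ψ hψ).op 1).toLinearMap := by
    refine closed_submodule_eq_top ?_ (fun ψ' φ => ?_) x
    · exact hcl.preimage (ContinuousLinearMap.continuous _)
    · refine ⟨inner ℂ ψ ψ' • φ, ?_⟩
      change tmulRight ψ _ = tensorOp _ _ _
      rw [tensorOp_tmul, pureState_apply, tmulRight_apply, smul_tmul_right, smul_tmul_left]
      rfl
  obtain ⟨k, hk⟩ := h1
  refine ⟨k, ?_⟩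
  have h2 : tensorOp (pureState ψ hψ).op B = tensorOp 1 B * tensorOp (pureState ψ hψ).op 1 := by
    rw [tensorOp_mul, one_mul, mul_one]
  rw [h2, mul_apply_eq_comp]
  have h3 : tmul ψ k = tensorOp (pureState ψ hψ).op 1 x := hk
  rw [← h3, tensorOp_tmul]
  rfl

namespace MeasurementScheme

universe v

variable {H : Type v} [NormedAddCommGroup H] [InnerProductSpace ℂ H] [CompleteSpace H]

/-- The event `U* (1 ⊗ Z(X)) U` of the compound system. -/
noncomputable def event (M : MeasurementScheme.{u} H) (X : Set ℝ) :
    HilbertTensor H M.K →L[ℂ] HilbertTensor H M.K :=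
  (M.U.symm : HilbertTensor H M.K →L[ℂ] HilbertTensor H M.K) ∘L
    tensorOp 1 (M.pointer.toFun X) ∘L (M.U : HilbertTensor H M.K →L[ℂ] HilbertTensor H M.K)

lemma isStarProjection_event (M : MeasurementScheme.{u} H) (X : Set ℝ) :
    IsStarProjection (M.event X) :=
  isStarProjection_conj M.U
    (isStarProjection_tensorOp (IsStarProjection.one _) (M.isSpectralMeasure.isSharp X))

/-- A sharp observable is measured, for instance, by handing the system over to a probe of the same
kind, on which the observable is then read off. -/
lemma exists_measures {A : H →ₗ.[ℂ] H} {C : Observable H} (hC : C.IsSpectralMeasureOf A)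
    {ψ : H} (hψ : ‖ψ‖ = 1) : ∃ M : MeasurementScheme.{v} H, M.Measures C := by
  refine ⟨{ K := H, σ := pureState ψ hψ, Z := A, pointer := C, isSpectralMeasure := hC, U := swap },
    fun ρ X hX => ?_⟩
  -- With the swap as coupling, the pointer event is the event of the system itself.
  have hE : (((swap (H := H)).symm : HilbertTensor H H ≃ₗᵢ[ℂ] HilbertTensor H H) :
      HilbertTensor H H →L[ℂ] HilbertTensor H H) ∘L
      tensorOp 1 (C.toFun X) ∘L ((swap (H := H) : HilbertTensor H H ≃ₗᵢ[ℂ] HilbertTensor H H) :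
      HilbertTensor H H →L[ℂ] HilbertTensor H H) = tensorOp (C.toFun X) 1 := by
    refine tensor_ext fun ψ φ => ?_
    change swap (tensorOp 1 (C.toFun X) (swap (tmul ψ φ))) = _
    rw [swap_tmul, tensorOp_tmul, swap_tmul, tensorOp_tmul]
  change trace _ = trace (tensorOp ρ.op (pureState ψ hψ).op ∘L _)
  rw [hE]
  obtain ⟨t, ht, hs⟩ := ρ.hasSum_trace_projection (hC.isSharp X)
  obtain ⟨t', ht', hs'⟩ := hasSum_trace_tensorOp ρ (pureState ψ hψ)
    (isStarProjection_tensorOp (hC.isSharp X) (IsStarProjection.one _))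
  rw [ht, ht']
  simp only [tensorOp_tmul, norm_tmul, mul_pow, one_apply_eq_self] at hs'
  have h := HasSum.mul hs (pureState ψ hψ).hasSum_norm_sqrt hs'.summable
  rw [← h.unique hs', mul_one]

/-- If a sharp event is certain in the state `φ`, then the corresponding pointer event is certain
whenever the system starts in `φ`. -/
lemma event_tmul {M : MeasurementScheme.{u} H} {C : Observable H} (hM : M.Measures C)
    (hC : C.IsSharp) {φ : H} (hφ : ‖φ‖ = 1) {X : Set ℝ} (hX : MeasurableSet X)
    (h : C.toFun X φ = φ) (k : M.K) :
    M.event X (tmul φ (CFC.sqrt M.σ.op k)) = tmul φ (CFC.sqrt M.σ.op k) := by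
  obtain ⟨t, ht, hs⟩ := (pureState φ hφ).hasSum_trace_projection (hC X)
  obtain ⟨t', ht', hs'⟩ := hasSum_trace_tensorOp (pureState φ hφ) M.σ (M.isStarProjection_event X)
  have htt : t = t' := by
    have h1 := hM (pureState φ hφ) X hX
    change _ = trace (tensorOp _ _ ∘L M.event X) at h1
    rw [ht, ht'] at h1
    exact_mod_cast h1
  simp only [sqrt_pureState, pureState_apply, map_smul, h] at hs hs'
  have hone : HasSum (fun i => ‖inner ℂ φ (basis H i) • φ‖ ^ 2) 1 := by
    have := (pureState φ hφ).hasSum_norm_sqrt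
    simpa only [sqrt_pureState, pureState_apply] using this
  have ht1 : t = 1 := hs.unique hone
  have hall : HasSum (fun p : basisIndex H × basisIndex M.K =>
      ‖tmul (inner ℂ φ (basis H p.1) • φ) (CFC.sqrt M.σ.op (basis M.K p.2))‖ ^ 2) 1 := by
    simp only [norm_tmul, mul_pow]
    have hsm := Summable.mul_of_nonneg (f := fun i => ‖inner ℂ φ (basis H i) • φ‖ ^ 2)
      (g := fun j => ‖CFC.sqrt M.σ.op (basis M.K j)‖ ^ 2) hone.summable
      M.σ.hasSum_norm_sqrt.summable (fun _ => sq_nonneg _) (fun _ => sq_nonneg _)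
    simpa using HasSum.mul hone M.σ.hasSum_norm_sqrt hsm
  rw [← htt, ht1] at hs'
  have hle (v : HilbertTensor H M.K) :
      ‖v - M.event X v‖ ^ 2 = ‖v‖ ^ 2 - ‖M.event X v‖ ^ 2 := by
    have hE := M.isStarProjection_event X
    have h1 : inner ℂ (M.event X v) v = inner ℂ (M.event X v) (M.event X v) := by
      conv_rhs => rw [← ContinuousLinearMap.adjoint_inner_left,
        ← ContinuousLinearMap.star_eq_adjoint, hE.isSelfAdjoint.star_eq, ← mul_apply_eq_comp,
        hE.isIdempotentElem.eq]
    have h2 : inner ℂ (v - M.event X v) (v - M.event X v) =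
        inner ℂ v v - inner ℂ (M.event X v) (M.event X v) := by
      rw [inner_sub_left, inner_sub_right, inner_sub_right, h1, ← inner_conj_symm v (M.event X v),
        h1, inner_self_eq_ofReal (M.event X v), Complex.conj_ofReal]
      ring
    rw [inner_self_eq_ofReal, inner_self_eq_ofReal, inner_self_eq_ofReal] at h2
    exact_mod_cast h2
  -- The defects `‖v‖² - ‖E v‖²` over the product basis are nonnegative and sum to `1 - 1 = 0`.
  have hz := hall.sub hs'
  simp only [← hle, sub_self] at hz
  have hz' := (hasSum_zero_iff_of_nonneg fun p => sq_nonneg _).1 hz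
  -- A basis vector that is not orthogonal to `φ` lets the factor on the system be cancelled.
  obtain ⟨i, hi⟩ : ∃ i, inner ℂ φ (basis H i) ≠ 0 := by
    by_contra! hcon
    simp only [hcon, zero_smul, norm_zero, ne_eq, OfNat.ofNat_ne_zero, not_false_eq_true,
      zero_pow] at hone
    exact one_ne_zero (hone.unique hasSum_zero)
  have key : (M.event X ∘L tmulRight φ) ∘L CFC.sqrt M.σ.op = tmulRight φ ∘L CFC.sqrt M.σ.op := by
    refine clm_ext_basis (basis M.K) fun j => ?_
    have hij := congrFun hz' (i, j)
    simp only [Pi.zero_apply, ne_eq, OfNat.ofNat_ne_zero, not_false_eq_true, pow_eq_zero_iff,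
      norm_eq_zero] at hij
    rw [smul_tmul_left, map_smul, ← smul_sub] at hij
    exact (sub_eq_zero.1 ((smul_eq_zero.1 hij).resolve_left hi)).symm
  exact congrArg (· k) key

lemma outputOp_apply (M : MeasurementScheme.{u} H) {x y : HilbertTensor H M.K}
    (h : (M.U x, y) ∈ (oneTensor (H := H) M.Z).graph) :
    ∃ hx : x ∈ M.outputOp.domain, M.outputOp ⟨x, hx⟩ = M.U.symm y := by
  rw [LinearPMap.mem_graph_iff] at h
  obtain ⟨z, hz, hzy⟩ := h
  have h1 : M.U x ∈ (oneTensor (H := H) M.Z).domain := by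
    rw [← show (z : _) = M.U x from hz]
    exact z.2
  have hz' : z = ⟨M.U x, h1⟩ := Subtype.ext hz
  refine ⟨⟨⟨trivial, h1⟩, trivial⟩, ?_⟩
  subst hz'
  rw [← show _ = y from hzy]
  rfl

/-- On product vectors built from the probe state, the output operator of a scheme that measures the
diagonal operator `A` acts as `A ⊗ 1`. -/
lemma mem_graph_of_measures {ι : Type*} {A : H →ₗ.[ℂ] H} {e : HilbertBasis ι ℂ H} {l : ι → ℝ}
    (hA : IsDiagonal A e l) {C : Observable H} (hC : C.IsSpectralMeasureOf A)
    {M : MeasurementScheme.{u} H} (hM : M.Measures C) (ψ : A.domain) (k : M.K) :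
    (M.U (tmul (ψ : H) (CFC.sqrt M.σ.op k)), M.U (tmul (A ψ) (CFC.sqrt M.σ.op k))) ∈
      (oneTensor (H := H) M.Z).graph := by
  set k' := CFC.sqrt M.σ.op k with hk'
  let L : H →L[ℂ] HilbertTensor H M.K :=
    (M.U : HilbertTensor H M.K →L[ℂ] HilbertTensor H M.K) ∘L tmulLeft k'
  have hG : IsClosed ((oneTensor (H := H) M.Z).graph :
      Set (HilbertTensor H M.K × HilbertTensor H M.K)) := by
    rw [graph_oneTensor M.isSpectralMeasure.dense_domain M.isSpectralMeasure.symm]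
    exact Submodule.isClosed_topologicalClosure _
  have hn (i : ι) : (L (e i), (l i : ℂ) • L (e i)) ∈ (oneTensor (H := H) M.Z).graph := by
    have h1 : C.toFun {l i} (e i) = e i :=
      hC.toFun_singleton_of_eigenvector ⟨e i, hA.basis_mem_domain i⟩ (l i) (hA.apply_basis i)
    have h2 := event_tmul hM hC.isSharp (e.orthonormal.1 i) (measurableSet_singleton (l i)) h1 k
    have h3 : tensorOp 1 (M.pointer.toFun {l i}) (L (e i)) = L (e i) := by
      have h4 := congrArg M.U h2
      change M.U (M.U.symm (tensorOp 1 (M.pointer.toFun {l i}) (L (e i)))) = L (e i) at h4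
      rwa [M.U.apply_symm_apply] at h4
    have h5 := mem_graph_oneTensor (H := H) M.isSpectralMeasure (l i) (L (e i))
    rwa [h3] at h5
  -- The graph is closed and contains the partial sums of the expansion in eigenvectors.
  have s1 := (e.hasSum_repr (ψ : H)).mapL L
  have s2 := (hA.hasSum_apply ψ).mapL L
  have s3 := s1.prodMk s2
  refine hG.mem_of_tendsto s3 (Filter.Eventually.of_forall fun s => ?_)
  refine Submodule.sum_mem _ fun i _ => ?_
  have h := Submodule.smul_mem _ (inner ℂ (e i) (ψ : H)) (hn i)
  rw [HilbertBasis.repr_apply_apply, map_smul, map_smul, map_smul]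
  exact h

/-- A scheme that measures a diagonal operator `A` measures an operator `B` without error in every
state `ψ` with `A ψ = B ψ`. -/
lemma noError_eq_zero {ι : Type*} {A B : H →ₗ.[ℂ] H} {e : HilbertBasis ι ℂ H} {l : ι → ℝ}
    (hA : IsDiagonal A e l) {C F : Observable H} (hC : C.IsSpectralMeasureOf A)
    (hF : F.IsSpectralMeasureOf B) {M : MeasurementScheme.{u} H} (hM : M.Measures C)
    {ψ : H} (hψ : ‖ψ‖ = 1) (hψA : ψ ∈ A.domain) (hψB : ψ ∈ B.domain)
    (hAB : A ⟨ψ, hψA⟩ = B ⟨ψ, hψB⟩) : noError B M (pureState ψ hψ) = 0 := by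
  have h : secondMoment (tensorOp (pureState ψ hψ).op M.σ.op) (M.noiseOp B) = 0 := by
    refine secondMoment_eq_zero (S := tensorOp (pureState ψ hψ).op (CFC.sqrt M.σ.op))
      (R := tensorOp (pureState ψ hψ).op (CFC.sqrt (CFC.sqrt M.σ.op))) ?_ ?_ fun x => ?_
    · rw [tensorOp_mul, mul_self_pureState, CFC.sqrt_mul_sqrt_self _ M.σ.nonneg]
    · rw [star_tensorOp, (CFC.sqrt_nonneg (CFC.sqrt M.σ.op)).isSelfAdjoint.star_eq,
        (pureState ψ hψ).nonneg.isSelfAdjoint.star_eq, tensorOp_mul, mul_self_pureState,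
        CFC.sqrt_mul_sqrt_self _ (CFC.sqrt_nonneg M.σ.op)]
    · obtain ⟨k, hk⟩ := tensorOp_pureState ψ hψ (CFC.sqrt M.σ.op) x
      obtain ⟨h1, h2⟩ := M.outputOp_apply (mem_graph_of_measures hA hC hM ⟨ψ, hψA⟩ k)
      have h3 : (tmul ψ (CFC.sqrt M.σ.op k), tmul (B ⟨ψ, hψB⟩) (CFC.sqrt M.σ.op k)) ∈
          (tensorOne (K := M.K) B).graph := by
        rw [graph_tensorOne hF.dense_domain hF.symm]
        exact Submodule.le_topologicalClosure _
          (Submodule.subset_span ⟨⟨ψ, hψB⟩, CFC.sqrt M.σ.op k, rfl⟩)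
      rw [LinearPMap.mem_graph_iff] at h3
      obtain ⟨⟨z, hz⟩, hz1, hz2⟩ := h3
      obtain rfl : z = tmul ψ (CFC.sqrt M.σ.op k) := hz1
      rw [hk]
      refine ⟨⟨h1, hz⟩, ?_⟩
      change M.outputOp ⟨_, h1⟩ - tensorOne B ⟨_, hz⟩ = 0
      rw [h2, show _ = tmul (B ⟨ψ, hψB⟩) _ from hz2, M.U.symm_apply_apply, hAB, sub_self]
  rw [noError, h]
  simp

end MeasurementScheme

end Scheme

/-! ### The position operator -/

section Position

lemma mem_domain_position {ψ : L2R} :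
    ψ ∈ position.domain ↔ MemLp (fun x : ℝ => (x : ℂ) * ψ x) 2 volume := Iff.rfl

lemma coeFn_position (ψ : position.domain) :
    position ψ =ᵐ[volume] fun x => (x : ℂ) * (ψ : L2R) x :=
  MemLp.coeFn_toLp ψ.2

lemma mem_graph_position {p : L2R × L2R} :
    p ∈ position.graph ↔ p.2 =ᵐ[volume] fun x => (x : ℂ) * p.1 x := by
  rw [LinearPMap.mem_graph_iff]
  constructor
  · rintro ⟨z, hz, hz2⟩
    rw [← hz, ← hz2]
    exact coeFn_position z
  · intro h
    have hd : p.1 ∈ position.domain := (memLp_congr_ae h).1 (Lp.memLp p.2)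
    refine ⟨⟨p.1, hd⟩, rfl, Lp.ext ?_⟩
    filter_upwards [coeFn_position ⟨p.1, hd⟩, h] with x hx hx'
    rw [hx, hx']

lemma isClosed_position : position.IsClosed := by
  -- A convergent sequence in the graph has a subsequence that converges almost everywhere.
  refine IsSeqClosed.isClosed fun u p hu hp => ?_
  have h1 : Filter.Tendsto (fun n => (u n).1) Filter.atTop (𝓝 p.1) :=
    (continuous_fst.tendsto p).comp hp
  have h2 : Filter.Tendsto (fun n => (u n).2) Filter.atTop (𝓝 p.2) :=
    (continuous_snd.tendsto p).comp hp
  obtain ⟨ns, hns, hae⟩ := (tendstoInMeasure_of_tendsto_Lp h1).exists_seq_tendsto_ae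
  obtain ⟨ms, hms, hae'⟩ := (tendstoInMeasure_of_tendsto_Lp
    (h2.comp hns.tendsto_atTop)).exists_seq_tendsto_ae
  refine mem_graph_position.2 ?_
  have hall : ∀ᵐ x, ∀ n, (u n).2 x = (x : ℂ) * (u n).1 x :=
    ae_all_iff.2 fun n => mem_graph_position.1 (hu n)
  filter_upwards [hae, hae', hall] with x hx hx' hxa
  refine tendsto_nhds_unique hx' ?_
  have h3 := (hx.comp hms.tendsto_atTop).const_mul (x : ℂ)
  refine h3.congr fun n => ?_
  exact (hxa _).symm

/-- Multiplication by the indicator function of a Borel set, as a linear map. -/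
noncomputable def indicatorLinearMap {X : Set ℝ} (hX : MeasurableSet X) : L2R →ₗ[ℂ] L2R where
  toFun ψ := MemLp.toLp (X.indicator ψ) ((Lp.memLp ψ).indicator hX)
  map_add' ψ φ := by
    rw [← MemLp.toLp_add, MemLp.toLp_eq_toLp_iff]
    filter_upwards [Lp.coeFn_add ψ φ] with x hx
    by_cases h : x ∈ X
    · simp only [Pi.add_apply, Set.indicator_of_mem h, hx]
    · simp only [Pi.add_apply, Set.indicator_of_notMem h, add_zero]
  map_smul' c ψ := by
    rw [RingHom.id_apply, ← MemLp.toLp_const_smul, MemLp.toLp_eq_toLp_iff]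
    filter_upwards [Lp.coeFn_smul c ψ] with x hx
    by_cases h : x ∈ X
    · simp only [Pi.smul_apply, Set.indicator_of_mem h, hx]
    · simp only [Pi.smul_apply, Set.indicator_of_notMem h, smul_zero]

lemma indicatorLinearMap_apply {X : Set ℝ} (hX : MeasurableSet X) (ψ : L2R) :
    indicatorLinearMap hX ψ = MemLp.toLp (X.indicator ψ) ((Lp.memLp ψ).indicator hX) := rfl

lemma coeFn_indicatorLinearMap {X : Set ℝ} (hX : MeasurableSet X) (ψ : L2R) :
    indicatorLinearMap hX ψ =ᵐ[volume] X.indicator ψ := by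
  rw [indicatorLinearMap_apply]
  exact MemLp.coeFn_toLp _

lemma norm_indicatorLinearMap_le {X : Set ℝ} (hX : MeasurableSet X) (ψ : L2R) :
    ‖indicatorLinearMap hX ψ‖ ≤ 1 * ‖ψ‖ := by
  rw [one_mul]
  refine Lp.norm_le_norm_of_ae_le ?_
  filter_upwards [coeFn_indicatorLinearMap hX ψ] with x hx
  rw [hx]
  exact norm_indicator_le_norm_self _ _

open scoped Classical in
/-- Multiplication by the indicator function of a Borel set `X`, as a bounded operator (`0` if `X`
is not a Borel set). -/
noncomputable def indicatorOp (X : Set ℝ) : L2R →L[ℂ] L2R :=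
  if hX : MeasurableSet X then
    (indicatorLinearMap hX).mkContinuous 1 (norm_indicatorLinearMap_le hX)
  else 0

lemma coeFn_indicatorOp {X : Set ℝ} (hX : MeasurableSet X) (ψ : L2R) :
    indicatorOp X ψ =ᵐ[volume] X.indicator ψ := by
  rw [indicatorOp, dif_pos hX]
  exact coeFn_indicatorLinearMap hX ψ

lemma indicatorOp_mul {X Y : Set ℝ} (hX : MeasurableSet X) (hY : MeasurableSet Y) :
    indicatorOp X * indicatorOp Y = indicatorOp (X ∩ Y) := by
  ext1 ψ
  refine Lp.ext ?_
  filter_upwards [coeFn_indicatorOp hX (indicatorOp Y ψ), coeFn_indicatorOp hY ψ,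
    coeFn_indicatorOp (hX.inter hY) ψ] with x h1 h2 h3
  rw [h3, mul_apply_eq_comp, h1]
  by_cases hx : x ∈ X <;> by_cases hy : x ∈ Y <;> simp [hx, hy, h2]

lemma isStarProjection_indicatorOp {X : Set ℝ} (hX : MeasurableSet X) :
    IsStarProjection (indicatorOp X) := by
  refine ⟨by rw [IsIdempotentElem, indicatorOp_mul hX hX, Set.inter_self], ?_⟩
  rw [IsSelfAdjoint, ContinuousLinearMap.star_eq_adjoint]
  ext1 ψ
  refine ext_inner_right ℂ fun φ => ?_
  rw [ContinuousLinearMap.adjoint_inner_left, L2.inner_def, L2.inner_def]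
  refine integral_congr_ae ?_
  filter_upwards [coeFn_indicatorOp hX ψ, coeFn_indicatorOp hX φ] with x h1 h2
  rw [h1, h2]
  by_cases hx : x ∈ X <;> simp [hx]

/-- The position distribution `|ψ(x)|² dx`. -/
noncomputable def positionMeasure (ψ : L2R) : Measure ℝ :=
  volume.withDensity fun x => ((‖ψ x‖₊ ^ 2 : ℝ≥0) : ℝ≥0∞)

lemma measurable_nnnorm_sq (ψ : L2R) : Measurable fun x => ‖ψ x‖₊ ^ 2 :=
  (Lp.stronglyMeasurable ψ).measurable.nnnorm.pow_const 2

lemma memLp_two_iff {f : ℝ → ℂ} (hf : AEStronglyMeasurable f volume) :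
    MemLp f 2 volume ↔ ∫⁻ x, ‖f x‖ₑ ^ 2 < ∞ := by
  rw [MemLp, and_iff_right hf,
    eLpNorm_lt_top_iff_lintegral_rpow_enorm_lt_top (by norm_num) (by norm_num)]
  simp

lemma coe_nnnorm_sq (z : ℂ) : ((‖z‖₊ ^ 2 : ℝ≥0) : ℝ≥0∞) = ‖z‖ₑ ^ 2 := by
  rw [enorm_eq_nnnorm]; norm_cast

instance (ψ : L2R) : IsFiniteMeasure (positionMeasure ψ) := by
  refine isFiniteMeasure_withDensity ?_
  simp only [coe_nnnorm_sq]
  exact ((memLp_two_iff (Lp.aestronglyMeasurable ψ)).1 (Lp.memLp ψ)).ne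

lemma inner_indicatorOp {X : Set ℝ} (hX : MeasurableSet X) (ψ : L2R) :
    inner ℂ ψ (indicatorOp X ψ) = (((positionMeasure ψ).real X : ℝ) : ℂ) := by
  have h1 : (positionMeasure ψ).real X = ∫ x in X, ‖ψ x‖ ^ 2 := by
    rw [measureReal_def, positionMeasure, withDensity_apply _ hX,
      integral_eq_lintegral_of_nonneg_ae (Filter.Eventually.of_forall fun x => by positivity)
        (by fun_prop)]
    congr 1
    refine lintegral_congr fun x => ?_
    rw [coe_nnnorm_sq, ← ofReal_norm, ENNReal.ofReal_pow (norm_nonneg _)]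
  rw [h1, ← integral_indicator hX, ← integral_complex_ofReal, L2.inner_def]
  refine integral_congr_ae ?_
  filter_upwards [coeFn_indicatorOp hX ψ] with x hx
  rw [hx]
  by_cases h : x ∈ X
  · simp only [h, Set.indicator_of_mem, inner_self_eq_ofReal]
  · simp [h]

lemma exists_isSpectralMeasureOf_position :
    ∃ F : Observable L2R, F.IsSpectralMeasureOf position := by
  have hP : ∀ X, MeasurableSet X → IsStarProjection (indicatorOp X) :=
    fun X hX => isStarProjection_indicatorOp hX
  have huniv : indicatorOp Set.univ = 1 := by
    ext1 ψ
    refine Lp.ext ?_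
    filter_upwards [coeFn_indicatorOp .univ ψ] with x hx
    rw [hx]; simp
  have hmul : ∀ X Y, MeasurableSet X → MeasurableSet Y →
      indicatorOp X * indicatorOp Y = indicatorOp (X ∩ Y) := fun X Y hX hY => indicatorOp_mul hX hY
  have hμ : ∀ X, MeasurableSet X → ∀ ψ,
      inner ℂ ψ (indicatorOp X ψ) = (((positionMeasure ψ).real X : ℝ) : ℂ) :=
    fun X hX ψ => inner_indicatorOp hX ψ
  refine ⟨.ofProjections indicatorOp positionMeasure hP huniv hmul hμ,
    Observable.isSharp_ofProjections hP huniv hmul hμ, fun ψ => ?_, fun ψ => ?_⟩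
  · have hm : AEStronglyMeasurable (fun x : ℝ => (x : ℂ) * ψ x) volume :=
      Complex.continuous_ofReal.aestronglyMeasurable.mul (Lp.aestronglyMeasurable ψ)
    rw [Observable.vectorMeasure_ofProjections, mem_domain_position, memLp_two_iff hm,
      positionMeasure, lintegral_withDensity_eq_lintegral_mul _
        (measurable_nnnorm_sq ψ).coe_nnreal_ennreal (by fun_prop)]
    refine iff_of_eq (congrArg (· < ∞) (lintegral_congr fun x => ?_))
    rw [Pi.mul_apply, coe_nnnorm_sq, enorm_mul, mul_pow, mul_comm, ← ofReal_norm (x : ℂ),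
      ← ENNReal.ofReal_pow (norm_nonneg _), Complex.norm_real, Real.norm_eq_abs, sq_abs]
  · rw [Observable.vectorMeasure_ofProjections, positionMeasure,
      integral_withDensity_eq_integral_smul (measurable_nnnorm_sq ψ), ← integral_complex_ofReal,
      L2.inner_def]
    refine integral_congr_ae ?_
    filter_upwards [coeFn_position ψ] with x hx
    rw [hx, ← smul_eq_mul, inner_smul_right, inner_self_eq_ofReal]
    simp [NNReal.smul_def, mul_comm]

variable {F : Observable L2R} (hF : F.IsSpectralMeasureOf position)
include hF

/-- Position has no eigenvalues: an eigenfunction would be supported in a single point. -/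
lemma hasPurelyContinuousSpectrum_position : F.HasPurelyContinuousSpectrum := by
  intro c
  ext1 ψ
  obtain ⟨h, he⟩ := hF.eigenvector_of_toFun_singleton c (hF.isSharp.toFun_toFun_self {c} ψ)
  refine Lp.ext ?_
  have hc : ∀ᵐ x : ℝ, x ≠ c := by simp [ae_iff]
  have h1 := coeFn_position ⟨_, h⟩
  rw [he] at h1
  filter_upwards [h1, Lp.coeFn_smul (c : ℂ) (F.toFun {c} ψ), hc, Lp.coeFn_zero ℂ 2 volume]
    with x hx1 hx2 hx3 hx4
  rw [hx2, Pi.smul_apply, smul_eq_mul] at hx1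
  have h2 : ((c : ℂ) - x) * F.toFun {c} ψ x = 0 := by rw [sub_mul, hx1, sub_self]
  rw [zero_apply, hx4]
  refine (mul_eq_zero.1 h2).resolve_left ?_
  change (c : ℂ) - x ≠ 0
  rw [sub_ne_zero]
  exact_mod_cast hx3.symm

/-- Functions concentrated near `c` are approximate eigenfunctions, so every `c` is in the
spectrum. -/
lemma spectrum_position : F.spectrum = Set.univ := by
  refine Set.eq_univ_of_forall fun c U hU hUo h0 => ?_
  obtain ⟨r, hr, hball⟩ := Metric.mem_nhds_iff.1 hU
  rw [Real.ball_eq_Ioo] at hball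
  have h1 : F.toFun (Set.Ioo (c - r) (c + r)) = 0 := by
    rw [← Set.inter_eq_left.2 hball, ← hF.isSharp.mul_toFun measurableSet_Ioo hUo.measurableSet,
      h0, mul_zero]
  -- On the interval of length `r / 4` that carries `ψ`, `Q - c` has norm at most `r / 4 < r / 2`.
  let ψ : L2R := indicatorConstLp 2 (measurableSet_Icc (a := c) (b := c + r / 4)) (by simp) 1
  have hψ : ψ =ᵐ[volume] (Set.Icc c (c + r / 4)).indicator fun _ => (1 : ℂ) :=
    indicatorConstLp_coeFn
  have hd : ψ ∈ position.domain := by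
    rw [mem_domain_position]
    refine MemLp.mono ((Lp.memLp ψ).const_mul ((|c| + r : ℝ) : ℂ))
      (Complex.continuous_ofReal.aestronglyMeasurable.mul (Lp.aestronglyMeasurable ψ)) ?_
    filter_upwards [hψ] with x hx
    rw [norm_mul, norm_mul, Complex.norm_real, Complex.norm_real, hx]
    by_cases hxI : x ∈ Set.Icc c (c + r / 4)
    · refine mul_le_mul_of_nonneg_right ?_ (norm_nonneg _)
      rw [Real.norm_eq_abs, Real.norm_eq_abs, abs_of_nonneg (a := |c| + r) (by positivity), abs_le]
      constructor <;> linarith [hxI.1, hxI.2, neg_abs_le c, le_abs_self c]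
    · simp [hxI]
  have h2 := hF.norm_le_of_toFun_eq_zero hr h1 ⟨ψ, hd⟩
  have h3 : ‖position ⟨ψ, hd⟩ - (c : ℂ) • ψ‖ ≤ r / 4 * ‖ψ‖ := by
    refine Lp.norm_le_mul_norm_of_ae_le_mul ?_
    filter_upwards [Lp.coeFn_sub (position ⟨ψ, hd⟩) ((c : ℂ) • ψ), Lp.coeFn_smul (c : ℂ) ψ,
      coeFn_position ⟨ψ, hd⟩, hψ] with x hx1 hx2 hx3 hx4
    rw [hx1, Pi.sub_apply, hx2, hx3, Pi.smul_apply, smul_eq_mul, ← sub_mul, norm_mul, hx4]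
    by_cases hxI : x ∈ Set.Icc c (c + r / 4)
    · refine mul_le_mul_of_nonneg_right ?_ (norm_nonneg _)
      rw [← Complex.ofReal_sub, Complex.norm_real, Real.norm_eq_abs, abs_of_nonneg] <;>
        linarith [hxI.1, hxI.2]
    · simp [hxI]
  have h4 : 0 < ‖ψ‖ := by
    rw [norm_indicatorConstLp (by norm_num) (by norm_num), norm_one, one_mul]
    refine Real.rpow_pos_of_pos ?_ _
    rw [measureReal_def, Real.volume_Icc, ENNReal.toReal_ofReal] <;> linarith
  have h5 : r * ‖ψ‖ ≤ 2 * (r / 4 * ‖ψ‖) := h2.trans (by linarith)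
  nlinarith [mul_pos hr h4]

/-- A countable set is a null set for every position distribution. -/
lemma toFun_countable {S : Set ℝ} (hS : S.Countable) : F.toFun S = 0 := by
  ext1 ψ
  have h : F.vectorMeasure ψ S = 0 := by
    rw [measure_null_iff_singleton hS]
    intro x _
    rw [hF.isSharp.vectorMeasure_apply (measurableSet_singleton x),
      hasPurelyContinuousSpectrum_position hF x]
    simp
  rw [hF.isSharp.vectorMeasure_apply hS.measurableSet] at h
  simpa using h

end Position

/-! ### Position and derivative on Schwartz functions -/

section SchwartzOperators

/-- Multiplication by the coordinate on Schwartz functions. -/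
noncomputable def mulX : 𝓢(ℝ, ℂ) →L[ℂ] 𝓢(ℝ, ℂ) :=
  SchwartzMap.smulLeftCLM ℂ (fun x : ℝ => (x : ℂ))

lemma mulX_apply (f : 𝓢(ℝ, ℂ)) (x : ℝ) : mulX f x = x * f x := by
  rw [mulX, SchwartzMap.smulLeftCLM_apply_apply Function.Complex.hasTemperateGrowth_ofReal, smul_eq_mul]

/-- The derivative on Schwartz functions. -/
noncomputable abbrev derivS : 𝓢(ℝ, ℂ) →L[ℂ] 𝓢(ℝ, ℂ) := SchwartzMap.derivCLM ℂ ℂ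

lemma derivS_mulX (f : 𝓢(ℝ, ℂ)) : derivS (mulX f) = f + mulX (derivS f) := by
  ext x
  rw [SchwartzMap.derivCLM_apply, add_apply, mulX_apply, SchwartzMap.derivCLM_apply]
  have h1 : (mulX f : ℝ → ℂ) = fun y : ℝ => (y : ℂ) * f y := funext (mulX_apply f)
  have h2 : HasDerivAt (fun y : ℝ => (y : ℂ)) 1 x := Complex.ofRealCLM.hasDerivAt
  have h3 := h2.fun_mul (f.hasDerivAt x)
  rw [h1, h3.deriv, one_mul]

lemma schwartz_add (f g : 𝓢(ℝ, ℂ)) : schwartz (f + g) = schwartz f + schwartz g := rfl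

lemma schwartz_sub (f g : 𝓢(ℝ, ℂ)) : schwartz (f - g) = schwartz f - schwartz g := rfl

lemma schwartz_smul (c : ℂ) (f : 𝓢(ℝ, ℂ)) : schwartz (c • f) = c • schwartz f := rfl

lemma coeFn_schwartz (f : 𝓢(ℝ, ℂ)) : schwartz f =ᵐ[volume] f := f.coeFn_toLp 2 volume

lemma inner_schwartz (f g : 𝓢(ℝ, ℂ)) :
    inner ℂ (schwartz f) (schwartz g) = ∫ x, inner ℂ (f x) (g x) :=
  SchwartzMap.inner_toL2_toL2_eq f g volume

lemma inner_schwartz_left (f : 𝓢(ℝ, ℂ)) (ψ : L2R) :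
    inner ℂ (schwartz f) ψ = ∫ x, inner ℂ (f x) (ψ x) := by
  rw [L2.inner_def]
  refine integral_congr_ae ?_
  filter_upwards [coeFn_schwartz f] with x hx
  rw [hx]

lemma inner_mulX (f g : 𝓢(ℝ, ℂ)) :
    inner ℂ (schwartz (mulX f)) (schwartz g) = inner ℂ (schwartz f) (schwartz (mulX g)) := by
  rw [inner_schwartz, inner_schwartz]
  congr 1
  ext x
  rw [mulX_apply, mulX_apply]
  simp only [RCLike.inner_apply, map_mul, Complex.conj_ofReal]
  ring

lemma inner_derivS (f g : 𝓢(ℝ, ℂ)) :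
    inner ℂ (schwartz (derivS f)) (schwartz g) = -inner ℂ (schwartz f) (schwartz (derivS g)) := by
  rw [inner_schwartz, inner_schwartz, eq_neg_iff_add_eq_zero, add_comm, ← eq_neg_iff_add_eq_zero]
  have h := SchwartzMap.integral_bilinear_deriv_right_eq_neg_left f g
    ((ContinuousLinearMap.mul ℝ ℂ).comp (Complex.conjCLE : ℂ →L[ℝ] ℂ))
  have e : ∀ z w : ℂ, inner ℂ z w = ((ContinuousLinearMap.mul ℝ ℂ).comp
      (Complex.conjCLE : ℂ →L[ℝ] ℂ)) z w := fun z w => mul_comm _ _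
  simp only [e, derivS, SchwartzMap.derivCLM_apply]
  exact h

lemma dense_schwartz : Dense (Set.range schwartz) :=
  SchwartzMap.denseRange_toLpCLM (E := ℝ) (F := ℂ) (p := 2) (by norm_num) (μ := volume)

lemma schwartz_injective : Function.Injective schwartz :=
  SchwartzMap.injective_toLp 2 volume

end SchwartzOperators

/-! ### Gaussians as Schwartz functions -/

section Gaussian

lemma pow_mul_exp_le (k : ℕ) (x : ℝ) :
    |x| ^ k * Real.exp (-(x ^ 2 / 2)) ≤ 1 + 2 ^ k * k.factorial := by
  have h1 : (x ^ 2 / 2) ^ k / k.factorial ≤ Real.exp (x ^ 2 / 2) :=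
    Real.pow_div_factorial_le_exp _ (by positivity) k
  have h2 : |x| ^ k ≤ 1 + (x ^ 2) ^ k := by
    rw [← sq_abs, ← pow_mul, mul_comm, pow_mul]
    nlinarith [sq_nonneg (|x| ^ k - 1), sq_nonneg (|x| ^ k)]
  have h3 : (x ^ 2) ^ k ≤ 2 ^ k * k.factorial * Real.exp (x ^ 2 / 2) := by
    rw [div_pow, div_div, div_le_iff₀ (by positivity)] at h1
    linarith
  have h4 : 1 ≤ Real.exp (x ^ 2 / 2) := Real.one_le_exp (by positivity)
  rw [Real.exp_neg, ← div_eq_mul_inv, div_le_iff₀ (Real.exp_pos _)]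
  nlinarith

lemma exists_polynomial_mul_exp_le (p : Polynomial ℝ) (k : ℕ) :
    ∃ C, ∀ x : ℝ, |x| ^ k * (|p.eval x| * Real.exp (-(x ^ 2 / 2))) ≤ C := by
  induction p using Polynomial.induction_on' with
  | add p q hp hq =>
    obtain ⟨C, hC⟩ := hp
    obtain ⟨D, hD⟩ := hq
    refine ⟨C + D, fun x => ?_⟩
    refine le_trans ?_ (add_le_add (hC x) (hD x))
    rw [Polynomial.eval_add, ← mul_add, ← add_mul]
    gcongr
    exact abs_add_le _ _
  | monomial n a =>
    refine ⟨|a| * (1 + 2 ^ (k + n) * (k + n).factorial), fun x => ?_⟩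
    rw [Polynomial.eval_monomial, abs_mul, abs_pow]
    calc |x| ^ k * (|a| * |x| ^ n * Real.exp (-(x ^ 2 / 2)))
        = |a| * (|x| ^ (k + n) * Real.exp (-(x ^ 2 / 2))) := by rw [pow_add]; ring
      _ ≤ _ := mul_le_mul_of_nonneg_left (pow_mul_exp_le _ x) (abs_nonneg a)

/-- The real Gaussian `exp (-x² / 2)` as a Schwartz function. -/
noncomputable def stdGaussian : 𝓢(ℝ, ℝ) where
  toFun x := Real.exp (-(x ^ 2 / 2))
  smooth' := by fun_prop
  decay' k n := by
    obtain ⟨C, hC⟩ := exists_polynomial_mul_exp_le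
      ((Polynomial.hermite n).map (algebraMap ℤ ℝ)) k
    refine ⟨C, fun x => ?_⟩
    rw [norm_iteratedFDeriv_eq_norm_iteratedDeriv, iteratedDeriv_eq_iterate,
      Polynomial.deriv_gaussian_eq_hermite_mul_gaussian, norm_mul, norm_mul, norm_pow, norm_neg,
      norm_one, one_pow, one_mul, Real.norm_eq_abs, Real.norm_eq_abs, Real.norm_eq_abs,
      abs_of_pos (Real.exp_pos _), ← Polynomial.eval_map_algebraMap]
    exact hC x

/-- The Gaussian `exp (-c (x - a)² / 2)` as a Schwartz function. -/
noncomputable def gaussian {c : ℝ} (hc : 0 < c) (a : ℝ) : 𝓢(ℝ, ℂ) :=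
  SchwartzMap.compSubConstCLM ℂ a (SchwartzMap.compCLMOfContinuousLinearEquiv ℂ
    (ContinuousLinearEquiv.unitsEquivAut ℝ (Units.mk0 √c (Real.sqrt_pos.2 hc).ne'))
    (SchwartzMap.postcompCLM Complex.ofRealCLM stdGaussian))

lemma gaussian_apply {c : ℝ} (hc : 0 < c) (a x : ℝ) :
    gaussian hc a x = (Real.exp (-(c * (x - a) ^ 2 / 2)) : ℝ) := by
  have : gaussian hc a x = (Real.exp (-(((x - a) * √c) ^ 2 / 2)) : ℝ) := rfl
  rw [this, mul_pow, Real.sq_sqrt hc.le, mul_comm c]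

lemma derivS_gaussian {c : ℝ} (hc : 0 < c) (a : ℝ) :
    derivS (gaussian hc a) = -((c : ℂ) • (mulX (gaussian hc a) - (a : ℂ) • gaussian hc a)) := by
  ext x
  have h1 : (gaussian hc a : ℝ → ℂ) = fun y : ℝ => ((Real.exp (-(c * (y - a) ^ 2 / 2)) : ℝ) : ℂ) :=
    funext (gaussian_apply hc a)
  have h2 : HasDerivAt (fun y : ℝ => Real.exp (-(c * (y - a) ^ 2 / 2)))
      (Real.exp (-(c * (x - a) ^ 2 / 2)) * (-(c * (x - a)))) x := by
    refine HasDerivAt.exp ?_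
    have h := (((((hasDerivAt_id x).sub_const a).fun_pow 2).const_mul c).div_const 2).fun_neg
    refine h.congr_deriv ?_
    simp only [id_eq]
    ring
  rw [SchwartzMap.derivCLM_apply, h1, h2.ofReal_comp.deriv]
  simp only [neg_apply, smul_apply, sub_apply, mulX_apply,
    gaussian_apply, smul_eq_mul]
  push_cast
  ring

end Gaussian

/-! ### Functions with vanishing Fourier transform -/

section Fourier

open scoped FourierTransform

/-- An integrable function with vanishing Fourier transform vanishes. -/
lemma ae_eq_zero_of_fourier_eq_zero {u : ℝ → ℂ} (hu : Integrable u)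
    (h : ∀ t : ℝ, ∫ x, Complex.exp (-(2 * Real.pi * t * x : ℝ) * Complex.I) * u x = 0) :
    u =ᵐ[volume] 0 := by
  -- The Fourier transform can be moved to a Schwartz function, so `u` annihilates all of these.
  have hF : 𝓕 u = 0 := by
    ext t
    rw [Real.fourier_real_eq_integral_exp_smul, Pi.zero_apply, ← h t]
    congr 1
    ext x
    rw [smul_eq_mul]
    congr 2
    push_cast
    ring
  have hS (φ : 𝓢(ℝ, ℂ)) : ∫ x, φ x * u x = 0 := by
    have h1 := VectorFourier.integral_fourierIntegral_smul_eq_flip (μ := volume) (ν := volume)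
      (L := innerₗ ℝ) (f := (𝓕⁻ φ : 𝓢(ℝ, ℂ))) (g := u) Real.continuous_fourierChar continuous_inner
      (SchwartzMap.integrable _) hu
    have h2 : ∀ ξ, VectorFourier.fourierIntegral 𝐞 volume (innerₗ ℝ) ((𝓕⁻ φ : 𝓢(ℝ, ℂ)) : ℝ → ℂ) ξ
        = φ ξ := fun ξ => by
      have := congrArg (fun f : 𝓢(ℝ, ℂ) => f ξ) (FourierTransform.fourier_fourierInv_eq φ :
        (𝓕 (𝓕⁻ φ : 𝓢(ℝ, ℂ)) : 𝓢(ℝ, ℂ)) = φ)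
      rw [← this]
      rfl
    have h3 : ∀ ξ, VectorFourier.fourierIntegral 𝐞 volume (innerₗ ℝ : ℝ →ₗ[ℝ] ℝ →ₗ[ℝ] ℝ).flip u ξ
        = 0 := fun ξ => by
      rw [flip_innerₗ]
      exact congrFun hF ξ
    simp only [h2, h3, smul_eq_mul, mul_zero, integral_zero] at h1
    exact h1
  refine ae_eq_zero_of_integral_contDiff_smul_eq_zero hu.locallyIntegrable fun g hg hgc => ?_
  have h4 : ContDiff ℝ ((⊤ : ℕ∞) : WithTop ℕ∞) fun x => (g x : ℂ) := Complex.ofRealCLM.contDiff.comp hg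
  have h5 : HasCompactSupport fun x => (g x : ℂ) := hgc.comp_left (g := Complex.ofReal) rfl
  simpa using hS (h5.toSchwartzMap h4)

end Fourier

/-! ### Creation and annihilation operators -/

section Ladder

/-- The operator `c (x - a) - d/dx` on Schwartz functions. Up to normalization it is the creation
operator of the oscillator centred at `a` whose ground state is `exp (-c (x - a)² / 2)`. -/
noncomputable def raising (c a : ℝ) : 𝓢(ℝ, ℂ) →L[ℂ] 𝓢(ℝ, ℂ) :=
  (c : ℂ) • (mulX - (a : ℂ) • ContinuousLinearMap.id ℂ _) - derivS

/-- The operator `c (x - a) + d/dx` on Schwartz functions, the formal adjoint of `raising c a`. -/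
noncomputable def lowering (c a : ℝ) : 𝓢(ℝ, ℂ) →L[ℂ] 𝓢(ℝ, ℂ) :=
  (c : ℂ) • (mulX - (a : ℂ) • ContinuousLinearMap.id ℂ _) + derivS

variable (c a : ℝ)

lemma raising_apply (f : 𝓢(ℝ, ℂ)) :
    raising c a f = (c : ℂ) • (mulX f - (a : ℂ) • f) - derivS f := rfl

lemma lowering_apply (f : 𝓢(ℝ, ℂ)) :
    lowering c a f = (c : ℂ) • (mulX f - (a : ℂ) • f) + derivS f := rfl

lemma lowering_raising (f : 𝓢(ℝ, ℂ)) :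
    lowering c a (raising c a f) = raising c a (lowering c a f) + (2 * c : ℂ) • f := by
  simp only [raising_apply, lowering_apply, map_sub, map_add, map_smul, derivS_mulX]
  module

lemma inner_raising (f g : 𝓢(ℝ, ℂ)) :
    inner ℂ (schwartz (raising c a f)) (schwartz g) =
      inner ℂ (schwartz f) (schwartz (lowering c a g)) := by
  simp only [raising_apply, lowering_apply, schwartz_sub, schwartz_add, schwartz_smul,
    inner_sub_left, inner_smul_left, inner_add_right, inner_sub_right, inner_smul_right,
    inner_mulX, inner_derivS, Complex.conj_ofReal]
  ring

end Ladder

/-! ### Hermite functions -/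

section Hermite

variable {c : ℝ} (hc : 0 < c) (a : ℝ)

/-- The Hermite functions centred at `a`, without normalization: the functions obtained from
the Gaussian `exp (-c (x - a)² / 2)` by repeated application of `raising c a`. -/
noncomputable def hermiteFun : ℕ → 𝓢(ℝ, ℂ)
  | 0 => gaussian hc a
  | n + 1 => raising c a (hermiteFun n)

lemma hermiteFun_succ (n : ℕ) : hermiteFun hc a (n + 1) = raising c a (hermiteFun hc a n) := rfl

lemma lowering_hermiteFun_zero : lowering c a (hermiteFun hc a 0) = 0 := by
  rw [hermiteFun, lowering_apply, derivS_gaussian, add_neg_cancel]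

lemma lowering_hermiteFun_succ (n : ℕ) :
    lowering c a (hermiteFun hc a (n + 1)) = (2 * c * (n + 1) : ℂ) • hermiteFun hc a n := by
  induction n with
  | zero =>
    rw [hermiteFun_succ, lowering_raising, lowering_hermiteFun_zero, map_zero, zero_add]
    simp
  | succ n ih =>
    rw [hermiteFun_succ, lowering_raising, ih, map_smul, ← hermiteFun_succ]
    push_cast
    module

lemma inner_hermiteFun_succ (m n : ℕ) :
    inner ℂ (schwartz (hermiteFun hc a (m + 1))) (schwartz (hermiteFun hc a (n + 1))) =
      (2 * c * (n + 1) : ℂ) *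
        inner ℂ (schwartz (hermiteFun hc a m)) (schwartz (hermiteFun hc a n)) := by
  rw [hermiteFun_succ, inner_raising, lowering_hermiteFun_succ, schwartz_smul, inner_smul_right]

lemma inner_hermiteFun_succ_zero (m : ℕ) :
    inner ℂ (schwartz (hermiteFun hc a (m + 1))) (schwartz (hermiteFun hc a 0)) = 0 := by
  rw [hermiteFun_succ, inner_raising, lowering_hermiteFun_zero,
    show schwartz 0 = 0 from rfl, inner_zero_right]

lemma inner_hermiteFun_of_ne {m n : ℕ} (h : m ≠ n) :
    inner ℂ (schwartz (hermiteFun hc a m)) (schwartz (hermiteFun hc a n)) = 0 := by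
  induction m generalizing n with
  | zero =>
    obtain ⟨k, rfl⟩ := Nat.exists_eq_succ_of_ne_zero h.symm
    rw [← inner_conj_symm, inner_hermiteFun_succ_zero, map_zero]
  | succ m ih =>
    cases n with
    | zero => exact inner_hermiteFun_succ_zero hc a m
    | succ n => rw [inner_hermiteFun_succ, ih (by omega), mul_zero]

/-- The `L²` norm of the `n`-th Hermite function. -/
noncomputable def hermiteNorm (n : ℕ) : ℝ := ‖schwartz (hermiteFun hc a n)‖

lemma hermiteNorm_succ (n : ℕ) :
    hermiteNorm hc a (n + 1) = √(2 * c * (n + 1)) * hermiteNorm hc a n := by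
  have h := inner_hermiteFun_succ hc a n n
  rw [inner_self_eq_ofReal, inner_self_eq_ofReal] at h
  norm_cast at h
  rw [hermiteNorm, hermiteNorm, ← sq_eq_sq₀ (norm_nonneg _)
    (mul_nonneg (Real.sqrt_nonneg _) (norm_nonneg _)), mul_pow, Real.sq_sqrt (by positivity)]
  exact_mod_cast h

lemma hermiteNorm_pos (n : ℕ) : 0 < hermiteNorm hc a n := by
  induction n with
  | zero =>
    refine norm_pos_iff.2 fun h => ?_
    have h1 : hermiteFun hc a 0 = 0 := schwartz_injective h
    have h2 := congrArg (fun f : 𝓢(ℝ, ℂ) => f a) h1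
    simp [hermiteFun, gaussian_apply] at h2
  | succ n ih =>
    rw [hermiteNorm_succ]
    positivity

/-- The normalized Hermite functions as Schwartz functions. -/
noncomputable def hermiteUnit (n : ℕ) : 𝓢(ℝ, ℂ) :=
  (((hermiteNorm hc a n)⁻¹ : ℝ) : ℂ) • hermiteFun hc a n

lemma raising_hermiteUnit (n : ℕ) :
    raising c a (hermiteUnit hc a n) =
      (√(2 * c * (n + 1)) : ℂ) • hermiteUnit hc a (n + 1) := by
  have h0 := hermiteNorm_pos hc a n
  have h1 : 0 < √(2 * c * (n + 1)) := Real.sqrt_pos.2 (by positivity)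
  simp only [hermiteUnit, map_smul, ← hermiteFun_succ, smul_smul, hermiteNorm_succ,
    ← Complex.ofReal_mul]
  congr 2
  field_simp

lemma lowering_hermiteUnit_zero : lowering c a (hermiteUnit hc a 0) = 0 := by
  rw [hermiteUnit, map_smul, lowering_hermiteFun_zero, smul_zero]

lemma lowering_hermiteUnit_succ (n : ℕ) :
    lowering c a (hermiteUnit hc a (n + 1)) =
      (√(2 * c * (n + 1)) : ℂ) • hermiteUnit hc a n := by
  have h0 := hermiteNorm_pos hc a n
  have h2 : 0 ≤ 2 * c * (n + 1) := by positivity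
  have h1 : 0 < √(2 * c * (n + 1)) := Real.sqrt_pos.2 (by positivity)
  simp only [hermiteUnit, map_smul, lowering_hermiteFun_succ, smul_smul, hermiteNorm_succ]
  congr 1
  norm_cast
  push_cast
  field_simp
  rw [Real.sq_sqrt h2]

lemma orthonormal_hermiteUnit : Orthonormal ℂ fun n => schwartz (hermiteUnit hc a n) := by
  refine ⟨fun n => ?_, fun m n h => ?_⟩
  · change ‖schwartz (hermiteUnit hc a n)‖ = 1
    rw [hermiteUnit, schwartz_smul, norm_smul, Complex.norm_real, norm_inv, Real.norm_eq_abs,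
      abs_of_pos (hermiteNorm_pos hc a n)]
    exact inv_mul_cancel₀ (hermiteNorm_pos hc a n).ne'
  · simp only [hermiteUnit, schwartz_smul, inner_smul_left, inner_smul_right,
      inner_hermiteFun_of_ne hc a h, mul_zero]

end Hermite

/-! ### Completeness of the Hermite functions -/

section Completeness

variable {c : ℝ} (hc : 0 < c) (a : ℝ)

include hc in
lemma mulX_eq (f : 𝓢(ℝ, ℂ)) :
    mulX f = (a : ℂ) • f + (1 / (2 * c) : ℂ) • (raising c a f + lowering c a f) := by
  have : (c : ℂ) ≠ 0 := by exact_mod_cast hc.ne'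
  rw [raising_apply, lowering_apply, sub_add_add_cancel, ← two_smul ℂ, smul_smul, smul_smul,
    show (1 / (2 * c) * 2 * c : ℂ) = 1 by field_simp, one_smul]
  abel

lemma derivS_eq (f : 𝓢(ℝ, ℂ)) :
    derivS f = (1 / 2 : ℂ) • (lowering c a f - raising c a f) := by
  rw [raising_apply, lowering_apply]
  module

lemma pow_mulX_apply (k : ℕ) (f : 𝓢(ℝ, ℂ)) (x : ℝ) : (mulX ^ k) f x = (x : ℂ) ^ k * f x := by
  induction k generalizing f with
  | zero => simp
  | succ k ih =>
    rw [pow_succ, mul_apply_eq_comp, ih, mulX_apply, pow_succ, mul_assoc]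

/-- A vector orthogonal to the Hermite functions is orthogonal to their products with powers
of the coordinate, since `mulX` maps the span of the Hermite functions into itself. -/
lemma inner_pow_mulX_hermiteFun {f : L2R}
    (hf : ∀ n, inner ℂ (schwartz (hermiteFun hc a n)) f = 0) (k n : ℕ) :
    inner ℂ (schwartz ((mulX ^ k) (hermiteFun hc a n))) f = 0 := by
  induction k generalizing n with
  | zero => exact hf n
  | succ k ih =>
    have h1 : inner ℂ (schwartz ((mulX ^ k) (lowering c a (hermiteFun hc a n)))) f = 0 := by
      cases n with
      | zero => rw [lowering_hermiteFun_zero, map_zero, show schwartz 0 = 0 from rfl,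
          inner_zero_left]
      | succ n => rw [lowering_hermiteFun_succ, map_smul, schwartz_smul, inner_smul_left, ih,
          mul_zero]
    have h2 : inner ℂ (schwartz ((mulX ^ k) (raising c a (hermiteFun hc a n)))) f = 0 := ih (n + 1)
    rw [pow_succ, mul_apply_eq_comp, mulX_eq hc a]
    simp only [map_add, map_smul, schwartz_add, schwartz_smul, inner_add_left, inner_smul_left,
      h1, h2, ih, mul_zero, add_zero]

lemma integrable_schwartz_mul (g : 𝓢(ℝ, ℂ)) (f : L2R) : Integrable fun x => g x * f x :=
  MemLp.integrable_mul (g.memLp 2 volume) (Lp.memLp f)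

include hc in
/-- The product of a Gaussian with an exponential is a multiple of a translated Gaussian. -/
lemma exp_mul_gaussian (s x : ℝ) :
    Real.exp (s * x) * Real.exp (-(c * (x - a) ^ 2 / 2)) =
      Real.exp (s * a + s ^ 2 / (2 * c)) * Real.exp (-(c * (x - (a + s / c)) ^ 2 / 2)) := by
  rw [← Real.exp_add, ← Real.exp_add]
  congr 1
  have := hc.ne'
  field_simp
  ring

lemma integrable_exp_mul_gaussian (f : L2R) (s : ℝ) :
    Integrable fun x : ℝ => Real.exp (s * x) * ‖gaussian hc a x * f x‖ := by
  have h := ((integrable_schwartz_mul (gaussian hc (a + s / c)) f).norm).const_mul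
    (Real.exp (s * a + s ^ 2 / (2 * c)))
  refine h.congr (Filter.Eventually.of_forall fun x => ?_)
  simp only [norm_mul, gaussian_apply, Complex.norm_real, Real.norm_eq_abs,
    abs_of_pos (Real.exp_pos _), ← mul_assoc]
  rw [exp_mul_gaussian hc]

lemma integrable_exp_abs_mul_gaussian (f : L2R) (s : ℝ) :
    Integrable fun x : ℝ => Real.exp |s * x| * ‖gaussian hc a x * f x‖ := by
  refine ((integrable_exp_mul_gaussian hc a f s).add
    (integrable_exp_mul_gaussian hc a f (-s))).mono' ?_ (Filter.Eventually.of_forall fun x => ?_)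
  · exact (by fun_prop : Continuous fun x : ℝ => Real.exp |s * x|).aestronglyMeasurable.mul
      (integrable_schwartz_mul (gaussian hc a) f).aestronglyMeasurable.norm
  · rw [Real.norm_of_nonneg (by positivity), Pi.add_apply, ← add_mul, neg_mul]
    gcongr
    rcases abs_cases (s * x) with ⟨h, _⟩ | ⟨h, _⟩ <;> rw [h]
    · linarith [Real.exp_pos (-(s * x))]
    · linarith [Real.exp_pos (s * x)]

/-- The Hermite functions are complete: if `f` is orthogonal to all of them, then all moments of
the function `gaussian * f` vanish. As this function decays faster than every exponential, its
Fourier transform is the sum of the power series given by its moments, so it vanishes. -/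
lemma eq_zero_of_inner_hermiteFun {f : L2R}
    (hf : ∀ n, inner ℂ (schwartz (hermiteFun hc a n)) f = 0) : f = 0 := by
  have hu := integrable_schwartz_mul (gaussian hc a) f
  have hmom (k : ℕ) : ∫ x : ℝ, (x : ℂ) ^ k * (gaussian hc a x * f x) = 0 := by
    rw [← inner_pow_mulX_hermiteFun hc a hf k 0, inner_schwartz_left]
    congr 1
    ext x
    rw [pow_mulX_apply, hermiteFun, gaussian_apply]
    simp only [RCLike.inner_apply, map_mul, map_pow, Complex.conj_ofReal]
    ring
  have hu0 : (fun x => gaussian hc a x * f x) =ᵐ[volume] 0 := by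
    refine ae_eq_zero_of_fourier_eq_zero hu fun t => ?_
    set s : ℝ := 2 * Real.pi * t
    have h := hasSum_integral_of_dominated_convergence (μ := volume)
      (F := fun (n : ℕ) (x : ℝ) => ((-(s * x : ℝ) * Complex.I) ^ n / (n.factorial : ℂ)) *
        (gaussian hc a x * f x))
      (f := fun x : ℝ => Complex.exp (-(s * x : ℝ) * Complex.I) * (gaussian hc a x * f x))
      (fun n x => |s * x| ^ n / n.factorial * ‖gaussian hc a x * f x‖)
      (fun n => (Continuous.aestronglyMeasurable (by fun_prop)).mul hu.aestronglyMeasurable)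
      (fun n => Filter.Eventually.of_forall fun x => by
        rw [norm_mul, norm_div, norm_pow, norm_mul, norm_neg, Complex.norm_I, mul_one,
          Complex.norm_real, Real.norm_eq_abs, Complex.norm_natCast])
      (Filter.Eventually.of_forall fun x => (Real.summable_pow_div_factorial _).mul_right _)
      (by
        refine (integrable_exp_abs_mul_gaussian hc a f s).congr
          (Filter.Eventually.of_forall fun x => ?_)
        simp only [tsum_mul_right, Real.exp_eq_exp_ℝ, NormedSpace.exp_eq_tsum_div])
      (Filter.Eventually.of_forall fun x => by
        refine HasSum.mul_right _ ?_
        rw [Complex.exp_eq_exp_ℂ]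
        exact NormedSpace.expSeries_div_hasSum_exp _)
    have h0 : ∀ n : ℕ, ∫ x : ℝ, ((-(s * x : ℝ) * Complex.I) ^ n / (n.factorial : ℂ)) *
        (gaussian hc a x * f x) = 0 := fun n => by
      have h1 : ∀ x : ℝ, ((-(s * x : ℝ) * Complex.I) ^ n / (n.factorial : ℂ)) *
          (gaussian hc a x * f x) = ((-s * Complex.I) ^ n / (n.factorial : ℂ)) *
            ((x : ℂ) ^ n * (gaussian hc a x * f x)) := fun x => by
        push_cast
        rw [show (-((s : ℂ) * x) * Complex.I) = -s * Complex.I * x by ring, mul_pow]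
        ring
      simp only [h1]
      rw [integral_const_mul, hmom, mul_zero]
    simp only [h0] at h
    exact h.unique hasSum_zero
  refine Lp.eq_zero_iff_ae_eq_zero.2 ?_
  filter_upwards [hu0] with x hx
  refine (mul_eq_zero.1 hx).resolve_left ?_
  rw [gaussian_apply]
  exact_mod_cast (Real.exp_pos _).ne'

/-- The Hilbert basis of `L²(ℝ)` that consists of the normalized Hermite functions. -/
noncomputable def hermiteBasis : HilbertBasis ℕ ℂ L2R :=
  HilbertBasis.mkOfOrthogonalEqBot (orthonormal_hermiteUnit hc a) <| by
    refine (Submodule.eq_bot_iff _).2 fun f hf => eq_zero_of_inner_hermiteFun hc a fun n => ?_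
    have h := (Submodule.mem_orthogonal _ _).1 hf _ (Submodule.subset_span ⟨n, rfl⟩)
    simp only [hermiteUnit, schwartz_smul, inner_smul_left, mul_eq_zero] at h
    refine h.resolve_left ?_
    simp [(hermiteNorm_pos hc a n).ne']

lemma hermiteBasis_apply (n : ℕ) : hermiteBasis hc a n = schwartz (hermiteUnit hc a n) := by
  rw [hermiteBasis, HilbertBasis.coe_mkOfOrthogonalEqBot]

end Completeness

/-! ### Operators that are linear in creation and annihilation operators -/

section Tridiagonal

variable {H : Type*} [NormedAddCommGroup H] [InnerProductSpace ℂ H]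

/-- The value at `e n` of an operator that is linear in creation and annihilation operators for the
basis `e`. For `n = 0` the last term vanishes. -/
noncomputable def ladderVector (e : ℕ → H) (p q r : ℂ) (n : ℕ) : H :=
  (p * √(n + 1)) • e (n + 1) + q • e n + (r * √n) • e (n - 1)

/-- `R` is a closed operator that acts on the basis `e` as a linear combination of creation
operator, identity and annihilation operator, and whose domain lies in that of the adjoint of its
restriction to the span of the basis. -/
structure IsLadder (R : H →ₗ.[ℂ] H) (e : HilbertBasis ℕ ℂ H) (p q r : ℂ) : Prop where
  isClosed : R.IsClosed
  mem_graph : ∀ n, (e n, ladderVector e p q r n) ∈ R.graph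
  inner_apply : ∀ (n : ℕ) (ψ : R.domain),
    inner ℂ (e n) (R ψ) = inner ℂ (ladderVector e p q r n) (ψ : H)

lemma summable_smul_basis [CompleteSpace H] (e : HilbertBasis ℕ ℂ H) {v : ℕ → ℂ}
    (hv : Summable fun n => ‖v n‖ ^ 2) : Summable fun n => v n • e n := by
  have h : Memℓp v 2 := memℓp_gen (by simpa using hv)
  exact (e.hasSum_repr_symm ⟨v, h⟩).summable

namespace IsLadder

variable {R : H →ₗ.[ℂ] H} {e : HilbertBasis ℕ ℂ H} {p q r : ℂ} (hR : IsLadder R e p q r)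
include hR

/-- Vectors with square summable coefficients for the weight `√(n + 1)` lie in the domain: the
expansion of `R ψ` splits into three series along the orthonormal basis, each of which converges, and
`R` is closed. -/
lemma mem_domain [CompleteSpace H] {ψ : H}
    (h : Summable fun n : ℕ => (n + 1 : ℝ) * ‖inner ℂ (e n) ψ‖ ^ 2) : ψ ∈ R.domain := by
  have hsqrt (n : ℕ) : ‖(√(n + 1) : ℂ)‖ ^ 2 = n + 1 := by
    rw [Complex.norm_real, Real.norm_eq_abs, sq_abs, Real.sq_sqrt (by positivity)]
  have h1 : Summable fun n : ℕ => (inner ℂ (e n) ψ * (p * √(n + 1))) • e (n + 1) := by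
    let v : ℕ → ℂ := fun n => inner ℂ (e (n - 1)) ψ * (p * √(n - 1 + 1 : ℝ))
    have hv : Summable fun n => ‖v n‖ ^ 2 := by
      rw [← summable_nat_add_iff 1]
      refine (h.mul_left (‖p‖ ^ 2)).congr fun n => ?_
      simp only [v, Nat.add_sub_cancel, Nat.cast_add, Nat.cast_one, add_sub_cancel_right]
      rw [norm_mul, norm_mul, mul_pow, mul_pow, hsqrt]
      ring
    refine ((summable_nat_add_iff 1).2 (summable_smul_basis e hv)).congr fun n => ?_
    simp [v]
  have h2 : Summable fun n : ℕ => (inner ℂ (e n) ψ * q) • e n := by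
    refine summable_smul_basis e ?_
    refine ((hasSum_norm_sq_inner e ψ).summable.mul_right (‖q‖ ^ 2)).congr fun n => ?_
    rw [norm_mul, mul_pow]
  have h3 : Summable fun n : ℕ => (inner ℂ (e n) ψ * (r * √n)) • e (n - 1) := by
    rw [← summable_nat_add_iff 1]
    simp only [Nat.add_sub_cancel]
    refine summable_smul_basis e ?_
    refine (((summable_nat_add_iff 1).2 h).mul_left (‖r‖ ^ 2)).of_nonneg_of_le
      (fun n => by positivity) fun n => ?_
    rw [norm_mul, norm_mul, mul_pow, mul_pow, Nat.cast_add, Nat.cast_one, hsqrt]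
    have : 0 ≤ ‖r‖ ^ 2 * ‖inner ℂ (e (n + 1)) ψ‖ ^ 2 := by positivity
    nlinarith
  have hs : Summable fun n : ℕ => inner ℂ (e n) ψ • ladderVector e p q r n := by
    refine ((h1.add h2).add h3).congr fun n => ?_
    simp only [ladderVector, smul_add, smul_smul]
  have hψ : HasSum (fun n => inner ℂ (e n) ψ • e n) ψ := by
    simpa only [HilbertBasis.repr_apply_apply] using e.hasSum_repr ψ
  have hp := hψ.prodMk hs.hasSum
  refine LinearPMap.mem_domain_of_mem_graph (hR.isClosed.mem_of_tendsto hp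
    (Filter.Eventually.of_forall fun s => ?_))
  exact Submodule.sum_mem _ fun n _ => Submodule.smul_mem _ (inner ℂ (e n) ψ) (hR.mem_graph n)

/-- Each application of `R` costs one power of the weight of the squared coefficients. -/
lemma summable_apply [CompleteSpace H] (k : ℕ) (ψ : R.domain)
    (h : Summable fun n : ℕ => (n + 1 : ℝ) ^ (k + 1) * ‖inner ℂ (e n) (ψ : H)‖ ^ 2) :
    Summable fun n : ℕ => (n + 1 : ℝ) ^ k * ‖inner ℂ (e n) (R ψ)‖ ^ 2 := by
  set w : ℕ → ℝ := fun n => (n + 1 : ℝ) ^ (k + 1) * ‖inner ℂ (e n) (ψ : H)‖ ^ 2 with hw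
  have h1 : Summable fun n => w (n + 1) := (summable_nat_add_iff 1).2 h
  have h2 : Summable fun n => w (n - 1) := by
    rw [← summable_nat_add_iff 1]
    simpa using h
  refine ((((h1.mul_left (‖p‖ ^ 2)).add (h.mul_left (‖q‖ ^ 2))).add
    (h2.mul_left (‖r‖ ^ 2 * 2 ^ k))).mul_left 3).of_nonneg_of_le (fun n => by positivity)
    fun n => ?_
  have hin : inner ℂ (e n) (R ψ) = (starRingEnd ℂ) (p * √(n + 1)) * inner ℂ (e (n + 1)) (ψ : H) +
      (starRingEnd ℂ) q * inner ℂ (e n) (ψ : H) +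
      (starRingEnd ℂ) (r * √n) * inner ℂ (e (n - 1)) (ψ : H) := by
    rw [hR.inner_apply, ladderVector, inner_add_left, inner_add_left, inner_smul_left,
      inner_smul_left, inner_smul_left]
  have hsq (x y z : ℂ) : ‖x + y + z‖ ^ 2 ≤ 3 * (‖x‖ ^ 2 + ‖y‖ ^ 2 + ‖z‖ ^ 2) := by
    have := norm_add₃_le (a := x) (b := y) (c := z)
    nlinarith [sq_nonneg (‖x‖ - ‖y‖), sq_nonneg (‖y‖ - ‖z‖), sq_nonneg (‖x‖ - ‖z‖),
      norm_nonneg (x + y + z)]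
  have hA : (n + 1 : ℝ) ^ k * ‖(starRingEnd ℂ) (p * √(n + 1)) * inner ℂ (e (n + 1)) (ψ : H)‖ ^ 2 ≤
      ‖p‖ ^ 2 * w (n + 1) := by
    rw [norm_mul, RCLike.norm_conj, norm_mul, Complex.norm_real, Real.norm_eq_abs, mul_pow, mul_pow,
      sq_abs, Real.sq_sqrt (by positivity)]
    have hle : (n + 1 : ℝ) ^ (k + 1) ≤ (n + 1 + 1 : ℝ) ^ (k + 1) := by gcongr; linarith
    calc _ = ‖p‖ ^ 2 * ((n + 1 : ℝ) ^ (k + 1) * ‖inner ℂ (e (n + 1)) (ψ : H)‖ ^ 2) := by ring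
      _ ≤ ‖p‖ ^ 2 * ((n + 1 + 1 : ℝ) ^ (k + 1) * ‖inner ℂ (e (n + 1)) (ψ : H)‖ ^ 2) := by gcongr
      _ = _ := by simp [hw]
  have hB : (n + 1 : ℝ) ^ k * ‖(starRingEnd ℂ) q * inner ℂ (e n) (ψ : H)‖ ^ 2 ≤
      ‖q‖ ^ 2 * w n := by
    rw [norm_mul, RCLike.norm_conj, mul_pow]
    have hle : (n + 1 : ℝ) ^ k ≤ (n + 1 : ℝ) ^ (k + 1) :=
      pow_le_pow_right₀ (by linarith [n.cast_nonneg (α := ℝ)]) k.le_succ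
    calc _ = ‖q‖ ^ 2 * ((n + 1 : ℝ) ^ k * ‖inner ℂ (e n) (ψ : H)‖ ^ 2) := by ring
      _ ≤ ‖q‖ ^ 2 * ((n + 1 : ℝ) ^ (k + 1) * ‖inner ℂ (e n) (ψ : H)‖ ^ 2) := by gcongr
      _ = _ := by simp [hw]
  have hC : (n + 1 : ℝ) ^ k * ‖(starRingEnd ℂ) (r * √n) * inner ℂ (e (n - 1)) (ψ : H)‖ ^ 2 ≤
      ‖r‖ ^ 2 * 2 ^ k * w (n - 1) := by
    rw [norm_mul, RCLike.norm_conj, norm_mul, Complex.norm_real, Real.norm_eq_abs, mul_pow, mul_pow,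
      sq_abs, Real.sq_sqrt (by positivity)]
    cases n with
    | zero => simp only [Nat.cast_zero, mul_zero, zero_mul, hw]; positivity
    | succ n =>
      simp only [Nat.add_sub_cancel, hw]
      push_cast
      have hle : (n + 1 + 1 : ℝ) ^ k ≤ 2 ^ k * (n + 1 : ℝ) ^ k := by
        rw [← mul_pow]
        gcongr
        linarith [n.cast_nonneg (α := ℝ)]
      calc _ = ‖r‖ ^ 2 * ((n + 1) * ((n + 1 + 1 : ℝ) ^ k * ‖inner ℂ (e n) (ψ : H)‖ ^ 2)) := by
            ring
        _ ≤ ‖r‖ ^ 2 * ((n + 1) * ((2 ^ k * (n + 1 : ℝ) ^ k) * ‖inner ℂ (e n) (ψ : H)‖ ^ 2)) := by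
            gcongr
        _ = _ := by ring
  rw [hin]
  calc _ ≤ (n + 1 : ℝ) ^ k * (3 * _) := mul_le_mul_of_nonneg_left (hsq _ _ _) (by positivity)
    _ ≤ _ := by
      rw [mul_left_comm, mul_add (_ ^ k), mul_add (_ ^ k)]
      exact mul_le_mul_of_nonneg_left (add_le_add (add_le_add hA hB) hC)
        (by norm_num : (0 : ℝ) ≤ 3)

/-- Vectors with square summable coefficients for the weight `n + 1` lie in the domain of `R²`. -/
lemma mem_domain_pcomp [CompleteSpace H] {ψ : H}
    (h : Summable fun n : ℕ => (n + 1 : ℝ) ^ 2 * ‖inner ℂ (e n) ψ‖ ^ 2) :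
    ψ ∈ (pcomp R R).domain := by
  have h1 : Summable fun n : ℕ => (n + 1 : ℝ) * ‖inner ℂ (e n) ψ‖ ^ 2 := by
    refine h.of_nonneg_of_le (fun n => by positivity) fun n => ?_
    gcongr
    nlinarith [n.cast_nonneg (α := ℝ)]
  refine ⟨hR.mem_domain h1, hR.mem_domain ?_⟩
  simpa using hR.summable_apply 1 ⟨ψ, hR.mem_domain h1⟩ h

end IsLadder

end Tridiagonal

/-! ### Symmetry against Schwartz functions, the momentum operator -/

section SchwartzAdjoint

/-- The adjoint of `S`, considered as an operator with the Schwartz functions as domain,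
extends `R`. -/
def SchwartzAdjoint (R : L2R →ₗ.[ℂ] L2R) (S : 𝓢(ℝ, ℂ) →L[ℂ] 𝓢(ℝ, ℂ)) : Prop :=
  ∀ (g : 𝓢(ℝ, ℂ)) (ψ : R.domain), inner ℂ (schwartz g) (R ψ) = inner ℂ (schwartz (S g)) (ψ : L2R)

namespace SchwartzAdjoint

variable {R R' : L2R →ₗ.[ℂ] L2R} {S S' : 𝓢(ℝ, ℂ) →L[ℂ] 𝓢(ℝ, ℂ)}

lemma pcomp (h : SchwartzAdjoint R S) (h' : SchwartzAdjoint R' S') :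
    SchwartzAdjoint (pcomp R R') (S' ∘L S) := fun g ψ =>
  (h g ⟨_, ψ.2.2⟩).trans (h' (S g) ⟨_, ψ.2.1⟩)

lemma add (h : SchwartzAdjoint R S) (h' : SchwartzAdjoint R' S') :
    SchwartzAdjoint (R + R') (S + S') := fun g ψ => by
  have e : (R + R') ψ = R ⟨ψ, ψ.2.1⟩ + R' ⟨ψ, ψ.2.2⟩ := rfl
  rw [e, inner_add_right, h, h', ← inner_add_left]
  rfl

lemma sub (h : SchwartzAdjoint R S) (h' : SchwartzAdjoint R' S') :
    SchwartzAdjoint (R - R') (S - S') := fun g ψ => by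
  have e : (R - R') ψ = R ⟨ψ, ψ.2.1⟩ - R' ⟨ψ, ψ.2.2⟩ := rfl
  rw [e, inner_sub_right, h, h', ← inner_sub_left]
  rfl

lemma smul (h : SchwartzAdjoint R S) (c : ℝ) :
    SchwartzAdjoint ((c : ℂ) • R) ((c : ℂ) • S) := fun g ψ => by
  have e : ((c : ℂ) • R) ψ = (c : ℂ) • R ψ := rfl
  rw [e, inner_smul_right, h, smul_apply, schwartz_smul, inner_smul_left,
    Complex.conj_ofReal]

lemma total_id : SchwartzAdjoint (total LinearMap.id) (ContinuousLinearMap.id ℂ _) :=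
  fun _ _ => rfl

end SchwartzAdjoint

lemma schwartzAdjoint_position : SchwartzAdjoint position mulX := fun g ψ => by
  rw [inner_schwartz_left, inner_schwartz_left]
  refine integral_congr_ae ?_
  filter_upwards [coeFn_position ψ] with x hx
  rw [hx, mulX_apply]
  simp only [RCLike.inner_apply, map_mul, Complex.conj_ofReal]
  ring

lemma mem_graph_position_schwartz (g : 𝓢(ℝ, ℂ)) :
    (schwartz g, schwartz (mulX g)) ∈ position.graph := by
  refine mem_graph_position.2 ?_
  filter_upwards [coeFn_schwartz g, coeFn_schwartz (mulX g)] with x h1 h2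
  rw [h1, h2, mulX_apply]

/-- The momentum operator on Schwartz functions. -/
noncomputable def momentumS (ħ : ℝ) : 𝓢(ℝ, ℂ) →L[ℂ] 𝓢(ℝ, ℂ) := (-Complex.I * ħ) • derivS

/-- The graph of the momentum operator. That the defining relation is single valued holds because
the Schwartz functions are dense. -/
lemma mem_graph_momentum {ħ : ℝ} {p : L2R × L2R} :
    p ∈ (momentum ħ).graph ↔
      ∀ g, inner ℂ (schwartz g) p.2 = inner ℂ (schwartz (momentumS ħ g)) p.1 := by
  rw [momentum, Submodule.toLinearPMap_graph_eq]
  · rfl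
  · intro x hx hx0
    refine dense_schwartz.eq_zero_of_inner_right ℂ ?_
    rintro _ ⟨g, rfl⟩
    rw [hx g, hx0, inner_zero_right]

lemma schwartzAdjoint_momentum (ħ : ℝ) : SchwartzAdjoint (momentum ħ) (momentumS ħ) := fun g ψ =>
  mem_graph_momentum.1 ((momentum ħ).mem_graph ψ) g

lemma isClosed_momentum (ħ : ℝ) : (momentum ħ).IsClosed := by
  have h : ((momentum ħ).graph : Set (L2R × L2R)) = ⋂ g : 𝓢(ℝ, ℂ), {p |
      inner ℂ (schwartz g) p.2 = inner ℂ (schwartz (momentumS ħ g)) p.1} := by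
    ext p
    simp only [Set.mem_iInter, SetLike.mem_coe, mem_graph_momentum, Set.mem_ofPred_eq]
  rw [LinearPMap.IsClosed, h]
  exact isClosed_iInter fun g => isClosed_eq (by fun_prop) (by fun_prop)

lemma mem_graph_momentum_schwartz (ħ : ℝ) (f : 𝓢(ℝ, ℂ)) :
    (schwartz f, schwartz (momentumS ħ f)) ∈ (momentum ħ).graph := by
  refine mem_graph_momentum.2 fun g => ?_
  simp only [momentumS, smul_apply, schwartz_smul, inner_smul_left,
    inner_smul_right, inner_derivS, map_mul, map_neg, Complex.conj_I, Complex.conj_ofReal]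
  ring

end SchwartzAdjoint

/-! ### Domains and diagonalization in a Hermite basis -/

section HermiteMatrix

variable {c : ℝ} (hc : 0 < c) (a : ℝ)

lemma lowering_hermiteUnit (n : ℕ) :
    lowering c a (hermiteUnit hc a n) = (√(2 * c * n) : ℂ) • hermiteUnit hc a (n - 1) := by
  cases n with
  | zero => simp [lowering_hermiteUnit_zero]
  | succ n => rw [lowering_hermiteUnit_succ]; simp

lemma isLadder_of_schwartz {R : L2R →ₗ.[ℂ] L2R} {S : 𝓢(ℝ, ℂ) →L[ℂ] 𝓢(ℝ, ℂ)}
    (hcl : R.IsClosed) (hR : SchwartzAdjoint R S)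
    (hgraph : ∀ g, (schwartz g, schwartz (S g)) ∈ R.graph) {p q r : ℂ}
    (hS : ∀ g, S g = p • raising c a g + q • g + r • lowering c a g) :
    IsLadder R (hermiteBasis hc a) (p * √(2 * c)) q (r * √(2 * c)) := by
  have h (n : ℕ) : ladderVector (hermiteBasis hc a) (p * √(2 * c)) q (r * √(2 * c)) n =
      schwartz (S (hermiteUnit hc a n)) := by
    have h2 : 0 ≤ 2 * c := by positivity
    rw [hS, raising_hermiteUnit, lowering_hermiteUnit, Real.sqrt_mul h2, Real.sqrt_mul h2,
      smul_smul, smul_smul]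
    simp only [ladderVector, hermiteBasis_apply, schwartz_add, schwartz_smul, Complex.ofReal_mul,
      mul_assoc]
  refine ⟨hcl, fun n => ?_, fun n ψ => ?_⟩
  · rw [h, hermiteBasis_apply]
    exact hgraph _
  · rw [h, hermiteBasis_apply]
    exact hR _ ψ

lemma mem_domain_pcomp_position {ψ : L2R}
    (h : Summable fun n : ℕ => (n + 1 : ℝ) ^ 2 * ‖inner ℂ (hermiteBasis hc a n) ψ‖ ^ 2) :
    ψ ∈ (pcomp position position).domain := by
  refine (isLadder_of_schwartz hc a isClosed_position schwartzAdjoint_position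
    mem_graph_position_schwartz (p := 1 / (2 * c)) (q := a) (r := 1 / (2 * c))
    fun g => ?_).mem_domain_pcomp h
  rw [mulX_eq hc a]
  module

lemma mem_domain_pcomp_momentum (ħ : ℝ) {ψ : L2R}
    (h : Summable fun n : ℕ => (n + 1 : ℝ) ^ 2 * ‖inner ℂ (hermiteBasis hc a n) ψ‖ ^ 2) :
    ψ ∈ (pcomp (momentum ħ) (momentum ħ)).domain := by
  refine (isLadder_of_schwartz hc a (isClosed_momentum ħ) (schwartzAdjoint_momentum ħ)
    (mem_graph_momentum_schwartz ħ) (p := Complex.I * ħ / 2) (q := 0) (r := -(Complex.I * ħ / 2))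
    fun g => ?_).mem_domain_pcomp h
  rw [momentumS, smul_apply, derivS_eq a (c := c)]
  module

lemma mem_domain_oscillator (ħ m ω : ℝ) {ψ : L2R}
    (h : Summable fun n : ℕ => (n + 1 : ℝ) ^ 2 * ‖inner ℂ (hermiteBasis hc a n) ψ‖ ^ 2) :
    ψ ∈ (oscillator ħ m ω).domain :=
  ⟨mem_domain_pcomp_momentum hc a ħ h, mem_domain_pcomp_position hc a h⟩

lemma mem_domain_perturbedPosition (ħ m ω α : ℝ) {ψ : L2R}
    (h : Summable fun n : ℕ => (n + 1 : ℝ) ^ 2 * ‖inner ℂ (hermiteBasis hc a n) ψ‖ ^ 2) :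
    ψ ∈ (perturbedPosition ħ m ω α).domain :=
  ⟨(mem_domain_pcomp_position hc a h).1, mem_domain_oscillator hc a ħ m ω h, Submodule.mem_top⟩

/-- An operator whose action on the Hermite functions is diagonal, with eigenvalues that grow
linearly, and which is symmetric on a large enough domain, is the maximal diagonal operator. -/
lemma isDiagonal_of_schwartz {A : L2R →ₗ.[ℂ] L2R} {S : 𝓢(ℝ, ℂ) →L[ℂ] 𝓢(ℝ, ℂ)} {s v : ℝ}
    (hs : 0 < s) (hA : SchwartzAdjoint A S)
    (hS : ∀ n : ℕ, S (hermiteUnit hc a n) = ((s * n + v : ℝ) : ℂ) • hermiteUnit hc a n)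
    (hdom : ∀ ψ, (Summable fun n : ℕ => (n + 1 : ℝ) ^ 2 * ‖inner ℂ (hermiteBasis hc a n) ψ‖ ^ 2) →
      ψ ∈ A.domain) :
    IsDiagonal A (hermiteBasis hc a) fun n => s * n + v := by
  have hin (ψ : A.domain) (n : ℕ) : inner ℂ (hermiteBasis hc a n) (A ψ) =
      ((s * n + v : ℝ) : ℂ) * inner ℂ (hermiteBasis hc a n) (ψ : L2R) := by
    rw [hermiteBasis_apply, hA, hS, schwartz_smul, inner_smul_left, Complex.conj_ofReal]
  refine ⟨fun ψ => ⟨fun hψ => ?_, fun hψ => hdom ψ ?_⟩, hin⟩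
  · refine (hasSum_norm_sq_inner (hermiteBasis hc a) (A ⟨ψ, hψ⟩)).summable.congr fun n => ?_
    rw [hin, norm_mul, mul_pow, Complex.norm_real, Real.norm_eq_abs, sq_abs]
  · have h2 := (hasSum_norm_sq_inner (hermiteBasis hc a) ψ).summable
    refine ((hψ.mul_left (2 / s ^ 2)).add (h2.mul_left (2 * (1 - v / s) ^ 2))).of_nonneg_of_le
      (fun n => by positivity) fun n => ?_
    rw [← mul_assoc, ← add_mul]
    gcongr
    have e : (n + 1 : ℝ) = (s * n + v) / s + (1 - v / s) := by field_simp; ring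
    calc (n + 1 : ℝ) ^ 2 = ((s * n + v) / s + (1 - v / s)) ^ 2 := by rw [← e]
      _ ≤ 2 * (((s * n + v) / s) ^ 2 + (1 - v / s) ^ 2) := add_sq_le
      _ = _ := by ring

end HermiteMatrix

/-! ### The harmonic oscillator and the perturbed position -/

section Oscillator

/-- `-d²/dx²` in terms of creation and annihilation operators. -/
lemma derivS_derivS (c a : ℝ) (f : 𝓢(ℝ, ℂ)) :
    derivS (derivS f) = ((c : ℂ) ^ 2) • (mulX (mulX f) - (2 * a : ℂ) • mulX f + (a ^ 2 : ℂ) • f) -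
      (c : ℂ) • f - raising c a (lowering c a f) := by
  simp only [raising_apply, lowering_apply, map_sub, map_add, map_smul, derivS_mulX]
  module

/-- The Hamiltonian of the harmonic oscillator on Schwartz functions. -/
noncomputable def oscillatorS (ħ m ω : ℝ) : 𝓢(ℝ, ℂ) →L[ℂ] 𝓢(ℝ, ℂ) :=
  ((1 / (2 * m) : ℝ) : ℂ) • (momentumS ħ ∘L momentumS ħ) +
    ((m * ω ^ 2 / 2 : ℝ) : ℂ) • (mulX ∘L mulX)

/-- The operator `Q + α (H - ħω/2)` on Schwartz functions. -/
noncomputable def perturbedPositionS (ħ m ω α : ℝ) : 𝓢(ℝ, ℂ) →L[ℂ] 𝓢(ℝ, ℂ) :=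
  mulX + (α : ℂ) • (oscillatorS ħ m ω - ((ħ * ω / 2 : ℝ) : ℂ) • ContinuousLinearMap.id ℂ _)

lemma schwartzAdjoint_oscillator (ħ m ω : ℝ) :
    SchwartzAdjoint (oscillator ħ m ω) (oscillatorS ħ m ω) :=
  (((schwartzAdjoint_momentum ħ).pcomp (schwartzAdjoint_momentum ħ)).smul _).add
    ((schwartzAdjoint_position.pcomp schwartzAdjoint_position).smul _)

lemma schwartzAdjoint_perturbedPosition (ħ m ω α : ℝ) :
    SchwartzAdjoint (perturbedPosition ħ m ω α) (perturbedPositionS ħ m ω α) :=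
  schwartzAdjoint_position.add
    (((schwartzAdjoint_oscillator ħ m ω).sub (SchwartzAdjoint.total_id.smul _)).smul α)

lemma raising_lowering_hermiteUnit {c : ℝ} (hc : 0 < c) (a : ℝ) (n : ℕ) :
    raising c a (lowering c a (hermiteUnit hc a n)) = (2 * c * n : ℂ) • hermiteUnit hc a n := by
  cases n with
  | zero => simp [lowering_hermiteUnit_zero]
  | succ n =>
    rw [lowering_hermiteUnit_succ, map_smul, raising_hermiteUnit, smul_smul, ← Complex.ofReal_mul,
      Real.mul_self_sqrt (by positivity)]
    push_cast
    rfl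

variable {ħ m ω : ℝ} (hħ : 0 < ħ) (hm : 0 < m) (hω : 0 < ω)

/-- The Hermite functions with `c = mω/ħ` centred at `a` are eigenfunctions of the oscillator
centred at `a`, whose Hamiltonian is `H - mω² a Q + mω² a² / 2`. -/
lemma oscillatorS_hermiteUnit (a : ℝ) (n : ℕ) :
    oscillatorS ħ m ω (hermiteUnit (div_pos (mul_pos hm hω) hħ) a n) =
      ((ħ * ω * n + ħ * ω / 2 - m * ω ^ 2 * a ^ 2 / 2 : ℝ) : ℂ) •
          hermiteUnit (div_pos (mul_pos hm hω) hħ) a n +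
        ((m * ω ^ 2 * a : ℝ) : ℂ) • mulX (hermiteUnit (div_pos (mul_pos hm hω) hħ) a n) := by
  set f := hermiteUnit (div_pos (mul_pos hm hω) hħ) a n with hf
  have hmom : momentumS ħ (momentumS ħ f) = (-ħ ^ 2 : ℂ) • derivS (derivS f) := by
    rw [momentumS, smul_apply, smul_apply, map_smul, smul_smul]
    congr 1
    linear_combination (ħ : ℂ) ^ 2 * Complex.I_mul_I
  have e : oscillatorS ħ m ω f = ((1 / (2 * m) : ℝ) : ℂ) • momentumS ħ (momentumS ħ f) +
    ((m * ω ^ 2 / 2 : ℝ) : ℂ) • mulX (mulX f) := rfl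
  rw [e, hmom, derivS_derivS (m * ω / ħ) a, hf, raising_lowering_hermiteUnit, ← hf]
  have hħ' : (ħ : ℂ) ≠ 0 := by exact_mod_cast hħ.ne'
  have hm' : (m : ℂ) ≠ 0 := by exact_mod_cast hm.ne'
  push_cast
  match_scalars <;> field_simp <;> ring

include hħ hω in
lemma isDiagonal_oscillator :
    IsDiagonal (oscillator ħ m ω) (hermiteBasis (div_pos (mul_pos hm hω) hħ) 0)
      fun n => ħ * ω * n + ħ * ω / 2 := by
  refine isDiagonal_of_schwartz _ 0 (mul_pos hħ hω) (schwartzAdjoint_oscillator ħ m ω)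
    (fun n => ?_) fun ψ h => mem_domain_oscillator _ 0 ħ m ω h
  rw [oscillatorS_hermiteUnit hħ hm hω 0 n]
  simp

/-- Completing the square, `Q'` is up to an additive constant the Hamiltonian `α H` of an
oscillator whose centre is moved to `-1 / (α m ω²)`. -/
lemma isDiagonal_perturbedPosition {α : ℝ} (hα : 0 < α) :
    IsDiagonal (perturbedPosition ħ m ω α)
      (hermiteBasis (div_pos (mul_pos hm hω) hħ) (-(1 / (α * m * ω ^ 2))))
      fun n => α * ħ * ω * n + -(1 / (2 * α * m * ω ^ 2)) := by
  refine isDiagonal_of_schwartz _ _ (mul_pos (mul_pos hα hħ) hω)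
    (schwartzAdjoint_perturbedPosition ħ m ω α) (fun n => ?_)
    fun ψ h => mem_domain_perturbedPosition _ _ ħ m ω α h
  set f := hermiteUnit (div_pos (mul_pos hm hω) hħ) (-(1 / (α * m * ω ^ 2))) n with hf
  have e : perturbedPositionS ħ m ω α f =
    mulX f + (α : ℂ) • (oscillatorS ħ m ω f - ((ħ * ω / 2 : ℝ) : ℂ) • f) := rfl
  rw [e, hf, oscillatorS_hermiteUnit hħ hm hω, ← hf]
  have hα' : (α : ℂ) ≠ 0 := by exact_mod_cast hα.ne'
  have hω' : (ω : ℂ) ≠ 0 := by exact_mod_cast hω.ne'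
  have hm' : (m : ℂ) ≠ 0 := by exact_mod_cast hm.ne'
  push_cast
  match_scalars <;> field_simp <;> ring

lemma isClosedEmbedding_affine {s : ℝ} (hs : 0 < s) (v : ℝ) :
    IsClosedEmbedding fun n : ℕ => s * n + v :=
  ((Homeomorph.mulLeft₀ s hs.ne').trans (Homeomorph.addRight v)).isClosedEmbedding.comp
    Nat.isClosedEmbedding_coe_real

end Oscillator

/-! ### Ground states -/

section GroundState

variable {ħ m ω : ℝ} (hħ : 0 < ħ) (hm : 0 < m) (hω : 0 < ω)
include hħ hm hω

lemma le_inner_oscillator (φ : (oscillator ħ m ω).domain) :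
    ħ * ω / 2 * ‖(φ : L2R)‖ ^ 2 ≤ (inner ℂ (φ : L2R) (oscillator ħ m ω φ)).re := by
  refine hasSum_le (fun n => ?_) ((hasSum_norm_sq_inner
    (hermiteBasis (div_pos (mul_pos hm hω) hħ) 0) (φ : L2R)).mul_left (ħ * ω / 2))
    ((isDiagonal_oscillator hħ hm hω).hasSum_inner_apply φ)
  gcongr
  have : 0 ≤ ħ * ω * n := by positivity
  linarith

lemma exists_isGroundState : ∃ ψ, IsGroundState (oscillator ħ m ω) ψ := by
  have hD := isDiagonal_oscillator hħ hm hω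
  refine ⟨hermiteBasis (div_pos (mul_pos hm hω) hħ) 0 0,
    (hermiteBasis (div_pos (mul_pos hm hω) hħ) 0).orthonormal.1 0, hD.basis_mem_domain 0,
    ħ * ω / 2, ?_, le_inner_oscillator hħ hm hω⟩
  rw [hD.apply_basis]
  simp

/-- The energy of every ground state is `ħω/2`: it is at most the energy of the Gaussian, and at least
the lower bound for the quadratic form. -/
lemma IsGroundState.apply {ψ : L2R} (h : IsGroundState (oscillator ħ m ω) ψ) :
    ∃ hψ : ψ ∈ (oscillator ħ m ω).domain,
      oscillator ħ m ω ⟨ψ, hψ⟩ = ((ħ * ω / 2 : ℝ) : ℂ) • ψ := by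
  obtain ⟨hψ, E, hE, hmin⟩ := h.exists_energy
  have hD := isDiagonal_oscillator hħ hm hω
  have h1 : E ≤ ħ * ω / 2 := by
    have := hmin ⟨_, hD.basis_mem_domain 0⟩
    rw [hD.apply_basis, inner_smul_right, inner_self_eq_ofReal, ← Complex.ofReal_mul,
      Complex.ofReal_re, (hermiteBasis (div_pos (mul_pos hm hω) hħ) 0).orthonormal.1 0] at this
    simpa using this
  have h2 : ħ * ω / 2 ≤ E := by
    have := le_inner_oscillator hħ hm hω ⟨ψ, hψ⟩
    rw [hE, inner_smul_right, inner_self_eq_ofReal, ← Complex.ofReal_mul,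
      Complex.ofReal_re] at this
    simpa [h.norm_eq_one] using this
  exact ⟨hψ, by rw [hE, le_antisymm h1 h2]⟩

/-- On a ground state `Q'` and `Q` agree, as `H - ħω/2` annihilates it. -/
lemma IsGroundState.perturbedPosition_apply {ψ : L2R} (h : IsGroundState (oscillator ħ m ω) ψ)
    (α : ℝ) : ∃ (h1 : ψ ∈ (perturbedPosition ħ m ω α).domain) (h2 : ψ ∈ position.domain),
      perturbedPosition ħ m ω α ⟨ψ, h1⟩ = position ⟨ψ, h2⟩ := by
  obtain ⟨hψ, hE⟩ := h.apply hħ hm hω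
  have h2 : ψ ∈ position.domain := hψ.2.1
  refine ⟨⟨h2, hψ, Submodule.mem_top⟩, h2, ?_⟩
  have e : perturbedPosition ħ m ω α ⟨ψ, h2, hψ, Submodule.mem_top⟩ = position ⟨ψ, h2⟩ +
    (α : ℂ) • (oscillator ħ m ω ⟨ψ, hψ⟩ - ((ħ * ω / 2 : ℝ) : ℂ) • ψ) := rfl
  rw [e, hE, sub_self, smul_zero, add_zero]

lemma IsGroundState.secondMoment_eq_zero {ψ : L2R} (h : IsGroundState (oscillator ħ m ω) ψ)
    (α : ℝ) : secondMoment (pureState ψ h.norm_eq_one).op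
      (perturbedPosition ħ m ω α - position) = 0 := by
  obtain ⟨h1, h2, h3⟩ := h.perturbedPosition_apply hħ hm hω α
  have hd : ψ ∈ (perturbedPosition ħ m ω α - position).domain := ⟨h1, h2⟩
  have h0 : (perturbedPosition ħ m ω α - position) ⟨ψ, hd⟩ = 0 := by
    have e : (perturbedPosition ħ m ω α - position) ⟨ψ, hd⟩ =
      perturbedPosition ħ m ω α ⟨ψ, h1⟩ - position ⟨ψ, h2⟩ := rfl
    rw [e, h3, sub_self]
  have hsa : star (pureState ψ h.norm_eq_one).op = (pureState ψ h.norm_eq_one).op :=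
    (IsSelfAdjoint.of_nonneg (pureState ψ h.norm_eq_one).nonneg).star_eq
  refine QM.secondMoment_eq_zero (S := (pureState ψ h.norm_eq_one).op)
    (R := (pureState ψ h.norm_eq_one).op) (mul_self_pureState ψ h.norm_eq_one)
    (by rw [hsa]; exact mul_self_pureState ψ h.norm_eq_one) fun x => ?_
  rw [pureState_apply]
  refine ⟨Submodule.smul_mem _ _ hd, ?_⟩
  have e := (perturbedPosition ħ m ω α - position).map_smul (inner ℂ ψ x) ⟨ψ, hd⟩
  rw [h0, smul_zero] at e
  exact e

end GroundState

/-! ### Certain and impossible events -/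

section Distribution

variable {H : Type*} [NormedAddCommGroup H] [InnerProductSpace ℂ H] [CompleteSpace H]

lemma Observable.distribution_eq_one {F : Observable H} {X : Set ℝ} (h : F.toFun X = 1)
    (ρ : DensityOperator H) : F.distribution ρ X = 1 := by
  have e : trace (ρ.op ∘L F.toFun X) = 1 := by
    rw [h]
    exact ρ.trace_one.tsum_eq
  rw [Observable.distribution, e, Complex.one_re]

lemma Observable.distribution_eq_zero {F : Observable H} {X : Set ℝ} (h : F.toFun X = 0)
    (ρ : DensityOperator H) : F.distribution ρ X = 0 := by
  rw [Observable.distribution, h, ContinuousLinearMap.comp_zero]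
  simp [trace]

end Distribution

end QM

theorem mainTheorem5 (ħ m ω α : ℝ) (hħ : 0 < ħ) (hm : 0 < m) (hω : 0 < ω) (hα : 0 < α) :
    IsSelfAdjoint (QM.perturbedPosition ħ m ω α) ∧
    (∃ C : QM.Observable QM.L2R, C.IsSpectralMeasureOf (QM.perturbedPosition ħ m ω α)) ∧
    (∃ Qs : QM.Observable QM.L2R, Qs.IsSpectralMeasureOf QM.position) ∧
    (∃ ψ₀ : QM.L2R, QM.IsGroundState (QM.oscillator ħ m ω) ψ₀) ∧
    ∀ C Qs : QM.Observable QM.L2R, C.IsSpectralMeasureOf (QM.perturbedPosition ħ m ω α) →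
      Qs.IsSpectralMeasureOf QM.position →
      (∃ M : QM.MeasurementScheme.{0} QM.L2R, M.Measures C) ∧
      (∀ (ψ₀ : QM.L2R) (hψ₀ : QM.IsGroundState (QM.oscillator ħ m ω) ψ₀),
        QM.secondMoment (QM.pureState ψ₀ hψ₀.norm_eq_one).op
          (QM.perturbedPosition ħ m ω α - QM.position) = 0 ∧
        ∀ M : QM.MeasurementScheme.{u} QM.L2R, M.Measures C →
          QM.noError QM.position M (QM.pureState ψ₀ hψ₀.norm_eq_one) = 0) ∧
      C.HasPurelyDiscreteSpectrum ∧
      Qs.HasPurelyContinuousSpectrum ∧ Qs.spectrum = Set.univ ∧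
      ∀ ρ : QM.DensityOperator QM.L2R,
        C.distribution ρ ≠ Qs.distribution ρ ∧
        ∃ S : Set ℝ, S.Countable ∧ C.distribution ρ S = 1 ∧ Qs.distribution ρ S = 0 := by
  have hD := QM.isDiagonal_perturbedPosition hħ hm hω hα
  obtain ⟨ψ₁, hψ₁⟩ := QM.exists_isGroundState hħ hm hω
  refine ⟨hD.isSelfAdjoint, hD.exists_isSpectralMeasureOf,
    QM.exists_isSpectralMeasureOf_position, ⟨ψ₁, hψ₁⟩, fun C Qs hC hQ => ?_⟩
  refine ⟨QM.MeasurementScheme.exists_measures hC hψ₁.norm_eq_one, fun ψ₀ hψ₀ => ⟨?_, ?_⟩,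
    hD.hasPurelyDiscreteSpectrum hC
      (QM.isClosedEmbedding_affine (mul_pos (mul_pos hα hħ) hω) _),
    QM.hasPurelyContinuousSpectrum_position hQ, QM.spectrum_position hQ, fun ρ => ?_⟩
  · exact hψ₀.secondMoment_eq_zero hħ hm hω α
  · intro M hM
    obtain ⟨h1, h2, h3⟩ := hψ₀.perturbedPosition_apply hħ hm hω α
    exact QM.MeasurementScheme.noError_eq_zero hD hC hQ hM hψ₀.norm_eq_one h1 h2 h3
  · -- The eigenvalues of `Q'` form the countable set that separates the two distributions.
    set S : Set ℝ := Set.range fun n : ℕ => α * ħ * ω * n + -(1 / (2 * α * m * ω ^ 2)) with hS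
    have hSc : S.Countable := Set.countable_range _
    have h1 : C.distribution ρ S = 1 := QM.Observable.distribution_eq_one
      (hD.toFun_eq_one hC hSc.measurableSet fun n => Set.mem_range_self n) ρ
    have h0 : Qs.distribution ρ S = 0 :=
      QM.Observable.distribution_eq_zero (QM.toFun_countable hQ hSc) ρ
    refine ⟨fun h => ?_, S, hSc, h1, h0⟩
    rw [h, h0] at h1
    exact zero_ne_one h1
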